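/- **Setting.** Let $f:(\mathbb R^2,0)\to(\mathbb R^4,0)$ be a smooth germ in the normal form of the $I_1$ singularity, $$f(x,y)=\Big(x,\;xy,\;\sum_{i+j=2,3}b_{ij}x^iy^j,\;c_{20}x^2+\sum_{i+j=3}c_{ij}x^iy^j\Big)+(\text{terms of order}\ge 4),\qquad b_{02}c_{03}\neq0,$$ let $M$ be its image, $p=f(0)=0$, $T_pM=\operatorname{Im} df_0$, $N_pM=(T_pM)^\perp$, and let $II(\mathbf u,\mathbf w)\in N_pM$ be the normal part of $D^2f_0(\mathbf u,\mathbf w)$. Let $E_p$ be the plane parallel to the affine hull of the curvature parabola $\{II(\mathbf u,\mathbf u):|df_0(\mathbf u)|=1\}$, and $C_pM$ the tangent cone (limits of secant lines of $M$ through $p$). If $0\ne\nu\in E_p$, $\mathbf u\neq0$ and $\langle II(\mathbf u,\mathbf w),\nu\rangle=0$ for all $\mathbf w$, then $\mathbf u$ is an asymptotic direction and $\nu$ is an associated binormal direction; $p$ is elliptic, parabolic or hyperbolic if there are $0$, $1$ or $2$ asymptotic directions (up to scalars). For a unit vector $v$ let $\Gamma_v=v^\perp$ and $h_v(x,y)=\langle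 f(x,y),v\rangle$. Type $A_k$ means right equivalent to $\pm x^{k+1}\pm y^2$, and the codimension of $h_v$ is $\dim_{\mathbb R}\mathcal E_2/\langle\partial_xh_v,\partial_yh_v\rangle$. For a smooth function $\psi$ such that $(f,\psi)$ is an immersion into $\mathbb R^5$ at $0$, let $N$ be its image and let $S$ be the regular surface obtained by projecting $N$ orthogonally to the four-space $TN\oplus E_p$ ($TN$ taken at the point over $p$). Let $\tau$ be the torsion of the normal section of $S$ tangent to an asymptotic direction $\mathbf u$. Identify the canal hypersurface of $S$ with the unit normal bundle of $S$, so that its Gauss map is $(q,n)\mapsto n$, and let $\mathcal C$ be the curve of cuspidal edge points of the Gauss map (swallowtails included): the points where the differential of the Gauss map has one-dimensional kernel and this kernel is tangent to the parabolic set $\{K_c=0\}$. "Transversal to $\mathcal C$" includes that the point belongs to $\mathcal C$ and that $\mathcal C$ is a regular curve there (its defining equations have linearisations with a one-dimensional space of solutions). Let $\delta$ be the parabolic curve of $S$, the zero set of the resultant $\frac14\big(4(l_1m_2-m_1l_2)(m_1n_2-n_1m_2)-(l_1n_2-n_1l_2)^2\big)$ of its second fundamental form; it is regular at $p$ if the differential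 of the resultant does not vanish there. A direction is transversal (tangent with first order contact) to $\delta$ at $p$ if $\delta$ is regular at $p$ and the direction is not (is) the tangent line of $\delta$. **Proposition.** Let $v=(0,v_2,v_3,0)$ be a unit vector with $v_3\neq0$. Then $\Gamma_v$ contains $T_pM$ and is transversal to $C_pM$ and to $E_p$, and $h_v$ is singular at $0$. * If $h_v$ has codimension at most $3$, its singularity is of type $A_1$, $A_2$ or $A_3$. For $k=2,3,4$, $h_v$ is of type $A_{k-1}$ if and only if it is modelled by the contact of the zero fibre of one of the submersions $\pm Z+(-1)^{k+1}X^k$ with the model surface, that is, $h_v$ or $-h_v$ is right equivalent to the composition of the submersion with $(x,y)\mapsto(x,xy,y^2,y^3)$. Each of these six models occurs for some $f$ and $v$ as above. * $h_v$ has type $A_1$ (Morse) if and only if $v$ is not a binormal direction. * (i) If $p$ is hyperbolic, $h_v$ has type $A_2$ if and only if $v$ is binormal and $\tau\neq0$, and type $A_3$ if and only if $v$ is binormal, $\tau=0$, and the asymptotic direction $\mathbf u$ associated to $v$ is transversal to $\mathcal C$ at $(p,v)$. * (ii) If $p$ is parabolic, $h_v$ has type $A_2$ if and only if $v$ is binormal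 and the associated asymptotic direction $\mathbf u$ is transversal to $\delta$. If moreover $\delta$ is a regular curve at $p$ and $h_v$ has codimension at most $3$, then $h_v$ has type $A_3$ if and only if $v$ is binormal and $\mathbf u$ is tangent to $\delta$ with first order contact. * (iii) If $p$ is elliptic, $h_v$ has type $A_1$. Parts (i) and (ii) hold for every choice of $\psi$. -/

import Mathlib

open Filter Topology
open scoped ContDiff

noncomputable section

/-- The source plane. -/
abbrev E2 : Type := EuclideanSpace ℝ (Fin 2)

/-- The target space of the singular surface. -/
abbrev E4 : Type := EuclideanSpace ℝ (Fin 4)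

/-- `ℝ⁵`, written as the orthogonal sum of `ℝ⁴` and a line. -/
abbrev E5 : Type := WithLp 2 (E4 × ℝ)

/-- `g` is of class `C^∞` on a neighbourhood of `a`. -/
def SmoothNear {X Y : Type*} [NormedAddCommGroup X] [NormedSpace ℝ X]
    [NormedAddCommGroup Y] [NormedSpace ℝ Y] (g : X → Y) (a : X) : Prop :=
  ∀ᶠ x in 𝓝 a, ContDiffAt ℝ ∞ g x

/-- The standard basis vectors of the source plane. -/
def stdVec (i : Fin 2) : E2 := EuclideanSpace.single i 1

/-- The second derivative `D²g_q(u, w)`. -/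
def secondDeriv {Y : Type*} [NormedAddCommGroup Y] [NormedSpace ℝ Y]
    (g : E2 → Y) (q u w : E2) : Y :=
  fderiv ℝ (fderiv ℝ g) q u w

section FunctionGerms

/-- A germ of a diffeomorphism `(ℝ², 0) → (ℝ², 0)`. -/
def IsDiffeoGerm (φ : E2 → E2) : Prop :=
  SmoothNear φ 0 ∧ φ 0 = 0 ∧ Function.Bijective (fderiv ℝ φ 0)

/-- Right equivalence of function germs at the origin of the plane. -/
def RightEquivalent (h g : E2 → ℝ) : Prop :=
  ∃ φ : E2 → E2, IsDiffeoGerm φ ∧ ∀ᶠ q in 𝓝 0, h (φ q) = g q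

/-- `h` has a singularity of type `A_k` at the origin: up to right equivalence it is
`h(0) ± x ^ (k + 1) ± y ^ 2`. -/
def HasTypeA (k : ℕ) (h : E2 → ℝ) : Prop :=
  ∃ ε δ : ℝ, (ε = 1 ∨ ε = -1) ∧ (δ = 1 ∨ δ = -1) ∧
    RightEquivalent h (fun q => h 0 + ε * q 0 ^ (k + 1) + δ * q 1 ^ 2)

/-- Functions on the plane that are smooth near the origin. -/
def smoothFunctions : Submodule ℝ (E2 → ℝ) where
  carrier := {g | SmoothNear g 0}
  add_mem' := by
    intro a b ha hb
    filter_upwards [ha, hb] with x hx hy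
    exact hx.add hy
  zero_mem' := Eventually.of_forall fun _ => contDiffAt_const
  smul_mem' := by
    intro c a ha
    filter_upwards [ha] with x hx
    exact contDiffAt_const.smul hx

/-- The functions whose germ at the origin lies in the Jacobian ideal
`⟨∂h/∂x, ∂h/∂y⟩` of the ring of smooth germs. -/
def jacobianIdeal (h : E2 → ℝ) : Submodule ℝ smoothFunctions where
  carrier := {g | ∃ a b : smoothFunctions, ∀ᶠ q in 𝓝 (0 : E2),
    g.1 q = a.1 q * fderiv ℝ h q (stdVec 0) + b.1 q * fderiv ℝ h q (stdVec 1)}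
  add_mem' := by
    rintro g g' ⟨a, b, hg⟩ ⟨a', b', hg'⟩
    refine ⟨a + a', b + b', ?_⟩
    filter_upwards [hg, hg'] with q h1 h2
    simp only [Submodule.coe_add, Pi.add_apply, h1, h2]
    ring
  zero_mem' := ⟨0, 0, Eventually.of_forall fun q => by simp⟩
  smul_mem' := by
    rintro c g ⟨a, b, hg⟩
    refine ⟨c • a, c • b, ?_⟩
    filter_upwards [hg] with q h1
    simp only [Submodule.coe_smul, Pi.smul_apply, smul_eq_mul, h1]
    ring

/-- The codimension (Milnor number) of the germ of `h` at the origin: the dimension of the ring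
of smooth germs modulo the Jacobian ideal. (Functions with zero germ lie in `jacobianIdeal h`,
so it does not matter that the quotient is formed before passing to germs.) -/
def codimension (h : E2 → ℝ) : Cardinal :=
  Module.rank ℝ (smoothFunctions ⧸ jacobianIdeal h)

end FunctionGerms

section ModelSurface

/-- The parametrisation `(x, xy, y², y³)` of the model surface. -/
def modelI1 (q : E2) : E4 := !₂[q 0, q 0 * q 1, q 1 ^ 2, q 1 ^ 3]

/-- The submersion `s Z + (-1) ^ (k + 1) X ^ k` on `ℝ⁴` with coordinates `(X, Y, Z, W)`. -/
def modelSubmersion (k : ℕ) (s : ℝ) (P : E4) : ℝ := s * P 2 + (-1) ^ (k + 1) * P 0 ^ k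

/-- The germ `h` is modelled by the contact of the zero fibre of
`s Z + (-1) ^ (k + 1) X ^ k` with the model surface: the composition of the submersion with the
parametrisation of the model surface is right equivalent to `h` or to `-h`
(a function and its negative have the same zero fibre). -/
def ModelledBy (h : E2 → ℝ) (k : ℕ) (s : ℝ) : Prop :=
  ∃ c : ℝ, (c = 1 ∨ c = -1) ∧
    RightEquivalent (fun q => c * h q) (fun q => modelSubmersion k s (modelI1 q))

end ModelSurface

section SingularSurface

/-- The polynomial part
`(x, xy, ∑_{i+j=2,3} b_ij x^i y^j, c_20 x² + ∑_{i+j=3} c_ij x^i y^j)`; here `b i j` and `c i j`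
stand for the coefficients `b_ij` and `c_ij`. -/
def normalFormJet (b c : ℕ → ℕ → ℝ) (q : E2) : E4 :=
  !₂[q 0,
     q 0 * q 1,
     b 2 0 * q 0 ^ 2 + b 1 1 * (q 0 * q 1) + b 0 2 * q 1 ^ 2
       + b 3 0 * q 0 ^ 3 + b 2 1 * (q 0 ^ 2 * q 1) + b 1 2 * (q 0 * q 1 ^ 2) + b 0 3 * q 1 ^ 3,
     c 2 0 * q 0 ^ 2
       + c 3 0 * q 0 ^ 3 + c 2 1 * (q 0 ^ 2 * q 1) + c 1 2 * (q 0 * q 1 ^ 2) + c 0 3 * q 1 ^ 3]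

/-- `f` is a smooth germ in the normal form of the `I_1` singularity under diffeomorphisms of
the source and isometries of the target, up to terms of order at least four. -/
def IsNormalFormI1 (f : E2 → E4) : Prop :=
  SmoothNear f 0 ∧ ∃ b c : ℕ → ℕ → ℝ, b 0 2 ≠ 0 ∧ c 0 3 ≠ 0 ∧
    (fun q => f q - normalFormJet b c q) =O[𝓝 0] fun q => ‖q‖ ^ 4

/-- The height function `h_v`. -/
def height (f : E2 → E4) (v : E4) (q : E2) : ℝ := inner ℝ (f q) v

variable (f : E2 → E4)

/-- The tangent line `T_p M`, the image of the differential at the singular point `p = f 0`. -/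
def tangentLine : Submodule ℝ E4 := LinearMap.range (fderiv ℝ f 0).toLinearMap

/-- The second fundamental form of `M` at `p`, with values in the normal hyperplane. -/
def secondFundamentalForm (u w : E2) : E4 :=
  (tangentLine f)ᗮ.starProjection (secondDeriv f 0 u w)

/-- The curvature parabola: the image of the tangent vectors that are unit for the first
fundamental form under `u ↦ II(u, u)`. -/
def curvatureParabola : Set E4 :=
  {x | ∃ u : E2, ‖fderiv ℝ f 0 u‖ = 1 ∧ x = secondFundamentalForm f u u}

/-- The plane `E_p`: the vector space parallel to the smallest affine space that contains
the curvature parabola (which is a non-degenerate parabola for an `I_1` singularity). -/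
def planeE : Submodule ℝ E4 := (affineSpan ℝ (curvatureParabola f)).direction

/-- `u` is an asymptotic direction of `M` at `p` and `ν` is a binormal direction
associated to it. -/
def IsAsymptoticFor (u : E2) (ν : E4) : Prop :=
  u ≠ 0 ∧ ν ≠ 0 ∧ ν ∈ planeE f ∧ ∀ w : E2, inner ℝ (secondFundamentalForm f u w) ν = 0

/-- `ν` is a binormal direction of `M` at `p`. -/
def IsBinormal (ν : E4) : Prop := ∃ u : E2, IsAsymptoticFor f u ν

/-- The asymptotic directions of `M` at `p`, as lines of the tangent plane of the source. -/
def asymptoticDirections : Set (Submodule ℝ E2) :=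
  {L | ∃ (u : E2) (ν : E4), IsAsymptoticFor f u ν ∧ L = Submodule.span ℝ {u}}

/-- `p` is elliptic: there are no asymptotic directions. -/
def IsEllipticPoint : Prop := asymptoticDirections f = ∅

/-- `p` is hyperbolic: there are two asymptotic directions. -/
def IsHyperbolicPoint : Prop := (asymptoticDirections f).encard = 2

/-- `p` is parabolic: there is one asymptotic direction. -/
def IsParabolicPoint : Prop := (asymptoticDirections f).encard = 1

/-- The tangent cone `C_p M`: the union of the limits of the secant lines of `M` through `p`. -/
def tangentConeM : Set E4 :=
  {w | ∃ (a : ℕ → ℝ) (q : ℕ → E2), Tendsto q atTop (𝓝 0) ∧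
    Tendsto (fun n => a n • (f (q n) - f 0)) atTop (𝓝 w)}

/-- The hyperplane `Γ_v` through `p = 0` orthogonal to `v`. -/
def hyperplane (v : E4) : Submodule ℝ E4 := (Submodule.span ℝ {v})ᗮ

end SingularSurface

section RegularSurface

/-! Regular surfaces in a Euclidean space `F` (of dimension four), given by a
parametrisation `r` defined near the origin of the plane. -/

variable {F : Type*} [NormedAddCommGroup F] [InnerProductSpace ℝ F]

/-- The tangent plane at the point with parameter `q`. -/
def tangentPlane (r : E2 → F) (q : E2) : Submodule ℝ F :=
  LinearMap.range (fderiv ℝ r q).toLinearMap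

/-- The second fundamental form at the point with parameter `q`: the normal component of the
second derivative. -/
def regularII [FiniteDimensional ℝ F] (r : E2 → F) (q u w : E2) : F :=
  (tangentPlane r q)ᗮ.starProjection (secondDeriv r q u w)

/-- `t ↦ r (c t)` parametrises, near `t = 0`, the normal section of the surface tangent to the
direction `u`: the intersection of the surface with the affine space through `r 0` spanned by
`u` and the normal plane. -/
def IsNormalSection (r : E2 → F) (u : E2) (c : ℝ → E2) : Prop :=
  SmoothNear c 0 ∧ c 0 = 0 ∧ deriv c 0 = u ∧
    ∀ᶠ t in 𝓝 (0 : ℝ),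
      r (c t) - r 0 ∈ Submodule.span ℝ {fderiv ℝ r 0 u} ⊔ (tangentPlane r 0)ᗮ

/-- The absolute value of the torsion at `t = 0` of a curve `γ` in a Euclidean `3`-space,
`|det (γ', γ'', γ''')| / |γ' × γ''| ^ 2`, written with Gram determinants. -/
def curveTorsion (γ : ℝ → F) : ℝ :=
  Real.sqrt (Matrix.gram ℝ
      ![iteratedDeriv 1 γ 0, iteratedDeriv 2 γ 0, iteratedDeriv 3 γ 0]).det /
    (Matrix.gram ℝ ![iteratedDeriv 1 γ 0, iteratedDeriv 2 γ 0]).det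

/-- The normal section of the surface at `r 0` tangent to `u` has torsion `τ`
(up to sign). -/
def HasNormalTorsion (r : E2 → F) (u : E2) (τ : ℝ) : Prop :=
  ∃ c : ℝ → E2, IsNormalSection r u c ∧ curveTorsion (fun t => r (c t)) = τ

/-- `(q, n)` is a point of the unit normal bundle of the surface. The canal hypersurface
`CS(ε) = {r q + ε n}` is identified with the unit normal bundle by `r q + ε n ↔ (q, n)`; its
Gauss map is then `(q, n) ↦ n`. -/
def IsUnitNormal (r : E2 → F) (P : E2 × F) : Prop :=
  (∀ w : E2, inner ℝ (fderiv ℝ r P.1 w) P.2 = 0) ∧ ‖P.2‖ = 1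

/-- The functions that define the unit normal bundle (their common zero set is
`IsUnitNormal r`). -/
def unitNormalEq (r : E2 → F) (P : E2 × F) : (Fin 2 → ℝ) × ℝ :=
  (fun i => inner ℝ (fderiv ℝ r P.1 (stdVec i)) P.2, ‖P.2‖ ^ 2 - 1)

/-- The matrix of the second fundamental form along `n` at `q` (the Hessian at `q` of the height
function in the direction `n`). -/
def normalHessian (r : E2 → F) (P : E2 × F) : Matrix (Fin 2) (Fin 2) ℝ :=
  Matrix.of fun i j => inner ℝ (secondDeriv r P.1 (stdVec i) (stdVec j)) P.2

/-- On the unit normal bundle, up to a nowhere vanishing smooth factor, the Gauss-Kronecker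
curvature of the canal hypersurface. -/
def gaussKronecker (r : E2 → F) (P : E2 × F) : ℝ := (normalHessian r P).det

/-- The vectors `w` for which `(w, 0)` is in the kernel of the differential of the
Gauss map `(q, n) ↦ n` of the canal hypersurface: these are the `w` for which `(w, 0)` is
tangent to the unit normal bundle. -/
def gaussKernel (r : E2 → F) (P : E2 × F) : Set E2 :=
  {w | ∀ w' : E2, inner ℝ (secondDeriv r P.1 w w') P.2 = 0}

/-- The curve `𝒞` of cuspidal edge points of the Gauss map, including its special points, the
swallowtails: the points at which the differential of the Gauss map has one-dimensional kernel
(so that they are in the parabolic set, the zero set of the Gauss-Kronecker curvature) and the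
kernel is tangent to the parabolic set. -/
def cuspidalEdgeCurve (r : E2 → F) : Set (E2 × F) :=
  {P | IsUnitNormal r P ∧ (∃ w : E2, w ≠ 0 ∧ gaussKernel r P = {x | ∃ a : ℝ, x = a • w}) ∧
    ∀ w ∈ gaussKernel r P, fderiv ℝ (gaussKronecker r) P (w, 0) = 0}

/-- The equation of the curve of cuspidal edge points inside the parabolic set. Where the Hessian
matrix `B` has rank one, its adjugate is a nonzero multiple of `w wᵀ`, with `w` spanning
the kernel, and so this vector is a nonzero multiple of `dK(w, 0) w`. -/
def cuspidalEdgeEq (r : E2 → F) (P : E2 × F) : Fin 2 → ℝ :=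
  Matrix.mulVec (normalHessian r P).adjugate
    (fun i => fderiv ℝ (gaussKronecker r) P (stdVec i, 0))

/-- The tangent space of `𝒞` at `P`: the solutions of the linearised equations of `𝒞` (those of
the unit normal bundle, of the parabolic set, and of `𝒞` inside it). -/
def cuspidalEdgeTangent (r : E2 → F) (P : E2 × F) : Submodule ℝ (E2 × F) :=
  LinearMap.ker (fderiv ℝ (unitNormalEq r) P).toLinearMap ⊓
    LinearMap.ker (fderiv ℝ (gaussKronecker r) P).toLinearMap ⊓
    LinearMap.ker (fderiv ℝ (cuspidalEdgeEq r) P).toLinearMap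

/-- `P` is on `𝒞`, `𝒞` is a regular curve at `P` (its linearised equations define a
line), and the direction `u`, regarded as the tangent vector `(u, 0)` of the canal hypersurface,
is transversal to it. -/
def TransversalToCuspidalEdge (r : E2 → F) (P : E2 × F) (u : E2) : Prop :=
  P ∈ cuspidalEdgeCurve r ∧ Module.finrank ℝ (cuspidalEdgeTangent r P) = 1 ∧
    (u, (0 : F)) ∉ cuspidalEdgeTangent r P

/-- For vectors `a b c d` of a plane (such as the normal plane),
`det (a, b) * det (c, d)`, the determinants being taken in any orthonormal basis of the plane. -/
def areaProduct (a b c d : F) : ℝ :=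
  inner ℝ a c * inner ℝ b d - inner ℝ a d * inner ℝ b c

theorem areaProduct_eq (e₁ e₂ : F) (h : Orthonormal ℝ ![e₁, e₂]) (a b c d : Fin 2 → ℝ) :
    areaProduct (a 0 • e₁ + a 1 • e₂) (b 0 • e₁ + b 1 • e₂) (c 0 • e₁ + c 1 • e₂)
      (d 0 • e₁ + d 1 • e₂) =
    (a 0 * b 1 - a 1 * b 0) * (c 0 * d 1 - c 1 * d 0) := by
  have h1 : inner ℝ e₁ e₁ = (1 : ℝ) := by
    have := h.1 0
    simp only [Matrix.cons_val_zero] at this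
    rw [real_inner_self_eq_norm_sq, this]; norm_num
  have h2 : inner ℝ e₂ e₂ = (1 : ℝ) := by
    have := h.1 1
    simp only [Matrix.cons_val_one, Matrix.cons_val_zero] at this
    rw [real_inner_self_eq_norm_sq, this]; norm_num
  have h3 : inner ℝ e₁ e₂ = (0 : ℝ) := by
    have := h.2 (i := 0) (j := 1) (by decide)
    simpa using this
  have h4 : inner ℝ e₂ e₁ = (0 : ℝ) := by rw [real_inner_comm]; exact h3
  simp only [areaProduct, inner_add_left, inner_add_right, real_inner_smul_left,
    real_inner_smul_right, h1, h2, h3, h4]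
  ring

/-- The resultant `¼ (4 (l₁ m₂ - m₁ l₂) (m₁ n₂ - n₁ m₂) - (l₁ n₂ - n₁ l₂) ^ 2)` of the two
quadratic forms of the second fundamental form, where `(l₁, l₂)`, `(m₁, m₂)`, `(n₁, n₂)` are
the components of `II(∂x, ∂x)`, `II(∂x, ∂y)`, `II(∂y, ∂y)` in an orthonormal basis of
the normal plane. By `areaProduct_eq` the basis does not matter. -/
def resultant [FiniteDimensional ℝ F] (r : E2 → F) (q : E2) : ℝ :=
  let A := regularII r q (stdVec 0) (stdVec 0)
  let B := regularII r q (stdVec 0) (stdVec 1)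
  let C := regularII r q (stdVec 1) (stdVec 1)
  (1 / 4) * (4 * areaProduct A B B C - areaProduct A C A C)

/-- The parabolic set `δ` (the zero set of the resultant) passes through `r 0` and is a regular
curve there: zero is not a critical value. -/
def ParabolicCurveRegular [FiniteDimensional ℝ F] (r : E2 → F) : Prop :=
  resultant r 0 = 0 ∧ fderiv ℝ (resultant r) 0 ≠ 0

/-- The tangent line of the parabolic curve at `r 0`, in the tangent plane of the parameters. -/
def parabolicTangent [FiniteDimensional ℝ F] (r : E2 → F) : Submodule ℝ E2 :=
  LinearMap.ker (fderiv ℝ (resultant r) 0).toLinearMap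

/-- The parabolic curve is regular at `r 0` and `u` is transversal to it. -/
def TransversalToParabolicCurve [FiniteDimensional ℝ F] (r : E2 → F) (u : E2) : Prop :=
  ParabolicCurveRegular r ∧ u ∉ parabolicTangent r

/-- The parabolic curve is regular at `r 0` and `u` is tangent to it: the direction and the
curve have first order contact (the same `1`-jet). -/
def TangentToParabolicCurve [FiniteDimensional ℝ F] (r : E2 → F) (u : E2) : Prop :=
  ParabolicCurveRegular r ∧ u ∈ parabolicTangent r

end RegularSurface

section AssociatedSurface

variable (f : E2 → E4) (ψ : E2 → ℝ)

/-- The surface `N` in `ℝ⁵` above `M`: the orthogonal projection of `ℝ⁵` to `ℝ⁴` maps it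
to `M`. -/
def liftN (q : E2) : E5 := WithLp.toLp 2 (f q, ψ q)

/-- `liftN f ψ` is a smooth immersion near the origin, so that `N` is a regular surface and `M`
is its projection along a direction that is tangent to it (by necessity,
as `f` is not an immersion). -/
def IsLift : Prop := SmoothNear ψ 0 ∧ Function.Injective (fderiv ℝ (liftN f ψ) 0)

/-- The inclusion of `ℝ⁴` in `ℝ⁵`. -/
def inclusion45 : E4 →ₗ[ℝ] E5 :=
  (WithLp.linearEquiv 2 ℝ (E4 × ℝ)).symm.toLinearMap ∘ₗ LinearMap.inl ℝ E4 ℝ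

/-- The four-space spanned by the tangent plane of `N` and the plane `E_p`. -/
def assocSpace : Submodule ℝ E5 :=
  LinearMap.range (fderiv ℝ (liftN f ψ) 0).toLinearMap ⊔ (planeE f).map inclusion45

/-- The regular surface `S` associated to `M` and `N`: the orthogonal projection of `N` to the
four-space `assocSpace f ψ`. -/
def assocSurface (q : E2) : assocSpace f ψ :=
  (assocSpace f ψ).orthogonalProjectionOnto (liftN f ψ q)

/-- The direction in the four-space of `S` that corresponds to the direction `v`. -/
def assocDirection (v : E4) : assocSpace f ψ :=
  (assocSpace f ψ).orthogonalProjectionOnto (inclusion45 v)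

end AssociatedSurface

end

/-!
The normal form gives `h_v = v₂ xy + v₃ (b₂₀ x² + b₁₁ xy + b₀₂ y²) + ⋯`, so that
`∂²h_v/∂y² ≠ 0` at the origin: the Hessian has corank at most one, and everything reduces to
counting how far the function degenerates along its kernel.

*Germs.* Let `h` be singular at `0` with `h_yy ≠ 0`. The equation `h_y = 0` defines a curve
`y = η(x)`, and the residual `g(x) = h(x, η(x))` carries the singularity: Hadamard's lemma, applied
twice, writes `h = g(x) + (y - η)² U`, so `h` has type `A_k` as soon as `g` vanishes to order exactly
`k + 1` (a splitting lemma). Conversely, type `A_k` is detected by an invariant of right equivalence,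
the existence of a regular curve along which `dh = O(t ^ k)` (`HasContactCurve`); the same curve
shows that codimension at most three forces type `A_1`, `A_2` or `A_3`, because
`1, x, x², x³` stay independent modulo the Jacobian ideal when `dh = O(t ^ 4)` along the curve.
The derivatives of `g` are then expressed without `η`: `g''` is the Hessian determinant `K` up to the
factor `h_yy`; if `u` spans the kernel of the Hessian then `g'''` is `D³h(u, u, u)` up to a nonzero
factor; and if this vanishes, `g''''` is the derivative along `u` of the first component
`h_yy K_x - h_xy K_y` of `adj(Hess h) ∇K` (`hessCusp`). These are `hasTypeA_one_iff`,
`hasTypeA_two_iff` and `hasTypeA_three_iff`.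

*Geometry.* For `v` in the plane `E_p`, the height function of `M` along `v` is the height function
of the regular surface `S` along the corresponding normal direction
(`inner_assocSurface`, `IsAssociated`), and `E_p` is the whole normal plane of `S` at `p`. It remains
to read the three conditions on a regular surface in a four-space:

* the derivatives of the normal section along `u` of orders one, two and three are linearly dependent
  if and only if `D³h(u, u, u) = 0`, provided that `II(u, u) ≠ 0` (`curveTorsion_eq_zero_iff`);
* with the same proviso the equations of the cuspidal edge curve restrict to independent equations on
  the tangent space of the unit normal bundle, and `u` is transversal to their solutions exactly when
  `hessCusp` has nonzero derivative along `u` (`transversalToCuspidalEdge_iff`);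
* if `II(u, u) = 0`, the derivative along `u` of the resultant is a nonzero multiple of
  `D³h(u, u, u)` (`exists_fderiv_resultant`).

Finally `p` is hyperbolic only if `b₂₀ ≠ 0`, in which case the asymptotic directions are transversal
to both axes and the `xy` term of `f` gives `II(u, u) ≠ 0`; it is parabolic only if `b₂₀ = 0`, in
which case `u` is the `x` axis and `II(u, u) = 0`.
-/

noncomputable section

/-! ### Germs of smooth maps -/

namespace SmoothNear

variable {X Y Z : Type*} [NormedAddCommGroup X] [NormedSpace ℝ X]
  [NormedAddCommGroup Y] [NormedSpace ℝ Y] [NormedAddCommGroup Z] [NormedSpace ℝ Z]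
  {g g' : X → Y} {a : X}

theorem contDiffAt (h : SmoothNear g a) : ContDiffAt ℝ ∞ g a := h.self_of_nhds

theorem differentiableAt (h : SmoothNear g a) : DifferentiableAt ℝ g a :=
  h.contDiffAt.differentiableAt (by simp)

theorem continuousAt (h : SmoothNear g a) : ContinuousAt g a := h.contDiffAt.continuousAt

theorem eventually (h : SmoothNear g a) : ∀ᶠ x in 𝓝 a, SmoothNear g x := eventually_nhds_iff.1 h |>
  fun ⟨s, hs, hso, has⟩ => eventually_nhds_iff.2 ⟨s, fun _ hy => eventually_nhds_iff.2
    ⟨s, hs, hso, hy⟩, hso, has⟩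

theorem congr (h : SmoothNear g a) (hg : g' =ᶠ[𝓝 a] g) : SmoothNear g' a := by
  filter_upwards [h, hg.eventuallyEq_nhds] with x hx hx'
  exact hx.congr_of_eventuallyEq hx'

theorem fderiv (h : SmoothNear g a) : SmoothNear (fderiv ℝ g) a := by
  filter_upwards [h] with x hx
  exact hx.fderiv_right (by simp)

theorem comp {k : Y → Z} (hk : SmoothNear k (g a)) (h : SmoothNear g a) :
    SmoothNear (fun x => k (g x)) a := by
  filter_upwards [h, h.continuousAt.eventually hk] with x hx hx'
  exact hx'.comp x hx

theorem sub (h : SmoothNear g a) (h' : SmoothNear g' a) : SmoothNear (fun x => g x - g' x) a := by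
  filter_upwards [h, h'] with x hx hx' using hx.sub hx'

theorem mul {k k' : X → ℝ} (h : SmoothNear k a) (h' : SmoothNear k' a) :
    SmoothNear (fun x => k x * k' x) a := by
  filter_upwards [h, h'] with x hx hx' using hx.mul hx'

theorem prodMk {k : X → Z} (h : SmoothNear g a) (h' : SmoothNear k a) :
    SmoothNear (fun x => (g x, k x)) a := by
  filter_upwards [h, h'] with x hx hx' using hx.prodMk hx'

theorem clm_apply {k : X → Y →L[ℝ] Z} (h : SmoothNear k a) (h' : SmoothNear g a) :
    SmoothNear (fun x => k x (g x)) a := by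
  filter_upwards [h, h'] with x hx hx' using hx.clm_apply hx'

theorem inner {F : Type*} [NormedAddCommGroup F] [InnerProductSpace ℝ F] {k k' : X → F}
    (h : SmoothNear k a) (h' : SmoothNear k' a) : SmoothNear (fun x => inner ℝ (k x) (k' x)) a := by
  filter_upwards [h, h'] with x hx hx' using hx.inner ℝ hx'

end SmoothNear

theorem ContDiff.smoothNear {X Y : Type*} [NormedAddCommGroup X] [NormedSpace ℝ X]
    [NormedAddCommGroup Y] [NormedSpace ℝ Y] {g : X → Y} (h : ContDiff ℝ ∞ g) (a : X) :
    SmoothNear g a := Eventually.of_forall fun _ => h.contDiffAt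

/-- Every smooth germ is the germ of a globally smooth map. -/
theorem SmoothNear.exists_contDiff {X Y : Type*} [NormedAddCommGroup X] [NormedSpace ℝ X]
    [FiniteDimensional ℝ X] [NormedAddCommGroup Y] [NormedSpace ℝ Y]
    {g : X → Y} {a : X} (h : SmoothNear g a) :
    ∃ G : X → Y, ContDiff ℝ ∞ G ∧ G =ᶠ[𝓝 a] g := by
  obtain ⟨ε, hε, hs⟩ := Metric.eventually_nhds_iff_ball.1 h
  let β : ContDiffBump a := ⟨ε / 4, ε / 2, by positivity, by linarith⟩
  refine ⟨fun x => β x • g x, contDiff_iff_contDiffAt.2 fun x => ?_, ?_⟩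
  · by_cases hx : x ∈ tsupport β
    · rw [β.tsupport_eq] at hx
      refine β.contDiff.contDiffAt.smul (hs x ?_)
      exact Metric.closedBall_subset_ball (by change ε / 2 < ε; linarith) hx
    · have h0 : (fun x => β x • g x) =ᶠ[𝓝 x] fun _ => 0 := by
        filter_upwards [notMem_tsupport_iff_eventuallyEq.1 hx] with y hy
        simp [hy]
      exact contDiffAt_const.congr_of_eventuallyEq h0
  · filter_upwards [β.eventuallyEq_one] with x hx
    simp [hx]

/-- The inverse function theorem for smooth germs. -/
theorem SmoothNear.exists_inverse {X Y : Type*} [NormedAddCommGroup X] [NormedSpace ℝ X]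
    [CompleteSpace X] [NormedAddCommGroup Y] [NormedSpace ℝ Y] [CompleteSpace Y]
    {g : X → Y} {a : X} (h : SmoothNear g a) (hb : Function.Bijective (_root_.fderiv ℝ g a)) :
    ∃ k : Y → X, SmoothNear k (g a) ∧ k (g a) = a ∧ (∀ᶠ y in 𝓝 (g a), g (k y) = y) ∧
      (∀ᶠ x in 𝓝 a, k (g x) = x) ∧ Function.Bijective (_root_.fderiv ℝ k (g a)) := by
  let L : X ≃L[ℝ] Y := ContinuousLinearEquiv.ofBijective (_root_.fderiv ℝ g a)
    (LinearMap.ker_eq_bot.2 hb.1) (LinearMap.range_eq_top.2 hb.2)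
  have hL : HasFDerivAt g (L : X →L[ℝ] Y) a := by
    have : (L : X →L[ℝ] Y) = _root_.fderiv ℝ g a := by ext x; rfl
    rw [this]; exact h.differentiableAt.hasFDerivAt
  have hn : (∞ : WithTop ℕ∞) ≠ 0 := by simp
  let e := h.contDiffAt.toOpenPartialHomeomorph g hL hn
  have ha : a ∈ e.source := h.contDiffAt.mem_toOpenPartialHomeomorph_source hL hn
  have hga : g a ∈ e.target := h.contDiffAt.image_mem_toOpenPartialHomeomorph_target hL hn
  have hsa : e.symm (g a) = a := e.left_inv ha
  have hcont : ContinuousAt e.symm (g a) := e.continuousAt_symm hga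
  have hinv : ∀ᶠ x in 𝓝 a, (_root_.fderiv ℝ g x) ∈ Set.range ((↑) : (X ≃L[ℝ] Y) → X →L[ℝ] Y) := by
    have h0 : Tendsto (_root_.fderiv ℝ g) (𝓝 a) (𝓝 (L : X →L[ℝ] Y)) := by
      rw [← hL.fderiv]; exact h.fderiv.continuousAt
    exact h0.eventually (ContinuousLinearEquiv.nhds L)
  have hright : ∀ᶠ y in 𝓝 (g a), g (e.symm y) = y := by
    filter_upwards [e.open_target.mem_nhds hga] with y hy using e.right_inv hy
  have hleft : ∀ᶠ x in 𝓝 a, e.symm (g x) = x := by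
    filter_upwards [e.open_source.mem_nhds ha] with y hy using e.left_inv hy
  have hsm : SmoothNear e.symm (g a) := by
    have h1 : Tendsto e.symm (𝓝 (g a)) (𝓝 a) := by
      have := hcont.tendsto; rwa [hsa] at this
    filter_upwards [e.open_target.mem_nhds hga, h1.eventually h, h1.eventually hinv] with y hy h2 h3
    obtain ⟨L', hL'⟩ := h3
    refine e.contDiffAt_symm (f₀' := L') hy ?_ h2
    rw [hL']
    exact (h2.differentiableAt (by simp)).hasFDerivAt
  refine ⟨e.symm, hsm, hsa, hright, hleft, ?_⟩
  have hd := hsm.differentiableAt.hasFDerivAt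
  have h1 : HasFDerivAt (fun x => e.symm (g x)) ((_root_.fderiv ℝ e.symm (g a)).comp (L : X →L[ℝ] Y)) a :=
    hd.comp a hL
  have h2 : (_root_.fderiv ℝ e.symm (g a)).comp (L : X →L[ℝ] Y) = ContinuousLinearMap.id ℝ X :=
    h1.unique ((hasFDerivAt_id a).congr_of_eventuallyEq hleft)
  have h3 : ⇑(_root_.fderiv ℝ e.symm (g a)) = L.symm := by
    funext y
    have := congrArg (fun T : X →L[ℝ] X => T (L.symm y)) h2
    simpa using this
  rw [h3]
  exact L.symm.bijective

/-! ### Smooth division -/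

section Division

open MeasureTheory

/-- Differentiation under the integral sign. -/
theorem hasFDerivAt_parametric_integral {E V : Type} [NormedAddCommGroup E] [NormedSpace ℝ E]
    [FiniteDimensional ℝ E] [NormedAddCommGroup V] [NormedSpace ℝ V] [CompleteSpace V]
    {G : E × ℝ → V} (hG : ContDiff ℝ 1 G) (x : E) :
    HasFDerivAt (fun x => ∫ t in (0 : ℝ)..1, G (x, t))
      (∫ t in (0 : ℝ)..1, (fderiv ℝ G (x, t)).comp (ContinuousLinearMap.inl ℝ E ℝ)) x := by
  have hc : Continuous fun p : E × ℝ => (fderiv ℝ G p).comp (ContinuousLinearMap.inl ℝ E ℝ) :=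
    (hG.continuous_fderiv (by simp)).clm_comp continuous_const
  obtain ⟨C, hC⟩ := ((isCompact_closedBall x 1).prod
    (isCompact_Icc (a := (0 : ℝ)) (b := 1))).exists_bound_of_continuousOn hc.continuousOn
  refine intervalIntegral.hasFDerivAt_integral_of_dominated_of_fderiv_le
    (F := fun x t => G (x, t))
    (F' := fun x t => (fderiv ℝ G (x, t)).comp (ContinuousLinearMap.inl ℝ E ℝ))
    (bound := fun _ => C)
    (Metric.closedBall_mem_nhds x one_pos) ?_ ?_ ?_ ?_ ?_ ?_
  · exact Eventually.of_forall fun y =>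
      (hG.continuous.comp (Continuous.prodMk_right y)).aestronglyMeasurable
  · exact (hG.continuous.comp (Continuous.prodMk_right x)).intervalIntegrable _ _
  · exact (hc.comp (Continuous.prodMk_right x)).aestronglyMeasurable
  · refine Eventually.of_forall fun t ht y hy => hC (y, t) ⟨hy, ?_⟩
    rw [Set.uIoc_of_le zero_le_one] at ht
    exact ⟨ht.1.le, ht.2⟩
  · exact intervalIntegrable_const
  · refine Eventually.of_forall fun t _ y _ => ?_
    exact ((hG.differentiable (by simp)) (y, t)).hasFDerivAt.comp y (hasFDerivAt_prodMk_left y t)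

theorem contDiff_parametric_integral {E : Type} [NormedAddCommGroup E] [NormedSpace ℝ E]
    [FiniteDimensional ℝ E] (n : ℕ) : ∀ {V : Type} [NormedAddCommGroup V] [NormedSpace ℝ V]
    [CompleteSpace V] {G : E × ℝ → V}, ContDiff ℝ ∞ G →
      ContDiff ℝ n (fun x => ∫ t in (0 : ℝ)..1, G (x, t)) := by
  induction n with
  | zero =>
    intro V _ _ _ G hG
    refine contDiff_zero.2 (continuous_iff_continuousAt.2 fun x => ?_)
    exact (hasFDerivAt_parametric_integral (hG.of_le (by simp)) x).continuousAt
  | succ n ih =>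
    intro V _ _ _ G hG
    have h1 : ContDiff ℝ 1 G := hG.of_le (by simp)
    push_cast
    refine (contDiff_succ_iff_fderiv (n := n)).2
      ⟨fun x => (hasFDerivAt_parametric_integral h1 x).differentiableAt, by simp, ?_⟩
    have : fderiv ℝ (fun x => ∫ t in (0 : ℝ)..1, G (x, t)) = fun x => ∫ t in (0 : ℝ)..1,
        (fun p : E × ℝ => (fderiv ℝ G p).comp (ContinuousLinearMap.inl ℝ E ℝ)) (x, t) := by
      funext x; exact (hasFDerivAt_parametric_integral h1 x).fderiv
    rw [this]
    exact ih ((hG.fderiv_right (by simp)).clm_comp contDiff_const)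

/-- Hadamard's lemma: a smooth function `H (x, y)` is `H (x, 0)` plus `y` times a smooth
function, namely `∫₀¹ ∂H/∂y (x, t y) dt`. -/
theorem exists_smooth_quotient {E : Type} [NormedAddCommGroup E] [NormedSpace ℝ E]
    [FiniteDimensional ℝ E] {H : E × ℝ → ℝ} (hH : ContDiff ℝ ∞ H) :
    ∃ U : E × ℝ → ℝ, ContDiff ℝ ∞ U ∧ ∀ x y, H (x, y) = H (x, 0) + y * U (x, y) := by
  let G : (E × ℝ) × ℝ → ℝ := fun p => fderiv ℝ H (p.1.1, p.2 * p.1.2) (0, 1)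
  have hG : ContDiff ℝ ∞ G := by
    have h1 : ContDiff ℝ ∞ (fderiv ℝ H) := hH.fderiv_right (by simp)
    refine (h1.comp ?_).clm_apply contDiff_const
    fun_prop
  refine ⟨fun p => ∫ t in (0 : ℝ)..1, G (p, t),
    contDiff_infty.2 fun n => contDiff_parametric_integral n hG, fun x y => ?_⟩
  have hd : ∀ t ∈ Set.uIcc (0 : ℝ) 1,
      HasDerivAt (fun t : ℝ => H (x, t * y)) (y * G ((x, y), t)) t := by
    intro t _
    have h1 := ((hH.differentiable (by simp)) (x, t * y)).hasFDerivAt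
    have h2 : HasDerivAt (fun t : ℝ => (x, t * y)) ((0 : E), y) t := by
      refine (hasDerivAt_const t x).prodMk ?_
      simpa using (hasDerivAt_id t).mul_const y
    have h3 := h1.comp_hasDerivAt t h2
    have h4 : ((0 : E), y) = y • ((0 : E), (1 : ℝ)) := by simp
    rw [h4, map_smul, smul_eq_mul] at h3
    exact h3
  have hint : IntervalIntegrable (fun t => y * G ((x, y), t)) volume 0 1 :=
    (continuous_const.mul (hG.continuous.comp (Continuous.prodMk_right _))).intervalIntegrable _ _
  have := intervalIntegral.integral_eq_sub_of_hasDerivAt hd hint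
  rw [intervalIntegral.integral_const_mul] at this
  simp only [one_mul, zero_mul] at this
  linarith

end Division

/-! ### The splitting lemma in the plane -/

theorem E2.eq_of_coord {q : E2} : q = q 0 • stdVec 0 + q 1 • stdVec 1 := by
  ext i; fin_cases i <;> simp [stdVec]

theorem E2.mk_eq (x y : ℝ) : (!₂[x, y] : E2) = x • stdVec 0 + y • stdVec 1 := by
  ext i; fin_cases i <;> simp [stdVec]

theorem hasFDerivAt_coord (i : Fin 2) (q : E2) :
    HasFDerivAt (fun q : E2 => q i) (EuclideanSpace.proj i : E2 →L[ℝ] ℝ) q :=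
  (EuclideanSpace.proj i : E2 →L[ℝ] ℝ).hasFDerivAt

theorem contDiff_coord (i : Fin 2) : ContDiff ℝ ∞ (fun q : E2 => q i) :=
  (EuclideanSpace.proj i : E2 →L[ℝ] ℝ).contDiff

theorem contDiff_mk {E : Type*} [NormedAddCommGroup E] [NormedSpace ℝ E] {a b : E → ℝ}
    (ha : ContDiff ℝ ∞ a) (hb : ContDiff ℝ ∞ b) : ContDiff ℝ ∞ (fun p => (!₂[a p, b p] : E2)) := by
  simp only [E2.mk_eq]
  exact (ha.smul contDiff_const).add (hb.smul contDiff_const)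

theorem hasDerivAt_mk {a b : ℝ → ℝ} {a' b' t : ℝ} (ha : HasDerivAt a a' t)
    (hb : HasDerivAt b b' t) : HasDerivAt (fun t => (!₂[a t, b t] : E2)) !₂[a', b'] t := by
  simp only [E2.mk_eq]
  exact (ha.smul_const _).add (hb.smul_const _)

theorem hasFDerivAt_fderiv_apply {X Y : Type*} [NormedAddCommGroup X] [NormedSpace ℝ X]
    [NormedAddCommGroup Y] [NormedSpace ℝ Y] {h : X → Y} {q : X}
    (hh : SmoothNear h q) (w : X) :
    HasFDerivAt (fun q => fderiv ℝ h q w) ((fderiv ℝ (fderiv ℝ h) q).flip w) q := by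
  have := hh.fderiv.differentiableAt.hasFDerivAt.clm_apply (hasFDerivAt_const w q)
  simpa using this

theorem secondDeriv_symm {Y : Type*} [NormedAddCommGroup Y] [NormedSpace ℝ Y] {h : E2 → Y}
    {q : E2} (hh : SmoothNear h q) (u w : E2) : secondDeriv h q u w = secondDeriv h q w u :=
  (hh.contDiffAt.isSymmSndFDerivAt (by
    simpa using WithTop.coe_le_coe.2 (le_top : (2 : ℕ∞) ≤ ⊤))).eq u w

/-- The curve `y = η x` consists of the critical points of the restrictions of `h` to the vertical
lines, and `g` is the restriction of `h` to this curve (the residual part of `h` in the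
splitting lemma). Both are taken globally smooth; only their germs matter. -/
structure IsResidual (h : E2 → ℝ) (η g : ℝ → ℝ) : Prop where
  smooth_curve : ContDiff ℝ ∞ η
  curve_zero : η 0 = 0
  smooth_res : ContDiff ℝ ∞ g
  res_eq : ∀ᶠ x in 𝓝 0, g x = h !₂[x, η x]
  crit : ∀ᶠ x in 𝓝 0, fderiv ℝ h !₂[x, η x] (stdVec 1) = 0

/-- The implicit function theorem, applied to `∂h/∂y = 0`. -/
theorem exists_isResidual {h : E2 → ℝ} (hh : SmoothNear h 0) (h0 : fderiv ℝ h 0 = 0)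
    (hyy : secondDeriv h 0 (stdVec 1) (stdVec 1) ≠ 0) : ∃ η g, IsResidual h η g := by
  let Ψ : E2 → ℝ × ℝ := fun q => (q 0, fderiv ℝ h q (stdVec 1))
  have hΨ : SmoothNear Ψ 0 :=
    ((contDiff_coord 0).smoothNear 0).prodMk (hh.fderiv.clm_apply (contDiff_const.smoothNear 0))
  have hΨ0 : Ψ 0 = 0 := by simp [Ψ, h0]
  have hd : HasFDerivAt Ψ ((EuclideanSpace.proj 0 : E2 →L[ℝ] ℝ).prod
      ((fderiv ℝ (fderiv ℝ h) 0).flip (stdVec 1))) 0 :=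
    (hasFDerivAt_coord 0 0).prodMk (hasFDerivAt_fderiv_apply hh _)
  have hinj : Function.Injective (fderiv ℝ Ψ 0) := by
    rw [injective_iff_map_eq_zero, hd.fderiv]
    intro w hw
    simp only [ContinuousLinearMap.prod_apply, Prod.mk_eq_zero,
      ContinuousLinearMap.flip_apply] at hw
    obtain ⟨hw0, hw1⟩ : w 0 = 0 ∧ _ := hw
    rw [E2.eq_of_coord (q := w), hw0, zero_smul, zero_add, map_smul] at hw1
    have : w 1 = 0 := (mul_eq_zero.1 hw1).resolve_right hyy
    rw [E2.eq_of_coord (q := w), hw0, this]; simp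
  have hbij : Function.Bijective (fderiv ℝ Ψ 0) :=
    ⟨hinj, (LinearMap.injective_iff_surjective_of_finrank_eq_finrank
      (f := (fderiv ℝ Ψ 0).toLinearMap) (by simp)).1 hinj⟩
  obtain ⟨k, hk, hk0, hright, -, -⟩ := hΨ.exists_inverse hbij
  rw [hΨ0] at hk hk0 hright
  have hline : ContDiff ℝ ∞ (fun x : ℝ => ((x, 0) : ℝ × ℝ)) := by fun_prop
  have hη : SmoothNear (fun x : ℝ => k (x, 0) 1) 0 :=
    SmoothNear.comp ((contDiff_coord 1).smoothNear _)
      (SmoothNear.comp (g := fun x : ℝ => ((x, 0) : ℝ × ℝ)) hk (hline.smoothNear 0))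
  obtain ⟨η, hηs, hηe⟩ := hη.exists_contDiff
  have hη0 : η 0 = 0 := by
    rw [hηe.self_of_nhds]
    have : k ((0 : ℝ), 0) = 0 := hk0
    simp [this]
  have hc : ContDiff ℝ ∞ (fun x : ℝ => (!₂[x, η x] : E2)) := contDiff_mk contDiff_id hηs
  have hc0 : (!₂[(0 : ℝ), η 0] : E2) = 0 := by
    rw [hη0]; ext i; fin_cases i <;> simp
  have hg : SmoothNear (fun x : ℝ => h !₂[x, η x]) 0 :=
    SmoothNear.comp (g := fun x : ℝ => (!₂[x, η x] : E2)) (by rw [hc0]; exact hh) (hc.smoothNear 0)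
  obtain ⟨g, hgs, hge⟩ := hg.exists_contDiff
  refine ⟨η, g, hηs, hη0, hgs, hge, ?_⟩
  have hev : ∀ᶠ x in 𝓝 (0 : ℝ), Ψ (k (x, 0)) = (x, 0) :=
    (hline.continuous.tendsto' 0 0 rfl).eventually hright
  filter_upwards [hηe, hev] with x hx hx'
  have h1 : k (x, 0) 0 = x := congrArg Prod.fst hx'
  have h2 : fderiv ℝ h (k (x, 0)) (stdVec 1) = 0 := congrArg Prod.snd hx'
  have : (!₂[x, η x] : E2) = k (x, 0) := by
    ext i; fin_cases i
    · simp [h1]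
    · simp [hx]
  rw [this, h2]

namespace IsResidual

variable {h : E2 → ℝ} {η g : ℝ → ℝ} (H : IsResidual h η g)
include H

theorem contDiff_curve : ContDiff ℝ ∞ (fun x : ℝ => (!₂[x, η x] : E2)) :=
  contDiff_mk contDiff_id H.smooth_curve

theorem curve_at_zero : (!₂[(0 : ℝ), η 0] : E2) = 0 := by
  rw [H.curve_zero]; ext i; fin_cases i <;> simp

theorem tendsto_curve : Tendsto (fun x : ℝ => (!₂[x, η x] : E2)) (𝓝 0) (𝓝 0) :=
  H.contDiff_curve.continuous.tendsto' 0 0 H.curve_at_zero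

theorem hasDerivAt_curve (x : ℝ) :
    HasDerivAt (fun x : ℝ => (!₂[x, η x] : E2)) !₂[1, deriv η x] x :=
  hasDerivAt_mk (hasDerivAt_id x) (H.smooth_curve.differentiable (by simp) x).hasDerivAt

/-- Completing the square. -/
theorem exists_split (hh : SmoothNear h 0) :
    ∃ U : ℝ × ℝ → ℝ, ContDiff ℝ ∞ U ∧
      (∀ᶠ q in 𝓝 (0 : E2), h q = g (q 0) + (q 1 - η (q 0)) ^ 2 * U (q 0, q 1 - η (q 0))) ∧
      2 * U (0, 0) = secondDeriv h 0 (stdVec 1) (stdVec 1) := by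
  obtain ⟨k, hk, hkh⟩ := hh.exists_contDiff
  have hηs := H.smooth_curve
  let G : ℝ × ℝ → ℝ := fun p => k !₂[p.1, p.2 + η p.1]
  have hG : ContDiff ℝ ∞ G :=
    hk.comp (contDiff_mk contDiff_fst (contDiff_snd.add (hηs.comp contDiff_fst)))
  obtain ⟨U₁, hU₁, hGU₁⟩ := exists_smooth_quotient hG
  obtain ⟨U, hU, hU₁U⟩ := exists_smooth_quotient hU₁
  have hkd : ∀ᶠ q in 𝓝 (0 : E2), fderiv ℝ k q = fderiv ℝ h q := hkh.fderiv
  -- the linear term of the expansion along the critical curve vanishes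
  have hlin : ∀ᶠ x in 𝓝 (0 : ℝ), U₁ (x, 0) = 0 := by
    filter_upwards [H.crit, H.tendsto_curve.eventually hkd] with x hx hx'
    have h1 : HasDerivAt (fun y => G (x, y)) (U₁ (x, 0)) 0 := by
      have : (fun y => G (x, y)) = fun y => G (x, 0) + y * U₁ (x, y) := by
        funext y; exact hGU₁ x y
      rw [this]
      have h2 : DifferentiableAt ℝ (fun y => U₁ (x, y)) 0 :=
        (hU₁.differentiable (by simp)).comp (differentiable_const x |>.prodMk differentiable_id) 0
      have := ((hasDerivAt_id (0 : ℝ)).mul h2.hasDerivAt).const_add (G (x, 0))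
      simpa using this
    have h3 : HasDerivAt (fun y => G (x, y)) (fderiv ℝ k !₂[x, η x] (stdVec 1)) 0 := by
      have h4 : HasDerivAt (fun y : ℝ => (!₂[x, y + η x] : E2)) (stdVec 1) 0 := by
        have := hasDerivAt_mk (hasDerivAt_const (0 : ℝ) x)
          ((hasDerivAt_id (0 : ℝ)).add_const (η x))
        simpa [E2.mk_eq] using this
      have h5 := (hk.differentiable (by simp) (!₂[x, 0 + η x])).hasFDerivAt.comp_hasDerivAt 0 h4
      simpa [Function.comp_def] using h5
    rw [h1.unique h3, hx', hx]
  have hcoord0 : Tendsto (fun q : E2 => q 0) (𝓝 0) (𝓝 0) :=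
    (contDiff_coord 0).continuous.tendsto' 0 0 (by simp)
  have hsplit : ∀ᶠ q in 𝓝 (0 : E2),
      h q = g (q 0) + (q 1 - η (q 0)) ^ 2 * U (q 0, q 1 - η (q 0)) := by
    filter_upwards [hkh, hcoord0.eventually hlin, hcoord0.eventually H.res_eq,
      (H.tendsto_curve.comp hcoord0).eventually hkh] with q h1 h2 h3 h4
    have h5 : (!₂[q 0, (q 1 - η (q 0)) + η (q 0)] : E2) = q := by
      ext i; fin_cases i <;> simp
    have h6 : G (q 0, q 1 - η (q 0)) = h q := by simp only [G, h5, h1]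
    have h7 : G (q 0, 0) = g (q 0) := by
      simp only [G, zero_add]; rw [h3]; exact h4
    rw [← h6, hGU₁, h7, hU₁U, h2]; ring
  refine ⟨U, hU, hsplit, ?_⟩
  have hv : HasDerivAt (fun y : ℝ => (!₂[0, y] : E2)) (stdVec 1) 0 := by
    have := hasDerivAt_mk (hasDerivAt_const (0 : ℝ) 0) (hasDerivAt_id (0 : ℝ))
    simpa [E2.mk_eq] using this
  have hv0 : (!₂[(0 : ℝ), 0] : E2) = 0 := by ext i; fin_cases i <;> simp
  have hvt : Tendsto (fun y : ℝ => (!₂[0, y] : E2)) (𝓝 0) (𝓝 0) := by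
    have := hv.continuousAt.tendsto; rwa [hv0] at this
  have hUy : ContDiff ℝ ∞ (fun y => U (0, y)) := hU.comp (contDiff_const.prodMk contDiff_id)
  have e1 : HasDerivAt (fun y : ℝ => fderiv ℝ h !₂[0, y] (stdVec 1))
      (secondDeriv h 0 (stdVec 1) (stdVec 1)) 0 := by
    have := hasFDerivAt_fderiv_apply (q := !₂[(0 : ℝ), 0]) (by rw [hv0]; exact hh) (stdVec 1)
    have := this.comp_hasDerivAt 0 hv
    rw [hv0] at this
    exact this
  have e2 : (fun y : ℝ => fderiv ℝ h !₂[0, y] (stdVec 1)) =ᶠ[𝓝 0]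
      fun y => y * (2 * U (0, y) + y * deriv (fun y => U (0, y)) y) := by
    filter_upwards [hvt.eventually hh.eventually, hvt.eventually hsplit.eventually_nhds]
      with y hy hy'
    have hvy : HasDerivAt (fun y : ℝ => (!₂[0, y] : E2)) (stdVec 1) y := by
      have := hasDerivAt_mk (hasDerivAt_const y (0 : ℝ)) (hasDerivAt_id y)
      simpa [E2.mk_eq] using this
    have a1 : HasDerivAt (fun y : ℝ => h !₂[0, y]) (fderiv ℝ h !₂[0, y] (stdVec 1)) y :=
      hy.differentiableAt.hasFDerivAt.comp_hasDerivAt y hvy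
    have a2 : (fun y : ℝ => h !₂[0, y]) =ᶠ[𝓝 y] fun y => g 0 + y ^ 2 * U (0, y) := by
      filter_upwards [hvy.continuousAt.eventually hy'] with z hz
      rw [hz]; simp [H.curve_zero]
    have a3 : HasDerivAt (fun y => g 0 + y ^ 2 * U (0, y))
        (2 * y * U (0, y) + y ^ 2 * deriv (fun y => U (0, y)) y) y := by
      have := ((hasDerivAt_pow 2 y).mul
        (hUy.differentiable (by simp) y).hasDerivAt).const_add (g 0)
      simpa using this
    rw [a1.unique (a3.congr_of_eventuallyEq a2)]; ring
  have e3 : HasDerivAt (fun y : ℝ => y * (2 * U (0, y) + y * deriv (fun y => U (0, y)) y))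
      (2 * U (0, 0)) 0 := by
    have hdU : DifferentiableAt ℝ (deriv (fun y => U (0, y))) 0 := by
      have : ContDiff ℝ 1 (deriv (fun y => U (0, y))) :=
        ((contDiff_infty_iff_deriv.1 hUy).2).of_le (by simp)
      exact this.differentiable (by simp) 0
    have hF : DifferentiableAt ℝ (fun y : ℝ => 2 * U (0, y) + y * deriv (fun y => U (0, y)) y) 0 :=
      ((hUy.differentiable (by simp) 0).const_mul 2).add (differentiableAt_id.mul hdU)
    have := (hasDerivAt_id (0 : ℝ)).fun_mul hF.hasDerivAt
    simpa using this
  exact e3.unique (e1.congr_of_eventuallyEq e2.symm)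

end IsResidual

/-! ### Factoring out the order of vanishing -/

theorem iteratedDeriv_succ_id_mul {w : ℝ → ℝ} (hw : ContDiff ℝ ∞ w) (i : ℕ) :
    iteratedDeriv (i + 1) (fun x => x * w x) =
      fun x => x * iteratedDeriv (i + 1) w x + (i + 1) * iteratedDeriv i w x := by
  have hd : ∀ j x, HasDerivAt (iteratedDeriv j w) (iteratedDeriv (j + 1) w x) x := by
    intro j x
    rw [iteratedDeriv_succ]
    exact (hw.differentiable_iteratedDeriv j (by exact_mod_cast WithTop.coe_lt_top _) x).hasDerivAt
  induction i with
  | zero =>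
    funext x
    rw [zero_add, iteratedDeriv_one]
    have := (hasDerivAt_id x).fun_mul (hd 0 x)
    simp only [iteratedDeriv_zero, zero_add, id] at this
    rw [this.deriv]
    simp; ring
  | succ i ih =>
    funext x
    rw [iteratedDeriv_succ, ih]
    have := ((hasDerivAt_id x).mul (hd (i + 1) x)).add ((hd i x).const_mul ((i : ℝ) + 1))
    rw [show (fun x => x * iteratedDeriv (i + 1) w x + ((i : ℝ) + 1) * iteratedDeriv i w x) =
      (id * iteratedDeriv (i + 1) w + fun y => ((i : ℝ) + 1) * iteratedDeriv i w y) from rfl,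
      this.deriv]
    simp; ring

/-- Hadamard's lemma on the line, with the Taylor coefficients of the quotient. -/
theorem exists_mul_of_smooth {g : ℝ → ℝ} (hg : ContDiff ℝ ∞ g) :
    ∃ w : ℝ → ℝ, ContDiff ℝ ∞ w ∧ (∀ x, g x = g 0 + x * w x) ∧
      ∀ i : ℕ, iteratedDeriv (i + 1) g 0 = (i + 1) * iteratedDeriv i w 0 := by
  obtain ⟨U, hU, hgU⟩ := exists_smooth_quotient (H := fun p : ℝ × ℝ => g p.2) (hg.comp contDiff_snd)
  have hw : ContDiff ℝ ∞ (fun y => U (0, y)) := hU.comp (contDiff_const.prodMk contDiff_id)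
  have he : ∀ x, g x = g 0 + x * U (0, x) := fun x => hgU 0 x
  refine ⟨fun y => U (0, y), hw, he, fun i => ?_⟩
  have h1 : deriv g = deriv (fun x => x * U (0, x)) := by
    have : g = fun x => g 0 + x * U (0, x) := funext he
    funext x
    conv_lhs => rw [this]
    exact deriv_const_add _
  rw [iteratedDeriv_succ', h1, ← iteratedDeriv_succ', iteratedDeriv_succ_id_mul hw]
  simp

theorem exists_pow_mul_of_smooth (n : ℕ) : ∀ {g : ℝ → ℝ}, ContDiff ℝ ∞ g →
    (∀ i < n, iteratedDeriv i g 0 = 0) →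
    ∃ w : ℝ → ℝ, ContDiff ℝ ∞ w ∧ (∀ x, g x = x ^ n * w x) ∧
      iteratedDeriv n g 0 = n.factorial * w 0 := by
  induction n with
  | zero => exact fun {g} hg _ => ⟨g, hg, by simp, by simp⟩
  | succ n ih =>
    intro g hg h0
    obtain ⟨w, hw, hgw, hd⟩ := exists_mul_of_smooth hg
    have hg0 : g 0 = 0 := by simpa using h0 0 (by omega)
    obtain ⟨w', hw', hww', hd'⟩ := ih hw fun i hi => by
      have := hd i
      rw [h0 (i + 1) (by omega)] at this
      exact (mul_eq_zero.1 this.symm).resolve_left (by positivity)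
    refine ⟨w', hw', fun x => by rw [hgw, hg0, hww']; ring, ?_⟩
    rw [hd, hd', Nat.factorial_succ]; push_cast; ring

/-! ### Recognition of the singularities `A_k` -/

theorem SmoothNear.rpow_const {X : Type*} [NormedAddCommGroup X] [NormedSpace ℝ X] {P : X → ℝ}
    {a : X} (hP : SmoothNear P a) (h0 : 0 < P a) (s : ℝ) : SmoothNear (fun x => P x ^ s) a := by
  filter_upwards [hP, hP.continuousAt.eventually (lt_mem_nhds h0)] with x hx hx'
  exact hx.rpow_const_of_ne hx'.ne'

theorem exists_sign_mul_pos {a : ℝ} (ha : a ≠ 0) : ∃ ε : ℝ, (ε = 1 ∨ ε = -1) ∧ 0 < ε * a := by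
  rcases lt_or_gt_of_ne ha with h | h
  · exact ⟨-1, Or.inr rfl, by linarith⟩
  · exact ⟨1, Or.inl rfl, by linarith⟩

namespace IsResidual

variable {h : E2 → ℝ} {η g : ℝ → ℝ} (H : IsResidual h η g)
include H

theorem res_zero : g 0 = h 0 := by
  rw [H.res_eq.self_of_nhds, H.curve_at_zero]

/-- If the residual part of `h` vanishes to the exact order `k + 1`, then taking roots of the two
nonvanishing factors in `h = h 0 + x ^ (k + 1) w + (y - η x) ^ 2 U` brings `h` to the normal form
of `A_k`. -/
theorem hasTypeA (hh : SmoothNear h 0) (hyy : secondDeriv h 0 (stdVec 1) (stdVec 1) ≠ 0) {k : ℕ}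
    (hvan : ∀ i, 1 ≤ i → i ≤ k → iteratedDeriv i g 0 = 0) (hne : iteratedDeriv (k + 1) g 0 ≠ 0) :
    HasTypeA k h := by
  obtain ⟨w₁, hw₁, hgw₁, hd₁⟩ := exists_mul_of_smooth H.smooth_res
  obtain ⟨w, hw, hw₁w, hd⟩ := exists_pow_mul_of_smooth k hw₁ fun i hi => by
    have := hd₁ i
    rw [hvan (i + 1) (by omega) (by omega)] at this
    exact (mul_eq_zero.1 this.symm).resolve_left (by positivity)
  have hw0 : w 0 ≠ 0 := by
    intro h0
    apply hne
    rw [hd₁, hd, h0]; simp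
  obtain ⟨U, hU, hsplit, hU0⟩ := H.exists_split hh
  have hU0 : U (0, 0) ≠ 0 := by
    intro h0; apply hyy; rw [← hU0, h0]; simp
  obtain ⟨ε, hε, hεw⟩ := exists_sign_mul_pos hw0
  obtain ⟨δ, hδ, hδU⟩ := exists_sign_mul_pos hU0
  have hηs := H.smooth_curve
  have hx := contDiff_coord 0
  have hy : ContDiff ℝ ∞ (fun q : E2 => q 1 - η (q 0)) := (contDiff_coord 1).sub (hηs.comp hx)
  let a : E2 → ℝ := fun q => (ε * w (q 0)) ^ (((k + 1 : ℕ) : ℝ)⁻¹)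
  let b : E2 → ℝ := fun q => (δ * U (q 0, q 1 - η (q 0))) ^ (((2 : ℕ) : ℝ)⁻¹)
  have hP : SmoothNear (fun q : E2 => ε * w (q 0)) 0 :=
    (contDiff_const.mul (hw.comp hx)).smoothNear 0
  have hQ : SmoothNear (fun q : E2 => δ * U (q 0, q 1 - η (q 0))) 0 :=
    (contDiff_const.mul (hU.comp (hx.prodMk hy))).smoothNear 0
  have hP0 : 0 < ε * w ((0 : E2) 0) := by simpa using hεw
  have hQ0 : 0 < δ * U ((0 : E2) 0, (0 : E2) 1 - η ((0 : E2) 0)) := by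
    simpa [H.curve_zero] using hδU
  have ha : SmoothNear a 0 := hP.rpow_const hP0 _
  have hb : SmoothNear b 0 := hQ.rpow_const hQ0 _
  have ha0 : a 0 ≠ 0 := (Real.rpow_pos_of_pos hP0 _).ne'
  have hb0 : b 0 ≠ 0 := (Real.rpow_pos_of_pos hQ0 _).ne'
  let Φ : E2 → E2 := fun q => !₂[q 0 * a q, (q 1 - η (q 0)) * b q]
  have hΦeq : Φ = fun q => (q 0 * a q) • stdVec 0 + ((q 1 - η (q 0)) * b q) • stdVec 1 := by
    funext q; exact E2.mk_eq _ _
  have hΦ : SmoothNear Φ 0 := by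
    have h1 := (hx.smoothNear 0).mul ha
    have h2 := (hy.smoothNear 0).mul hb
    rw [hΦeq]
    filter_upwards [h1, h2] with q h1 h2
    exact (h1.smul contDiffAt_const).add (h2.smul contDiffAt_const)
  have hΦ0 : Φ 0 = 0 := by
    rw [hΦeq]; simp [H.curve_zero]
  have hη' : HasFDerivAt (fun q : E2 => η (q 0))
      (deriv η 0 • (EuclideanSpace.proj 0 : E2 →L[ℝ] ℝ)) 0 := by
    have h1 : HasDerivAt η (deriv η 0) ((0 : E2) 0) :=
      (hηs.differentiable (by simp) 0).hasDerivAt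
    exact h1.comp_hasFDerivAt (0 : E2) (hasFDerivAt_coord 0 0)
  have hdΦ : ∀ u : E2, fderiv ℝ Φ 0 u =
      (a 0 * u 0) • stdVec 0 + (b 0 * (u 1 - deriv η 0 * u 0)) • stdVec 1 := by
    intro u
    have h1 := (hasFDerivAt_coord 0 (0 : E2)).fun_mul ha.differentiableAt.hasFDerivAt
    have h2 := ((hasFDerivAt_coord 1 (0 : E2)).fun_sub hη').fun_mul hb.differentiableAt.hasFDerivAt
    have h3 := (h1.smul_const (𝕜' := ℝ) (stdVec 0)).fun_add (h2.smul_const (𝕜' := ℝ) (stdVec 1))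
    rw [hΦeq, h3.fderiv]
    simp [H.curve_zero]
  have hinj : Function.Injective (fderiv ℝ Φ 0) := by
    rw [injective_iff_map_eq_zero]
    intro u hu
    rw [hdΦ, ← E2.mk_eq] at hu
    have h1 : a 0 * u 0 = 0 := by simpa using congrArg (fun q : E2 => q 0) hu
    have h2 : b 0 * (u 1 - deriv η 0 * u 0) = 0 := by simpa using congrArg (fun q : E2 => q 1) hu
    have h3 := (mul_eq_zero.1 h1).resolve_left ha0
    have h4 := (mul_eq_zero.1 h2).resolve_left hb0
    rw [h3, mul_zero, sub_zero] at h4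
    rw [E2.eq_of_coord (q := u), h3, h4]; simp
  have hbij : Function.Bijective (fderiv ℝ Φ 0) :=
    ⟨hinj, (LinearMap.injective_iff_surjective (f := (fderiv ℝ Φ 0).toLinearMap)).1 hinj⟩
  obtain ⟨φ, hφ, hφ0, hright, -, hφb⟩ := hΦ.exists_inverse hbij
  rw [hΦ0] at hφ hφ0 hright hφb
  refine ⟨ε, δ, hε, hδ, φ, ⟨hφ, hφ0, hφb⟩, ?_⟩
  have hnf : ∀ᶠ q in 𝓝 (0 : E2), h q = h 0 + ε * Φ q 0 ^ (k + 1) + δ * Φ q 1 ^ 2 := by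
    filter_upwards [hsplit, hP.continuousAt.eventually (lt_mem_nhds hP0),
      hQ.continuousAt.eventually (lt_mem_nhds hQ0)] with q h1 h2 h3
    have hε2 : ε * ε = 1 := by rcases hε with h | h <;> rw [h] <;> norm_num
    have hδ2 : δ * δ = 1 := by rcases hδ with h | h <;> rw [h] <;> norm_num
    have e1 : a q ^ (k + 1) = ε * w (q 0) := Real.rpow_inv_natCast_pow h2.le (by omega)
    have e2 : b q ^ 2 = δ * U (q 0, q 1 - η (q 0)) := Real.rpow_inv_natCast_pow h3.le (by omega)
    have e3 : Φ q 0 = q 0 * a q := by simp [Φ]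
    have e4 : Φ q 1 = (q 1 - η (q 0)) * b q := by simp [Φ]
    rw [h1, e3, e4, mul_pow, mul_pow, e1, e2, hgw₁, hw₁w, H.res_zero]
    linear_combination (-(q 0 ^ (k + 1) * w (q 0))) * hε2 -
      ((q 1 - η (q 0)) ^ 2 * U (q 0, q 1 - η (q 0))) * hδ2
  have ht : Tendsto φ (𝓝 0) (𝓝 0) := by
    have := hφ.continuousAt.tendsto; rwa [hφ0] at this
  filter_upwards [ht.eventually hnf, hright] with q h1 h2
  rw [h1, h2]

theorem deriv_res (hh : SmoothNear h 0) :
    ∀ᶠ x in 𝓝 0, deriv g x = fderiv ℝ h !₂[x, η x] (stdVec 0) := by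
  filter_upwards [H.res_eq.eventually_nhds, H.crit, H.tendsto_curve.eventually hh.eventually]
    with x h1 h2 h3
  have h4 := h3.differentiableAt.hasFDerivAt.comp_hasDerivAt x (H.hasDerivAt_curve x)
  have h5 : g =ᶠ[𝓝 x] h ∘ fun x => !₂[x, η x] := h1
  rw [h5.deriv_eq, h4.deriv, E2.mk_eq (1 : ℝ), map_add, map_smul, map_smul, h2]
  simp

/-- Along the critical curve the differential of `h` is `g'(x) dx`. -/
theorem isBigO_fderiv (hh : SmoothNear h 0) {k : ℕ}
    (hvan : ∀ i, 1 ≤ i → i ≤ k → iteratedDeriv i g 0 = 0) :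
    (fun t : ℝ => fderiv ℝ h !₂[t, η t]) =O[𝓝 0] fun t => t ^ k := by
  have hg' : ContDiff ℝ ∞ (deriv g) := (contDiff_infty_iff_deriv.1 H.smooth_res).2
  obtain ⟨w, hw, hgw, -⟩ := exists_pow_mul_of_smooth k hg' fun i hi => by
    rw [← iteratedDeriv_succ']; exact hvan _ (by omega) (by omega)
  have h1 : (fun t : ℝ => fderiv ℝ h !₂[t, η t]) =ᶠ[𝓝 0]
      fun t => t ^ k • (w t • (EuclideanSpace.proj 0 : E2 →L[ℝ] ℝ)) := by
    filter_upwards [H.deriv_res hh, H.crit] with t h1 h2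
    ext q
    rw [E2.eq_of_coord (q := q), map_add, map_smul, map_smul, h2, ← h1, hgw]
    simp [stdVec]; ring
  refine h1.trans_isBigO ?_
  have h2 : (fun t => w t • (EuclideanSpace.proj 0 : E2 →L[ℝ] ℝ)) =O[𝓝 0] fun _ => (1 : ℝ) :=
    ((hw.continuous.smul continuous_const).tendsto 0).isBigO_one ℝ
  simpa using (Asymptotics.isBigO_refl (fun t : ℝ => t ^ k) (𝓝 0)).smul h2

end IsResidual

/-- There is a regular curve through the origin along which the differential of `h` is of
order `t ^ k`. This property of a germ is invariant under right equivalence, and it separates the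
singularities `A_k`. -/
def HasContactCurve (k : ℕ) (h : E2 → ℝ) : Prop :=
  ∃ (γ : ℝ → E2) (u : E2), u ≠ 0 ∧ γ 0 = 0 ∧ HasDerivAt γ u 0 ∧
    (fun t => fderiv ℝ h (γ t)) =O[𝓝 0] fun t => t ^ k

theorem isBigO_pow_of_le {j k : ℕ} (hjk : j ≤ k) :
    (fun t : ℝ => t ^ k) =O[𝓝 0] fun t => t ^ j := by
  refine Asymptotics.IsBigO.of_bound 1 ?_
  filter_upwards [Metric.ball_mem_nhds (0 : ℝ) one_pos] with t ht
  have : |t| ≤ 1 := by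
    rw [mem_ball_zero_iff, Real.norm_eq_abs] at ht; exact ht.le
  simpa using pow_le_pow_of_le_one (abs_nonneg t) this hjk

theorem HasContactCurve.mono {j k : ℕ} {h : E2 → ℝ} (hk : HasContactCurve k h) (hjk : j ≤ k) :
    HasContactCurve j h := by
  obtain ⟨γ, u, hu, h0, hd, hO⟩ := hk
  exact ⟨γ, u, hu, h0, hd, hO.trans (isBigO_pow_of_le hjk)⟩

/-- Contact curves are transported by right equivalences. -/
theorem HasContactCurve.comp {k : ℕ} {h g : E2 → ℝ} {κ φ : E2 → E2}
    (hc : HasContactCurve k g) (hg : SmoothNear g 0) (hκ : SmoothNear κ 0) (hφ : IsDiffeoGerm φ)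
    (hκφ : ∀ᶠ q in 𝓝 0, κ (φ q) = q) (hh : ∀ᶠ q in 𝓝 0, h q = g (κ q)) : HasContactCurve k h := by
  obtain ⟨γ, u, hu, h0, hd, hO⟩ := hc
  obtain ⟨hφs, hφ0, hφb⟩ := hφ
  have hκ0 : κ 0 = 0 := by
    have := hκφ.self_of_nhds; rwa [hφ0] at this
  have hdφ : HasDerivAt (fun t => φ (γ t)) (fderiv ℝ φ 0 u) 0 := by
    have h1 := hφs.differentiableAt.hasFDerivAt
    rw [← h0] at h1
    have := h1.comp_hasDerivAt 0 hd
    rwa [h0] at this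
  have hγt : Tendsto γ (𝓝 0) (𝓝 0) := by
    have := hd.continuousAt.tendsto; rwa [h0] at this
  have hφt : Tendsto (fun t => φ (γ t)) (𝓝 0) (𝓝 0) := by
    have := hdφ.continuousAt.tendsto; rwa [h0, hφ0] at this
  refine ⟨fun t => φ (γ t), fderiv ℝ φ 0 u, ?_, by simp [h0, hφ0], hdφ, ?_⟩
  · intro h; exact hu ((injective_iff_map_eq_zero _).1 hφb.1 u h)
  have h1 : (fun t => fderiv ℝ h (φ (γ t))) =ᶠ[𝓝 0]
      fun t => (fderiv ℝ g (γ t)).comp (fderiv ℝ κ (φ (γ t))) := by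
    filter_upwards [hφt.eventually hh.eventually_nhds, hφt.eventually hκ.eventually,
      hγt.eventually hg.eventually, hγt.eventually hκφ] with t h1 h2 h3 h4
    have h5 : h =ᶠ[𝓝 (φ (γ t))] fun q => g (κ q) := h1
    have h6 : HasFDerivAt g (fderiv ℝ g (γ t)) (κ (φ (γ t))) := by
      rw [h4]; exact h3.differentiableAt.hasFDerivAt
    rw [h5.fderiv_eq]
    exact (h6.comp _ h2.differentiableAt.hasFDerivAt).fderiv
  refine h1.trans_isBigO ?_
  have h2 : (fun t => fderiv ℝ κ (φ (γ t))) =O[𝓝 0] fun _ => (1 : ℝ) :=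
    (hκ.fderiv.continuousAt.tendsto.comp hφt).isBigO_one ℝ
  have h3 : (fun t => (fderiv ℝ g (γ t)).comp (fderiv ℝ κ (φ (γ t)))) =O[𝓝 0]
      fun t => ‖fderiv ℝ g (γ t)‖ * ‖fderiv ℝ κ (φ (γ t))‖ :=
    Asymptotics.IsBigO.of_bound 1 (Eventually.of_forall fun t => by
      simpa using ContinuousLinearMap.opNorm_comp_le _ _)
  refine h3.trans ?_
  simpa using hO.norm_left.mul h2.norm_left

/-- A power `a ^ m` that vanishes to higher order than `t ^ m` has a base with zero derivative. -/
theorem eq_zero_of_pow_isBigO {a : ℝ → ℝ} {a' : ℝ} (ha : HasDerivAt a a' 0) (h0 : a 0 = 0) {m : ℕ}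
    (hO : (fun t => a t ^ m) =O[𝓝 0] fun t => t ^ (m + 1)) : a' = 0 := by
  have h1 : Tendsto (fun t => (t⁻¹ * a t) ^ m) (𝓝[≠] 0) (𝓝 (a' ^ m)) := by
    have := (hasDerivAt_iff_tendsto_slope.1 ha).pow m
    refine this.congr fun t => ?_
    simp [slope_def_field, h0, div_eq_inv_mul]
  have h2 : (fun t => (t⁻¹ * a t) ^ m) =O[𝓝[≠] 0] fun t : ℝ => t := by
    have h3 : (fun t : ℝ => (t⁻¹) ^ m * a t ^ m) =O[𝓝[≠] 0] fun t => (t⁻¹) ^ m * t ^ (m + 1) :=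
      (Asymptotics.isBigO_refl _ _).mul (hO.mono nhdsWithin_le_nhds)
    refine (h3.congr' ?_ ?_)
    · exact Eventually.of_forall fun t => by simp [mul_pow]
    · filter_upwards [self_mem_nhdsWithin] with t ht
      have ht' : t ≠ 0 := ht
      rw [pow_succ, ← mul_assoc, ← mul_pow, inv_mul_cancel₀ ht', one_pow, one_mul]
  have h3 : Tendsto (fun t : ℝ => t) (𝓝[≠] 0) (𝓝 0) := nhdsWithin_le_nhds
  by_contra hne
  exact pow_ne_zero m hne (tendsto_nhds_unique h1 (h2.trans_tendsto h3))

theorem hasFDerivAt_normalForm (c ε δ : ℝ) (k : ℕ) (q : E2) :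
    HasFDerivAt (fun q : E2 => c + ε * q 0 ^ (k + 1) + δ * q 1 ^ 2)
      ((ε * ((k + 1) * q 0 ^ k)) • (EuclideanSpace.proj 0 : E2 →L[ℝ] ℝ) +
        (δ * (2 * q 1)) • (EuclideanSpace.proj 1 : E2 →L[ℝ] ℝ)) q := by
  have h1 := ((hasFDerivAt_coord 0 q).pow (k + 1)).const_mul ε
  have h2 := ((hasFDerivAt_coord 1 q).pow 2).const_mul δ
  have h3 := (h1.const_add c).add h2
  refine h3.congr_fderiv ?_
  ext w; simp; ring

/-- Contact curves determine `k`: along the `x` axis the differential of `±x ^ (k + 1) ± y ^ 2` is of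
order `k`, and order `k + 1` along a curve would force both components of its velocity to vanish. -/
theorem HasTypeA.contact {k : ℕ} (hk : 1 ≤ k) {h : E2 → ℝ} (hA : HasTypeA k h)
    (hh : SmoothNear h 0) : HasContactCurve k h ∧ ¬ HasContactCurve (k + 1) h := by
  obtain ⟨ε, δ, hε, hδ, φ, ⟨hφ, hφ0, hφb⟩, hnf⟩ := hA
  have hε0 : ε ≠ 0 := by rcases hε with h | h <;> rw [h] <;> norm_num
  have hδ0 : δ ≠ 0 := by rcases hδ with h | h <;> rw [h] <;> norm_num
  obtain ⟨κ, hκ, hκ0, hright, hleft, hκb⟩ := hφ.exists_inverse hφb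
  rw [hφ0] at hκ hκ0 hright hκb
  set N : E2 → ℝ := fun q => h 0 + ε * q 0 ^ (k + 1) + δ * q 1 ^ 2 with hN
  have hNs : SmoothNear N 0 := by
    have h0 := contDiff_coord 0
    have h1 := contDiff_coord 1
    exact ((contDiff_const.add (contDiff_const.mul (h0.pow _))).add
      (contDiff_const.mul (h1.pow _))).smoothNear 0
  constructor
  · have hc : HasContactCurve k N := by
      refine ⟨fun t => !₂[t, 0], stdVec 0, ?_, ?_, ?_, ?_⟩
      · intro h; simpa [stdVec] using congrArg (fun q : E2 => q 0) h
      · ext i; fin_cases i <;> simp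
      · have := hasDerivAt_mk (hasDerivAt_id (0 : ℝ)) (hasDerivAt_const (0 : ℝ) (0 : ℝ))
        simpa [E2.mk_eq] using this
      · have : (fun t : ℝ => fderiv ℝ N !₂[t, 0]) = fun t : ℝ => t ^ k •
            ((ε * (k + 1)) • (EuclideanSpace.proj 0 : E2 →L[ℝ] ℝ)) := by
          funext t
          rw [hN, (hasFDerivAt_normalForm _ _ _ _ _).fderiv]
          ext w; simp; ring
        rw [this]
        simpa using (Asymptotics.isBigO_refl (fun t : ℝ => t ^ k) (𝓝 0)).smul
          (Asymptotics.isBigO_const_const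
            ((ε * (k + 1)) • (EuclideanSpace.proj 0 : E2 →L[ℝ] ℝ)) (one_ne_zero (α := ℝ)) _)
    have ht : Tendsto κ (𝓝 0) (𝓝 0) := by
      have := hκ.continuousAt.tendsto; rwa [hκ0] at this
    refine hc.comp hNs hκ ⟨hφ, hφ0, hφb⟩ hleft ?_
    filter_upwards [ht.eventually hnf, hright] with q h1 h2
    rw [← h1, h2]
  · intro hc
    have hcN : HasContactCurve (k + 1) N :=
      hc.comp hh hφ ⟨hκ, hκ0, hκb⟩ hright (hnf.mono fun q hq => hq.symm)
    obtain ⟨γ, u, hu, h0, hd, hO⟩ := hcN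
    have hcoord : ∀ i, HasDerivAt (fun t => γ t i) (u i) 0 := fun i =>
      (hasFDerivAt_coord i (γ 0)).comp_hasDerivAt 0 hd
    have happ : ∀ w : E2, (fun t => fderiv ℝ N (γ t) w) =O[𝓝 0] fun t => t ^ (k + 1) := by
      intro w
      refine Asymptotics.IsBigO.trans (Asymptotics.IsBigO.of_bound ‖w‖
        (Eventually.of_forall fun t => ?_)) hO
      rw [mul_comm]; exact (fderiv ℝ N (γ t)).le_opNorm w
    have hu0 : u 0 = 0 := by
      refine eq_zero_of_pow_isBigO (m := k) (hcoord 0) (by simp [h0]) ?_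
      have h1 := (happ (stdVec 0)).const_mul_left ((ε * (k + 1))⁻¹)
      refine h1.congr_left fun t => ?_
      have : ((k : ℝ) + 1) ≠ 0 := by positivity
      rw [hN, (hasFDerivAt_normalForm _ _ _ _ _).fderiv]
      simp [stdVec]
      field_simp
    have hu1 : u 1 = 0 := by
      refine eq_zero_of_pow_isBigO (m := 1) (hcoord 1) (by simp [h0]) ?_
      have h1 := (happ (stdVec 1)).const_mul_left ((δ * 2)⁻¹)
      refine (h1.congr_left fun t => ?_).trans (isBigO_pow_of_le (by omega))
      rw [hN, (hasFDerivAt_normalForm _ _ _ _ _).fderiv]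
      simp [stdVec]
      field_simp
    apply hu
    rw [E2.eq_of_coord (q := u), hu0, hu1]; simp

namespace IsResidual

variable {h : E2 → ℝ} {η g : ℝ → ℝ} (H : IsResidual h η g)
include H

theorem hasContactCurve (hh : SmoothNear h 0) {k : ℕ}
    (hvan : ∀ i, 1 ≤ i → i ≤ k → iteratedDeriv i g 0 = 0) : HasContactCurve k h := by
  refine ⟨_, _, ?_, H.curve_at_zero, H.hasDerivAt_curve 0, H.isBigO_fderiv hh hvan⟩
  intro h; simpa using congrArg (fun q : E2 => q 0) h

/-- The type is read off the order of vanishing of the residual part. If a derivative of `g` of order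
`i ≤ k` were the first not to vanish, `h` would have type `A_(i - 1)`, which has no contact curve of
order `k`. -/
theorem hasTypeA_iff (hh : SmoothNear h 0) (hyy : secondDeriv h 0 (stdVec 1) (stdVec 1) ≠ 0)
    {k : ℕ} (hk : 1 ≤ k) (h1 : deriv g 0 = 0) :
    HasTypeA k h ↔ (∀ i, 1 ≤ i → i ≤ k → iteratedDeriv i g 0 = 0) ∧
      iteratedDeriv (k + 1) g 0 ≠ 0 := by
  refine ⟨fun hA => ?_, fun hA => H.hasTypeA hh hyy hA.1 hA.2⟩
  obtain ⟨hc, hnc⟩ := hA.contact hk hh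
  have hvan : ∀ i, 1 ≤ i → i ≤ k → iteratedDeriv i g 0 = 0 := by
    intro i
    induction i using Nat.strong_induction_on with
    | _ i ih =>
      intro hi hik
      rcases Nat.lt_or_ge 1 i with hi1 | hi1
      · by_contra hne
        obtain ⟨j, rfl⟩ : ∃ j, i = j + 1 := ⟨i - 1, by omega⟩
        have hj := H.hasTypeA hh hyy (fun l hl hlj => ih l (by omega) hl (by omega)) hne
        exact (hj.contact (by omega) hh).2 (hc.mono hik)
      · obtain rfl : i = 1 := by omega
        simpa using h1
  refine ⟨hvan, fun h0 => hnc (H.hasContactCurve hh fun i hi hik => ?_)⟩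
  rcases Nat.lt_or_ge k i with h | h
  · obtain rfl : i = k + 1 := by omega
    exact h0
  · exact hvan i hi h

end IsResidual

/-! ### The codimension -/

/-- A polynomial of degree less than `n` that is `O(t ^ n)` is zero. -/
theorem eq_zero_of_sum_isBigO (n : ℕ) : ∀ (a : Fin n → ℝ),
    (fun t : ℝ => ∑ i, a i * t ^ (i : ℕ)) =O[𝓝[≠] 0] (fun t => t ^ n) → ∀ i, a i = 0 := by
  induction n with
  | zero => exact fun a _ i => i.elim0
  | succ n ih =>
    intro a hO
    simp only [Fin.sum_univ_succ, Fin.val_zero, pow_zero, mul_one, Fin.val_succ] at hO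
    have ht : Tendsto (fun t : ℝ => t ^ (n + 1)) (𝓝[≠] 0) (𝓝 0) :=
      ((continuous_pow (n + 1)).tendsto' (0 : ℝ) 0 (by simp)).mono_left nhdsWithin_le_nhds
    have hc : Tendsto (fun t : ℝ => a 0 + ∑ i : Fin n, a i.succ * t ^ ((i : ℕ) + 1)) (𝓝[≠] 0)
        (𝓝 (a 0)) := by
      refine Tendsto.mono_left ?_ nhdsWithin_le_nhds
      have : Continuous (fun t : ℝ => a 0 + ∑ i : Fin n, a i.succ * t ^ ((i : ℕ) + 1)) := by
        fun_prop
      exact this.tendsto' 0 _ (by simp)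
    have h0 : a 0 = 0 := tendsto_nhds_unique hc (hO.trans_tendsto ht)
    have h1 := ih (fun i => a i.succ) (by
      have h2 := (Asymptotics.isBigO_refl (fun t : ℝ => t⁻¹) (𝓝[≠] 0)).mul hO
      refine h2.congr' ?_ ?_
      · filter_upwards [self_mem_nhdsWithin] with t ht
        have ht' : t ≠ 0 := ht
        rw [h0, zero_add, Finset.mul_sum]
        refine Finset.sum_congr rfl fun i _ => ?_
        rw [pow_succ]; field_simp
      · filter_upwards [self_mem_nhdsWithin] with t ht
        have ht' : t ≠ 0 := ht
        rw [pow_succ]; field_simp)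
    exact fun i => Fin.cases h0 h1 i

/-- The powers `1, x, …, x ^ (k - 1)` are independent modulo the Jacobian ideal if the
differential of `h` is of order `k` along a curve parametrised by `x`. -/
theorem IsResidual.le_codimension {h : E2 → ℝ} {η g : ℝ → ℝ} (H : IsResidual h η g)
    (hh : SmoothNear h 0) {k : ℕ} (hvan : ∀ i, 1 ≤ i → i ≤ k → iteratedDeriv i g 0 = 0) :
    (k : Cardinal) ≤ codimension h := by
  let m : Fin k → smoothFunctions := fun i =>
    ⟨fun q => q 0 ^ (i : ℕ), ((contDiff_coord 0).pow _).smoothNear 0⟩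
  have hli : LinearIndependent ℝ (fun i => (jacobianIdeal h).mkQ (m i)) := by
    rw [Fintype.linearIndependent_iff]
    intro a ha
    simp only [← map_smul, ← map_sum] at ha
    rw [Submodule.mkQ_apply, Submodule.Quotient.mk_eq_zero] at ha
    obtain ⟨α, β, he⟩ := ha
    refine eq_zero_of_sum_isBigO k a (Asymptotics.IsBigO.mono ?_ nhdsWithin_le_nhds)
    have h1 : (fun t : ℝ => ∑ i, a i * t ^ (i : ℕ)) =ᶠ[𝓝 0] fun t =>
        α.1 !₂[t, η t] * fderiv ℝ h !₂[t, η t] (stdVec 0) +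
          β.1 !₂[t, η t] * fderiv ℝ h !₂[t, η t] (stdVec 1) := by
      filter_upwards [H.tendsto_curve.eventually he] with t ht
      rw [← ht]
      simp [m, Finset.sum_apply]
    have h2 : ∀ (ρ : smoothFunctions) (w : E2),
        (fun t : ℝ => ρ.1 !₂[t, η t] * fderiv ℝ h !₂[t, η t] w) =O[𝓝 0] fun t => t ^ k := by
      intro ρ w
      have hρ : SmoothNear ρ.1 0 := ρ.2
      have h3 : (fun t : ℝ => ρ.1 !₂[t, η t]) =O[𝓝 0] fun _ => (1 : ℝ) :=
        (hρ.continuousAt.tendsto.comp H.tendsto_curve).isBigO_one ℝ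
      have h4 : (fun t : ℝ => fderiv ℝ h !₂[t, η t] w) =O[𝓝 0] fun t => t ^ k := by
        refine Asymptotics.IsBigO.trans (Asymptotics.IsBigO.of_bound ‖w‖
          (Eventually.of_forall fun t => ?_)) (H.isBigO_fderiv hh hvan)
        rw [mul_comm]; exact (fderiv ℝ h _).le_opNorm w
      simpa using h3.mul h4
    exact h1.trans_isBigO ((h2 α _).add (h2 β _))
  have := hli.cardinal_le_rank
  simpa [codimension] using this

/-! ### The chain rule along curves -/

theorem SmoothNear.deriv {Y : Type*} [NormedAddCommGroup Y] [NormedSpace ℝ Y] {c : ℝ → Y} {t : ℝ}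
    (hc : SmoothNear c t) : SmoothNear (deriv c) t :=
  (hc.fderiv.clm_apply (contDiff_const (c := (1 : ℝ)) |>.smoothNear t)).congr
    (Eventually.of_forall fun _ => rfl)

/-- The third derivative `D³h_q(u, w, z)`. -/
def thirdDeriv {Y : Type*} [NormedAddCommGroup Y] [NormedSpace ℝ Y]
    (h : E2 → Y) (q u w z : E2) : Y :=
  fderiv ℝ (fderiv ℝ (fderiv ℝ h)) q u w z

section Chain

variable {Y : Type*} [NormedAddCommGroup Y] [NormedSpace ℝ Y] {h : E2 → Y} {c : ℝ → E2} {t : ℝ}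

theorem deriv_comp_curve (hh : SmoothNear h (c t)) (hc : SmoothNear c t) :
    deriv (fun t => h (c t)) t = fderiv ℝ h (c t) (deriv c t) :=
  (hh.differentiableAt.hasFDerivAt.comp_hasDerivAt t hc.differentiableAt.hasDerivAt).deriv

theorem deriv_deriv_comp_curve (hh : SmoothNear h (c t)) (hc : SmoothNear c t) :
    deriv (deriv (fun t => h (c t))) t =
      secondDeriv h (c t) (deriv c t) (deriv c t) + fderiv ℝ h (c t) (deriv (deriv c) t) := by
  have h1 : deriv (fun t => h (c t)) =ᶠ[𝓝 t] fun t => fderiv ℝ h (c t) (deriv c t) := by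
    filter_upwards [hc.continuousAt.eventually hh.eventually, hc.eventually] with s h1 h2
    exact deriv_comp_curve h1 h2
  rw [h1.deriv_eq]
  have h2 := hh.fderiv.differentiableAt.hasFDerivAt.comp_hasDerivAt t
    hc.differentiableAt.hasDerivAt
  exact (h2.clm_apply hc.deriv.differentiableAt.hasDerivAt).deriv

theorem iteratedDeriv_three_comp_curve (hh : SmoothNear h (c t)) (hc : SmoothNear c t) :
    iteratedDeriv 3 (fun t => h (c t)) t =
      thirdDeriv h (c t) (deriv c t) (deriv c t) (deriv c t) +
        (3 : ℝ) • secondDeriv h (c t) (deriv c t) (deriv (deriv c) t) +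
        fderiv ℝ h (c t) (deriv (deriv (deriv c)) t) := by
  have h1 : deriv (deriv (fun t => h (c t))) =ᶠ[𝓝 t] fun t =>
      secondDeriv h (c t) (deriv c t) (deriv c t) + fderiv ℝ h (c t) (deriv (deriv c) t) := by
    filter_upwards [hc.continuousAt.eventually hh.eventually, hc.eventually] with s h1 h2
    exact deriv_deriv_comp_curve h1 h2
  rw [iteratedDeriv_succ, iteratedDeriv_succ, iteratedDeriv_one, h1.deriv_eq]
  have d0 := hc.differentiableAt.hasDerivAt
  have d1 := hc.deriv.differentiableAt.hasDerivAt
  have d2 := hc.deriv.deriv.differentiableAt.hasDerivAt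
  have h2 := hh.fderiv.fderiv.differentiableAt.hasFDerivAt.comp_hasDerivAt t d0
  have h3 := hh.fderiv.differentiableAt.hasFDerivAt.comp_hasDerivAt t d0
  have h4 := ((h2.clm_apply d1).clm_apply d1).add (h3.clm_apply d2)
  refine h4.deriv.trans ?_
  have hs := secondDeriv_symm hh (deriv (deriv c) t) (deriv c t)
  simp only [secondDeriv] at hs
  simp only [add_apply, thirdDeriv, secondDeriv, Function.comp_apply, hs]
  module

end Chain

/-! ### The Hessian determinant along the critical curve -/

/-- The Hessian determinant. -/
def hessDet (h : E2 → ℝ) (q : E2) : ℝ :=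
  secondDeriv h q (stdVec 0) (stdVec 0) * secondDeriv h q (stdVec 1) (stdVec 1) -
    secondDeriv h q (stdVec 0) (stdVec 1) * secondDeriv h q (stdVec 1) (stdVec 0)

/-- The first entry of the product of the adjugate of the Hessian matrix with the gradient of its
determinant. -/
def hessCusp (h : E2 → ℝ) (q : E2) : ℝ :=
  secondDeriv h q (stdVec 1) (stdVec 1) * fderiv ℝ (hessDet h) q (stdVec 0) -
    secondDeriv h q (stdVec 0) (stdVec 1) * fderiv ℝ (hessDet h) q (stdVec 1)

theorem SmoothNear.secondDeriv {Y : Type*} [NormedAddCommGroup Y] [NormedSpace ℝ Y]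
    {h : E2 → Y} {q : E2} (hh : SmoothNear h q) (u w : E2) :
    SmoothNear (fun q => secondDeriv h q u w) q :=
  (hh.fderiv.fderiv.clm_apply (contDiff_const.smoothNear q)).clm_apply (contDiff_const.smoothNear q)

theorem SmoothNear.hessDet {h : E2 → ℝ} {q : E2} (hh : SmoothNear h q) :
    SmoothNear (hessDet h) q :=
  ((hh.secondDeriv _ _).mul (hh.secondDeriv _ _)).sub ((hh.secondDeriv _ _).mul (hh.secondDeriv _ _))

theorem SmoothNear.hessCusp {h : E2 → ℝ} {q : E2} (hh : SmoothNear h q) :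
    SmoothNear (hessCusp h) q :=
  ((hh.secondDeriv _ _).mul (hh.hessDet.fderiv.clm_apply (contDiff_const.smoothNear q))).sub
    ((hh.secondDeriv _ _).mul (hh.hessDet.fderiv.clm_apply (contDiff_const.smoothNear q)))

theorem secondDeriv_left {Y : Type*} [NormedAddCommGroup Y] [NormedSpace ℝ Y]
    (h : E2 → Y) (q u w : E2) : secondDeriv h q u w =
      u 0 • secondDeriv h q (stdVec 0) w + u 1 • secondDeriv h q (stdVec 1) w := by
  simp only [secondDeriv]
  conv_lhs => rw [E2.eq_of_coord (q := u)]
  simp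

theorem secondDeriv_right {Y : Type*} [NormedAddCommGroup Y] [NormedSpace ℝ Y]
    (h : E2 → Y) (q u w : E2) : secondDeriv h q u w =
      w 0 • secondDeriv h q u (stdVec 0) + w 1 • secondDeriv h q u (stdVec 1) := by
  simp only [secondDeriv]
  conv_lhs => rw [E2.eq_of_coord (q := w)]
  simp

/-- The Hessian determinant vanishes exactly if the Hessian form has a kernel. -/
theorem hessDet_eq_zero_iff {h : E2 → ℝ} {q : E2} (hh : SmoothNear h q)
    (hyy : secondDeriv h q (stdVec 1) (stdVec 1) ≠ 0) :
    hessDet h q = 0 ↔ ∃ u : E2, u ≠ 0 ∧ ∀ w, secondDeriv h q u w = 0 := by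
  have hs := secondDeriv_symm hh (stdVec 1) (stdVec 0)
  constructor
  · intro hK
    obtain ⟨u, hu0, hu1⟩ : ∃ u : E2, u 0 = secondDeriv h q (stdVec 1) (stdVec 1) ∧
        u 1 = -secondDeriv h q (stdVec 0) (stdVec 1) := ⟨!₂[_, _], rfl, rfl⟩
    refine ⟨u, fun h0 => hyy (by rw [← hu0, h0]; simp), fun w => ?_⟩
    rw [secondDeriv_right, secondDeriv_left h q u (stdVec 0), secondDeriv_left h q u (stdVec 1)]
    simp only [hessDet, hs] at hK
    simp only [hu0, hu1, smul_eq_mul, hs]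
    linear_combination w 0 * hK
  · rintro ⟨u, hu, hk⟩
    have h0 := hk (stdVec 0)
    have h1 := hk (stdVec 1)
    rw [secondDeriv_left, smul_eq_mul, smul_eq_mul] at h0 h1
    have hu0 : u 0 ≠ 0 := by
      intro hu0
      rw [hu0, zero_mul, zero_add] at h1
      apply hu
      rw [E2.eq_of_coord (q := u), hu0, (mul_eq_zero.1 h1).resolve_right hyy]; simp
    have : u 0 * hessDet h q = 0 := by
      rw [hessDet]
      linear_combination secondDeriv h q (stdVec 1) (stdVec 1) * h0 -
        secondDeriv h q (stdVec 1) (stdVec 0) * h1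
    exact (mul_eq_zero.1 this).resolve_left hu0

namespace IsResidual

variable {h : E2 → ℝ} {η g : ℝ → ℝ} (H : IsResidual h η g)
include H

theorem deriv_res_zero (hh : SmoothNear h 0) (h0 : fderiv ℝ h 0 = 0) : deriv g 0 = 0 := by
  rw [(H.deriv_res hh).self_of_nhds, H.curve_at_zero, h0]; rfl

theorem secondDeriv_crit (hh : SmoothNear h 0) : ∀ᶠ x in 𝓝 0,
    secondDeriv h !₂[x, η x] (stdVec 0) (stdVec 1) +
      deriv η x * secondDeriv h !₂[x, η x] (stdVec 1) (stdVec 1) = 0 := by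
  filter_upwards [H.crit.eventually_nhds, H.tendsto_curve.eventually hh.eventually] with x h1 h2
  have h3 := (hasFDerivAt_fderiv_apply h2 (stdVec 1)).comp_hasDerivAt x (H.hasDerivAt_curve x)
  have h4 := h3.unique ((hasDerivAt_const x (0 : ℝ)).congr_of_eventuallyEq h1)
  rw [ContinuousLinearMap.flip_apply] at h4
  have h5 := secondDeriv_left h !₂[x, η x] !₂[1, deriv η x] (stdVec 1)
  simpa [secondDeriv] using h5.symm.trans h4

theorem deriv_deriv_res (hh : SmoothNear h 0) : ∀ᶠ x in 𝓝 0,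
    deriv (deriv g) x = secondDeriv h !₂[x, η x] (stdVec 0) (stdVec 0) +
      deriv η x * secondDeriv h !₂[x, η x] (stdVec 1) (stdVec 0) := by
  filter_upwards [(H.deriv_res hh).eventually_nhds, H.tendsto_curve.eventually hh.eventually]
    with x h1 h2
  have h3 := (hasFDerivAt_fderiv_apply h2 (stdVec 0)).comp_hasDerivAt x (H.hasDerivAt_curve x)
  have h4 : deriv g =ᶠ[𝓝 x] _ := h1
  rw [h4.deriv_eq]
  refine h3.deriv.trans ?_
  rw [ContinuousLinearMap.flip_apply]
  have h5 := secondDeriv_left h !₂[x, η x] !₂[1, deriv η x] (stdVec 0)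
  simpa [secondDeriv] using h5

/-- Along the critical curve the Hessian determinant is `g'' ∂²h/∂y²`, because `g''` is the Schur
complement of the entry `∂²h/∂y²`. -/
theorem hessDet_curve (hh : SmoothNear h 0) : ∀ᶠ x in 𝓝 0, hessDet h !₂[x, η x] =
    deriv (deriv g) x * secondDeriv h !₂[x, η x] (stdVec 1) (stdVec 1) := by
  filter_upwards [H.secondDeriv_crit hh, H.deriv_deriv_res hh] with x h1 h2
  rw [h2, hessDet]
  linear_combination (-secondDeriv h !₂[x, η x] (stdVec 1) (stdVec 0)) * h1

theorem fderiv_hessDet_curve (hh : SmoothNear h 0) : ∀ᶠ x in 𝓝 0,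
    fderiv ℝ (hessDet h) !₂[x, η x] !₂[1, deriv η x] =
      deriv (fun x => deriv (deriv g) x *
        secondDeriv h !₂[x, η x] (stdVec 1) (stdVec 1)) x := by
  filter_upwards [(H.hessDet_curve hh).eventually_nhds,
    H.tendsto_curve.eventually hh.hessDet.eventually] with x h1 h2
  have h3 := h2.differentiableAt.hasFDerivAt.comp_hasDerivAt x (H.hasDerivAt_curve x)
  have h4 : (hessDet h ∘ fun x => !₂[x, η x]) =ᶠ[𝓝 x] _ := h1
  rw [← h3.deriv, h4.deriv_eq]

/-- Along the critical curve `hessCusp h` is `∂²h/∂y²` times the derivative of the Hessian determinant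
along the curve, because `(∂²h/∂y², -∂²h/∂x∂y)` is a multiple of the velocity of the curve. -/
theorem hessCusp_curve (hh : SmoothNear h 0) : ∀ᶠ x in 𝓝 0, hessCusp h !₂[x, η x] =
    secondDeriv h !₂[x, η x] (stdVec 1) (stdVec 1) * deriv (fun x => deriv (deriv g) x *
        secondDeriv h !₂[x, η x] (stdVec 1) (stdVec 1)) x := by
  filter_upwards [H.fderiv_hessDet_curve hh, H.secondDeriv_crit hh] with x h1 h2
  rw [← h1, E2.mk_eq (1 : ℝ), map_add, map_smul, map_smul, hessCusp]
  simp only [smul_eq_mul]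
  linear_combination (-fderiv ℝ (hessDet h) !₂[x, η x] (stdVec 1)) * h2

theorem smoothNear_secondDeriv_curve (hh : SmoothNear h 0) :
    SmoothNear (fun x => secondDeriv h !₂[x, η x] (stdVec 1) (stdVec 1)) 0 := by
  have h1 : SmoothNear (fun q => secondDeriv h q (stdVec 1) (stdVec 1)) !₂[(0 : ℝ), η 0] := by
    rw [H.curve_at_zero]; exact hh.secondDeriv _ _
  exact h1.comp (g := fun x : ℝ => (!₂[x, η x] : E2)) (H.contDiff_curve.smoothNear 0)

theorem hessDet_zero (hh : SmoothNear h 0) : hessDet h 0 =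
    iteratedDeriv 2 g 0 * secondDeriv h 0 (stdVec 1) (stdVec 1) := by
  have := (H.hessDet_curve hh).self_of_nhds
  rwa [H.curve_at_zero, show deriv (deriv g) 0 = iteratedDeriv 2 g 0 by
    rw [iteratedDeriv_succ, iteratedDeriv_one]] at this

theorem fderiv_hessDet_zero (hh : SmoothNear h 0) (h2 : iteratedDeriv 2 g 0 = 0) :
    fderiv ℝ (hessDet h) 0 !₂[1, deriv η 0] =
      iteratedDeriv 3 g 0 * secondDeriv h 0 (stdVec 1) (stdVec 1) := by
  have h1 := (H.fderiv_hessDet_curve hh).self_of_nhds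
  have hg := (H.smooth_res.smoothNear 0).deriv.deriv
  have hb := H.smoothNear_secondDeriv_curve hh
  have h3 := (hg.differentiableAt.hasDerivAt.fun_mul hb.differentiableAt.hasDerivAt).deriv
  rw [h3, H.curve_at_zero] at h1
  rw [h1, show deriv (deriv g) 0 = iteratedDeriv 2 g 0 by
    rw [iteratedDeriv_succ, iteratedDeriv_one], h2, iteratedDeriv_succ, iteratedDeriv_succ,
    iteratedDeriv_one]
  simp

theorem fderiv_hessCusp_zero (hh : SmoothNear h 0) (h2 : iteratedDeriv 2 g 0 = 0)
    (h3 : iteratedDeriv 3 g 0 = 0) : fderiv ℝ (hessCusp h) 0 !₂[1, deriv η 0] =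
      iteratedDeriv 4 g 0 * secondDeriv h 0 (stdVec 1) (stdVec 1) ^ 2 := by
  rw [iteratedDeriv_succ, iteratedDeriv_succ, iteratedDeriv_succ, iteratedDeriv_one]
  rw [iteratedDeriv_succ, iteratedDeriv_succ, iteratedDeriv_one] at h3
  rw [iteratedDeriv_succ, iteratedDeriv_one] at h2
  set b : ℝ → ℝ := fun x => secondDeriv h !₂[x, η x] (stdVec 1) (stdVec 1) with hb
  have hbs : SmoothNear b 0 := H.smoothNear_secondDeriv_curve hh
  have hb0 : b 0 = secondDeriv h 0 (stdVec 1) (stdVec 1) := by rw [hb]; simp only [H.curve_at_zero]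
  have ha := (H.smooth_res.smoothNear 0).deriv.deriv
  have e1 : deriv (fun x => deriv (deriv g) x * b x) =ᶠ[𝓝 0]
      fun x => deriv (deriv (deriv g)) x * b x + deriv (deriv g) x * deriv b x := by
    filter_upwards [ha.eventually, hbs.eventually] with x h1 h2
    exact (h1.differentiableAt.hasDerivAt.fun_mul h2.differentiableAt.hasDerivAt).deriv
  have e2 : (hessCusp h ∘ fun x => !₂[x, η x]) =ᶠ[𝓝 0] fun x =>
      b x * (deriv (deriv (deriv g)) x * b x + deriv (deriv g) x * deriv b x) := by
    filter_upwards [e1, H.hessCusp_curve hh] with x h1 h2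
    rw [Function.comp_apply, h2, ← h1]
  have e3 : HasDerivAt (hessCusp h ∘ fun x => !₂[x, η x])
      (fderiv ℝ (hessCusp h) 0 !₂[1, deriv η 0]) 0 := by
    have h1 : HasFDerivAt (hessCusp h) (fderiv ℝ (hessCusp h) 0) !₂[(0 : ℝ), η 0] := by
      rw [H.curve_at_zero]; exact hh.hessCusp.differentiableAt.hasFDerivAt
    exact h1.comp_hasDerivAt 0 (H.hasDerivAt_curve 0)
  have d1 := ha.differentiableAt.hasDerivAt
  have d2 := ha.deriv.differentiableAt.hasDerivAt
  have d3 := hbs.differentiableAt.hasDerivAt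
  have d4 := hbs.deriv.differentiableAt.hasDerivAt
  have e4 := d3.fun_mul ((d2.fun_mul d3).fun_add (d1.fun_mul d4))
  rw [(e3.congr_of_eventuallyEq e2.symm).unique e4, h2, h3, hb0]
  ring

theorem secondDeriv_tangent (hh : SmoothNear h 0) (h2 : iteratedDeriv 2 g 0 = 0) (w : E2) :
    secondDeriv h 0 !₂[1, deriv η 0] w = 0 := by
  have h1 := (H.secondDeriv_crit hh).self_of_nhds
  have h3 := (H.deriv_deriv_res hh).self_of_nhds
  rw [iteratedDeriv_succ, iteratedDeriv_one] at h2
  rw [H.curve_at_zero] at h1 h3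
  rw [h2] at h3
  rw [secondDeriv_right, secondDeriv_left _ _ _ (stdVec 0), secondDeriv_left _ _ _ (stdVec 1)]
  simp only [Matrix.cons_val_zero, Matrix.cons_val_one, smul_eq_mul]
  linear_combination w 1 * h1 - w 0 * h3

theorem iteratedDeriv_three_res (hh : SmoothNear h 0) (h0 : fderiv ℝ h 0 = 0)
    (h2 : iteratedDeriv 2 g 0 = 0) : iteratedDeriv 3 g 0 =
      thirdDeriv h 0 !₂[1, deriv η 0] !₂[1, deriv η 0] !₂[1, deriv η 0] := by
  have h1 : g =ᶠ[𝓝 0] fun x => h !₂[x, η x] := H.res_eq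
  rw [h1.iteratedDeriv_eq, iteratedDeriv_three_comp_curve (c := fun x => !₂[x, η x])
    (by rw [H.curve_at_zero]; exact hh) (H.contDiff_curve.smoothNear 0),
    (H.hasDerivAt_curve 0).deriv, H.curve_at_zero, H.secondDeriv_tangent hh h2, h0]
  simp

/-- The kernel of the Hessian form is spanned by the tangent of the critical curve. -/
theorem eq_smul_tangent (hh : SmoothNear h 0) (hyy : secondDeriv h 0 (stdVec 1) (stdVec 1) ≠ 0)
    {u : E2} (hk : secondDeriv h 0 u (stdVec 1) = 0) : u = u 0 • !₂[1, deriv η 0] := by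
  have h1 := (H.secondDeriv_crit hh).self_of_nhds
  rw [H.curve_at_zero] at h1
  rw [secondDeriv_left, smul_eq_mul, smul_eq_mul] at hk
  have h3 : (u 1 - u 0 * deriv η 0) * secondDeriv h 0 (stdVec 1) (stdVec 1) = 0 := by
    linear_combination hk - u 0 * h1
  have h4 := (mul_eq_zero.1 h3).resolve_right hyy
  ext i; fin_cases i
  · simp
  · simp; linarith

end IsResidual

/-! ### Criteria for `A_1`, `A_2` and `A_3` -/

section Criteria

variable {h : E2 → ℝ} (hh : SmoothNear h 0) (h0 : fderiv ℝ h 0 = 0)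
  (hyy : secondDeriv h 0 (stdVec 1) (stdVec 1) ≠ 0)
include hh h0 hyy

theorem hasTypeA_one_iff : HasTypeA 1 h ↔ hessDet h 0 ≠ 0 := by
  obtain ⟨η, g, H⟩ := exists_isResidual hh h0 hyy
  have h1 := H.deriv_res_zero hh h0
  rw [H.hasTypeA_iff hh hyy le_rfl h1, H.hessDet_zero hh]
  simp only [ne_eq, mul_eq_zero, hyy, or_false]
  refine ⟨fun h => h.2, fun h => ⟨fun i hi hi' => ?_, h⟩⟩
  obtain rfl : i = 1 := by omega
  simpa using h1

theorem HasTypeA.hessDet_eq_zero {k : ℕ} (hA : HasTypeA k h) (hk : 2 ≤ k) : hessDet h 0 = 0 := by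
  obtain ⟨η, g, H⟩ := exists_isResidual hh h0 hyy
  have h1 := H.deriv_res_zero hh h0
  rw [H.hasTypeA_iff hh hyy (by omega) h1] at hA
  rw [H.hessDet_zero hh, hA.1 2 (by omega) hk, zero_mul]

/-- If the derivatives of `g` up to the fourth vanished, the codimension would be at least four. -/
theorem hasTypeA_of_codimension_le (hc : codimension h ≤ 3) :
    HasTypeA 1 h ∨ HasTypeA 2 h ∨ HasTypeA 3 h := by
  obtain ⟨η, g, H⟩ := exists_isResidual hh h0 hyy
  have h1 := H.deriv_res_zero hh h0
  have h1' : iteratedDeriv 1 g 0 = 0 := by simpa using h1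
  by_cases h2 : iteratedDeriv 2 g 0 = 0
  · by_cases h3 : iteratedDeriv 3 g 0 = 0
    · by_cases h4 : iteratedDeriv 4 g 0 = 0
      · exfalso
        have := (H.le_codimension hh (k := 4) fun i hi hi' => by
          interval_cases i <;> assumption).trans hc
        norm_cast at this
      · exact Or.inr (Or.inr ((H.hasTypeA_iff hh hyy (by omega) h1).2
          ⟨fun i hi hi' => by interval_cases i <;> assumption, h4⟩))
    · exact Or.inr (Or.inl ((H.hasTypeA_iff hh hyy (by omega) h1).2
          ⟨fun i hi hi' => by interval_cases i <;> assumption, h3⟩))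
  · exact Or.inl ((H.hasTypeA_iff hh hyy (by omega) h1).2
          ⟨fun i hi hi' => by interval_cases i; assumption, h2⟩)

variable {u : E2} (hu : u ≠ 0) (hk : ∀ w, secondDeriv h 0 u w = 0)
include hk

theorem fderiv_hessDet_eq_zero_iff :
    fderiv ℝ (hessDet h) 0 u = 0 ↔ thirdDeriv h 0 u u u = 0 := by
  obtain ⟨η, g, H⟩ := exists_isResidual hh h0 hyy
  rcases eq_or_ne u 0 with rfl | hu
  · simp [thirdDeriv]
  have h2 : iteratedDeriv 2 g 0 = 0 := by
    have := (hessDet_eq_zero_iff hh hyy).2 ⟨u, hu, hk⟩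
    rw [H.hessDet_zero hh] at this
    exact (mul_eq_zero.1 this).resolve_right hyy
  have hu' := H.eq_smul_tangent hh hyy (hk _)
  have hu0 : u 0 ≠ 0 := by
    intro h; apply hu; rw [hu', h, zero_smul]
  have h3 := H.iteratedDeriv_three_res hh h0 h2
  rw [hu', map_smul, H.fderiv_hessDet_zero hh h2, h3]
  simp [thirdDeriv, hu0, hyy]

include hu

theorem hasTypeA_two_iff : HasTypeA 2 h ↔ thirdDeriv h 0 u u u ≠ 0 := by
  obtain ⟨η, g, H⟩ := exists_isResidual hh h0 hyy
  have h1 := H.deriv_res_zero hh h0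
  have h1' : iteratedDeriv 1 g 0 = 0 := by simpa using h1
  have h2 : iteratedDeriv 2 g 0 = 0 := by
    have := (hessDet_eq_zero_iff hh hyy).2 ⟨u, hu, hk⟩
    rw [H.hessDet_zero hh] at this
    exact (mul_eq_zero.1 this).resolve_right hyy
  have hu' := H.eq_smul_tangent hh hyy (hk _)
  have hu0 : u 0 ≠ 0 := by
    intro h; apply hu; rw [hu', h, zero_smul]
  rw [H.hasTypeA_iff hh hyy (by omega) h1, H.iteratedDeriv_three_res hh h0 h2, hu']
  have : (∀ i, 1 ≤ i → i ≤ 2 → iteratedDeriv i g 0 = 0) :=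
    fun i hi hi' => by interval_cases i <;> assumption
  rw [and_iff_right this]
  simp [thirdDeriv, hu0]

theorem hasTypeA_three_iff : HasTypeA 3 h ↔
    thirdDeriv h 0 u u u = 0 ∧ fderiv ℝ (hessCusp h) 0 u ≠ 0 := by
  obtain ⟨η, g, H⟩ := exists_isResidual hh h0 hyy
  have h1 := H.deriv_res_zero hh h0
  have h1' : iteratedDeriv 1 g 0 = 0 := by simpa using h1
  have h2 : iteratedDeriv 2 g 0 = 0 := by
    have := (hessDet_eq_zero_iff hh hyy).2 ⟨u, hu, hk⟩
    rw [H.hessDet_zero hh] at this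
    exact (mul_eq_zero.1 this).resolve_right hyy
  have hu' := H.eq_smul_tangent hh hyy (hk _)
  have hu0 : u 0 ≠ 0 := by
    intro h; apply hu; rw [hu', h, zero_smul]
  have h3 : thirdDeriv h 0 u u u = 0 ↔ iteratedDeriv 3 g 0 = 0 := by
    rw [H.iteratedDeriv_three_res hh h0 h2, hu']
    simp [thirdDeriv, hu0]
  rw [H.hasTypeA_iff hh hyy (by omega) h1, h3]
  constructor
  · rintro ⟨hv, h4⟩
    have h3 := hv 3 (by omega) le_rfl
    refine ⟨h3, ?_⟩
    rw [hu', map_smul, H.fderiv_hessCusp_zero hh h2 h3]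
    simp [hu0, hyy, h4]
  · rintro ⟨h3, h4⟩
    refine ⟨fun i hi hi' => by interval_cases i <;> assumption, fun h5 => h4 ?_⟩
    rw [hu', map_smul, H.fderiv_hessCusp_zero hh h2 h3, h5]
    simp

end Criteria

/-! ### Derivatives of linear images -/

section LinearImage

variable {Y Z : Type*} [NormedAddCommGroup Y] [NormedSpace ℝ Y] [NormedAddCommGroup Z]
  [NormedSpace ℝ Z] (L : Y →L[ℝ] Z)

theorem SmoothNear.clm_comp {X : Type*} [NormedAddCommGroup X] [NormedSpace ℝ X] {r : X → Y}
    {q : X} (hr : SmoothNear r q) : SmoothNear (fun q => L (r q)) q :=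
  SmoothNear.comp (L.contDiff.smoothNear _) hr

theorem fderiv_linear_image {X : Type*} [NormedAddCommGroup X] [NormedSpace ℝ X] {r : X → Y} {q : X}
    (hr : SmoothNear r q) (w : X) :
    fderiv ℝ (fun q => L (r q)) q w = L (fderiv ℝ r q w) :=
  congrArg (fun T : X →L[ℝ] Z => T w)
    (L.hasFDerivAt.comp q hr.differentiableAt.hasFDerivAt).fderiv

theorem secondDeriv_eq_fderiv {r : E2 → Y} {q : E2} (hr : SmoothNear r q) (u w : E2) :
    secondDeriv r q u w = fderiv ℝ (fun q => fderiv ℝ r q w) q u := by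
  rw [(hasFDerivAt_fderiv_apply hr w).fderiv]; rfl

theorem thirdDeriv_eq_fderiv {r : E2 → Y} {q : E2} (hr : SmoothNear r q) (u w z : E2) :
    thirdDeriv r q u w z = fderiv ℝ (fun q => secondDeriv r q w z) q u := by
  have h1 := hr.fderiv.fderiv.differentiableAt.hasFDerivAt.clm_apply (hasFDerivAt_const w q)
  have h2 := h1.clm_apply (hasFDerivAt_const z q)
  refine Eq.trans ?_ (congrArg (fun T : E2 →L[ℝ] Y => T u) h2.fderiv.symm)
  simp [thirdDeriv]

theorem secondDeriv_linear_image {r : E2 → Y} {q : E2} (hr : SmoothNear r q) (u w : E2) :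
    secondDeriv (fun q => L (r q)) q u w = L (secondDeriv r q u w) := by
  rw [secondDeriv_eq_fderiv (hr.clm_comp L), secondDeriv_eq_fderiv hr]
  have h1 : (fun q => fderiv ℝ (fun q => L (r q)) q w) =ᶠ[𝓝 q] fun q => L (fderiv ℝ r q w) := by
    filter_upwards [hr.eventually] with x hx using fderiv_linear_image L hx w
  rw [h1.fderiv_eq, fderiv_linear_image L (hr.fderiv.clm_apply (contDiff_const.smoothNear q))]

theorem SmoothNear.iteratedDeriv {γ : ℝ → Y} {t : ℝ} (hγ : SmoothNear γ t) (n : ℕ) :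
    SmoothNear (iteratedDeriv n γ) t := by
  induction n with
  | zero => simpa using hγ
  | succ n ih => rw [iteratedDeriv_succ]; exact ih.deriv

theorem iteratedDeriv_linear_image {γ : ℝ → Y} {t : ℝ} (hγ : SmoothNear γ t) (n : ℕ) :
    (iteratedDeriv n fun t => L (γ t)) =ᶠ[𝓝 t] fun t => L (iteratedDeriv n γ t) := by
  induction n with
  | zero => simp
  | succ n ih =>
    rw [iteratedDeriv_succ, iteratedDeriv_succ]
    filter_upwards [ih.eventuallyEq_nhds, (hγ.iteratedDeriv n).eventually] with s h1 h2
    rw [h1.deriv_eq]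
    exact (L.hasFDerivAt.comp_hasDerivAt s h2.differentiableAt.hasDerivAt).deriv

end LinearImage

section Surface

variable {F : Type*} [NormedAddCommGroup F] [InnerProductSpace ℝ F]

theorem secondDeriv_inner {r : E2 → F} {q : E2} (hr : SmoothNear r q) (v : F) (u w : E2) :
    secondDeriv (fun q => inner ℝ (r q) v) q u w = inner ℝ (secondDeriv r q u w) v := by
  simpa [real_inner_comm] using secondDeriv_linear_image (innerSL ℝ v) hr u w

theorem fderiv_inner_const {r : E2 → F} {q : E2} (hr : SmoothNear r q) (v : F) (w : E2) :
    fderiv ℝ (fun q => inner ℝ (r q) v) q w = inner ℝ (fderiv ℝ r q w) v := by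
  simpa [real_inner_comm] using fderiv_linear_image (innerSL ℝ v) hr w

theorem SmoothNear.inner_const {r : E2 → F} {q : E2} (hr : SmoothNear r q) (v : F) :
    SmoothNear (fun q => Inner.inner ℝ (r q) v) q :=
  hr.inner (contDiff_const.smoothNear q)

variable [FiniteDimensional ℝ F] {r : E2 → F}

/-! ### Torsion of normal sections -/

/-- The normal section is the inverse image of a line of the tangent plane under the orthogonal
projection of the surface to this plane, which is a local diffeomorphism. -/
theorem exists_isNormalSection (hr : SmoothNear r 0) (hinj : Function.Injective (fderiv ℝ r 0))
    (u : E2) : ∃ c, IsNormalSection r u c := by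
  set T := tangentPlane r 0 with hT
  let L : F →L[ℝ] T := T.orthogonalProjectionOnto
  have hmem : ∀ w, fderiv ℝ r 0 w ∈ T := fun w => ⟨w, rfl⟩
  have hLT : ∀ w, L (fderiv ℝ r 0 w) = ⟨fderiv ℝ r 0 w, hmem w⟩ := fun w =>
    T.orthogonalProjectionOnto_mem_subspace_eq_self ⟨fderiv ℝ r 0 w, hmem w⟩
  let Ψ : E2 → T := fun q => L (r q)
  have hΨ : SmoothNear Ψ 0 := hr.clm_comp L
  have hdΨ : ∀ w, fderiv ℝ Ψ 0 w = ⟨fderiv ℝ r 0 w, hmem w⟩ := fun w => by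
    rw [← hLT]; exact fderiv_linear_image L hr w
  have hbij : Function.Bijective (fderiv ℝ Ψ 0) := by
    constructor
    · intro a b hab
      rw [hdΨ, hdΨ] at hab
      exact hinj (congrArg Subtype.val hab)
    · rintro ⟨x, w, rfl⟩
      exact ⟨w, hdΨ w⟩
  obtain ⟨k, hk, hk0, hright, -, -⟩ := hΨ.exists_inverse hbij
  let ℓ : ℝ → T := fun t => Ψ 0 + t • ⟨fderiv ℝ r 0 u, hmem u⟩
  have hℓ : ContDiff ℝ ∞ ℓ := contDiff_const.add (contDiff_id.smul contDiff_const)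
  have hℓ0 : ℓ 0 = Ψ 0 := by simp [ℓ]
  have hc : SmoothNear (fun t => k (ℓ t)) 0 :=
    SmoothNear.comp (g := ℓ) (by rw [hℓ0]; exact hk) (hℓ.smoothNear 0)
  have hc0 : k (ℓ 0) = 0 := by rw [hℓ0, hk0]
  have hev : ∀ᶠ t in 𝓝 (0 : ℝ), Ψ (k (ℓ t)) = ℓ t :=
    (hℓ.continuous.tendsto' 0 _ hℓ0).eventually hright
  refine ⟨fun t => k (ℓ t), hc, hc0, ?_, ?_⟩
  · have h1 := hΨ.differentiableAt.hasFDerivAt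
    rw [← hc0] at h1
    have h2 := h1.comp_hasDerivAt 0 hc.differentiableAt.hasDerivAt
    have h3 : HasDerivAt ℓ ⟨fderiv ℝ r 0 u, hmem u⟩ 0 := by
      have := ((hasDerivAt_id (0 : ℝ)).smul_const
        (⟨fderiv ℝ r 0 u, hmem u⟩ : T)).const_add (Ψ 0)
      rw [one_smul] at this
      exact this
    have h4 := h2.unique (h3.congr_of_eventuallyEq hev)
    rw [hc0, ← hdΨ] at h4
    exact hbij.1 h4
  · filter_upwards [hev] with t ht
    have h1 : L (r (k (ℓ t)) - r 0) = t • ⟨fderiv ℝ r 0 u, hmem u⟩ := by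
      rw [map_sub]
      change Ψ (k (ℓ t)) - Ψ 0 = _
      rw [ht]; simp [ℓ]
    have h2 : T.starProjection (r (k (ℓ t)) - r 0) = t • fderiv ℝ r 0 u := by
      rw [Submodule.starProjection_apply]
      exact congrArg Subtype.val h1
    have h3 := T.starProjection_add_starProjection_orthogonal (r (k (ℓ t)) - r 0)
    rw [← h3, h2]
    exact Submodule.add_mem_sup (Submodule.smul_mem _ _ (Submodule.mem_span_singleton_self _))
      (Submodule.starProjection_apply_mem _ _)

variable {u : E2} {v : F}

/-- The first two derivatives of the section are independent, orthogonal to `v`, and the section lies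
in a three-space that contains `v`; so the third derivative is in their span if and only if it is
orthogonal to `v`. Its component along `v` is the cubic form of the height function. -/
theorem curveTorsion_eq_zero_iff {c : ℝ → E2} (hr : SmoothNear r 0)
    (hinj : Function.Injective (fderiv ℝ r 0)) (hF : Module.finrank ℝ F = 4)
    (hc : IsNormalSection r u c) (hv : v ≠ 0) (hvT : ∀ w, inner ℝ (fderiv ℝ r 0 w) v = 0)
    (hk : ∀ w, inner ℝ (secondDeriv r 0 u w) v = 0) (hII : regularII r 0 u u ≠ 0) :
    curveTorsion (fun t => r (c t)) = 0 ↔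
      thirdDeriv (fun q => inner ℝ (r q) v) 0 u u u = 0 := by
  obtain ⟨hcs, hc0, hcu, hsec⟩ := hc
  have hrc : SmoothNear r (c 0) := by rw [hc0]; exact hr
  set γ : ℝ → F := fun t => r (c t) with hγ
  have hγs : SmoothNear γ 0 := SmoothNear.comp hrc hcs
  set T := tangentPlane r 0 with hT
  have hmem : ∀ w, fderiv ℝ r 0 w ∈ T := fun w => ⟨w, rfl⟩
  have hu : u ≠ 0 := by
    rintro rfl; apply hII; simp [regularII, secondDeriv]
  have hu' : fderiv ℝ r 0 u ≠ 0 := fun h => hu ((injective_iff_map_eq_zero _).1 hinj u h)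
  -- the first two derivatives of the section
  have h1 : iteratedDeriv 1 γ 0 = fderiv ℝ r 0 u := by
    rw [iteratedDeriv_one, hγ, deriv_comp_curve hrc hcs, hc0, hcu]
  have h2 : iteratedDeriv 2 γ 0 = secondDeriv r 0 u u + fderiv ℝ r 0 (deriv (deriv c) 0) := by
    rw [iteratedDeriv_succ, iteratedDeriv_one, hγ, deriv_deriv_comp_curve hrc hcs, hc0, hcu]
  have hP1 : Tᗮ.starProjection (iteratedDeriv 1 γ 0) = 0 := by
    rw [h1]; exact Submodule.starProjection_orthogonal_apply_eq_zero (hmem u)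
  have hP2 : Tᗮ.starProjection (iteratedDeriv 2 γ 0) = regularII r 0 u u := by
    rw [h2, map_add, Submodule.starProjection_orthogonal_apply_eq_zero (hmem _), add_zero]
    rfl
  have hv1 : inner ℝ (iteratedDeriv 1 γ 0) v = 0 := by rw [h1]; exact hvT u
  have hv2 : inner ℝ (iteratedDeriv 2 γ 0) v = 0 := by
    rw [h2, inner_add_left, hk, hvT, add_zero]
  -- the binormal component of the third derivative
  have hv3 : inner ℝ (iteratedDeriv 3 γ 0) v =
      thirdDeriv (fun q => inner ℝ (r q) v) 0 u u u := by
    have e1 := (iteratedDeriv_linear_image (innerSL ℝ v) hγs 3).self_of_nhds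
    have e2 := iteratedDeriv_three_comp_curve (h := fun q => inner ℝ (r q) v)
      (hrc.inner_const v) hcs
    rw [hc0, hcu, secondDeriv_inner hr, hk, fderiv_inner_const hr, hvT] at e2
    simp only [innerSL_apply_apply] at e1
    rw [real_inner_comm, ← e1]
    simp only [hγ, real_inner_comm v] at e2 ⊢
    simpa [real_inner_comm] using e2
  have hlin2 : LinearIndependent ℝ ![iteratedDeriv 1 γ 0, iteratedDeriv 2 γ 0] := by
    rw [LinearIndependent.pair_iff]
    intro a b hab
    have e1 := congrArg Tᗮ.starProjection hab
    rw [map_add, map_smul, map_smul, hP1, hP2, smul_zero, zero_add, map_zero] at e1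
    have hb := (smul_eq_zero.1 e1).resolve_right hII
    rw [hb, zero_smul, add_zero, h1] at hab
    exact ⟨(smul_eq_zero.1 hab).resolve_right hu', hb⟩
  have hlin3 : LinearIndependent ℝ
      ![iteratedDeriv 1 γ 0, iteratedDeriv 2 γ 0, iteratedDeriv 3 γ 0] ↔
      thirdDeriv (fun q => inner ℝ (r q) v) 0 u u u ≠ 0 := by
    rw [← hv3]
    constructor
    · -- otherwise the three derivatives are in a plane of the space of the section
      intro hl h0
      set V : Submodule ℝ F := Submodule.span ℝ {fderiv ℝ r 0 u} ⊔ Tᗮ with hV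
      have hVmem : ∀ n, iteratedDeriv (n + 1) γ 0 ∈ V := by
        intro n
        have e1 := (iteratedDeriv_linear_image Vᗮ.starProjection hγs (n + 1)).self_of_nhds
        have e2 : (fun t => Vᗮ.starProjection (γ t)) =ᶠ[𝓝 0]
            fun _ => Vᗮ.starProjection (r 0) := by
          filter_upwards [hsec] with t ht
          have := Submodule.starProjection_orthogonal_apply_eq_zero ht
          rw [map_sub, sub_eq_zero] at this
          exact this
        rw [e2.iteratedDeriv_eq, iteratedDeriv_const] at e1
        simp only [Nat.add_eq_zero_iff, one_ne_zero, and_false, if_false] at e1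
        have e3 := V.starProjection_add_starProjection_orthogonal (iteratedDeriv (n + 1) γ 0)
        rw [← e1, add_zero] at e3
        rw [← e3]; exact Submodule.starProjection_apply_mem _ _
      have hvV : v ∈ V := by
        refine Submodule.mem_sup_right ((Submodule.mem_orthogonal _ _).2 ?_)
        rintro _ ⟨w, rfl⟩
        exact hvT w
      have hlt : V ⊓ (Submodule.span ℝ {v})ᗮ < V := by
        refine lt_of_le_of_ne inf_le_left fun he => hv ?_
        have : v ∈ V ⊓ (Submodule.span ℝ {v})ᗮ := by rw [he]; exact hvV
        exact inner_self_eq_zero.1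
          ((Submodule.mem_orthogonal_singleton_iff_inner_right).1 this.2)
      have hTr : Module.finrank ℝ T = 2 := by
        have := LinearMap.finrank_range_of_inj (f := (fderiv ℝ r 0).toLinearMap) hinj
        rw [hT, tangentPlane, this]; simp
      have hVr : Module.finrank ℝ V ≤ 3 := by
        have e1 := Submodule.finrank_add_le_finrank_add_finrank
          (Submodule.span ℝ {fderiv ℝ r 0 u}) Tᗮ
        have e2 := T.finrank_add_finrank_orthogonal
        have e3 := finrank_span_singleton (K := ℝ) hu'
        rw [hV]; omega
      have hfr := Submodule.finrank_lt_finrank_of_lt hlt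
      have hle : Submodule.span ℝ (Set.range
          ![iteratedDeriv 1 γ 0, iteratedDeriv 2 γ 0, iteratedDeriv 3 γ 0]) ≤
          V ⊓ (Submodule.span ℝ {v})ᗮ := by
        rw [Submodule.span_le]
        rintro _ ⟨i, rfl⟩
        have hor : ∀ x : F, inner ℝ x v = 0 → x ∈ (Submodule.span ℝ {v})ᗮ := fun x hx => by
          rw [Submodule.mem_orthogonal_singleton_iff_inner_right, real_inner_comm]; exact hx
        fin_cases i
        · exact ⟨hVmem 0, hor _ hv1⟩
        · exact ⟨hVmem 1, hor _ hv2⟩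
        · exact ⟨hVmem 2, hor _ h0⟩
      have e1 := finrank_span_eq_card hl
      have e2 := Submodule.finrank_mono hle
      simp only [Fintype.card_fin] at e1
      omega
    · intro h0
      rw [Fintype.linearIndependent_iff]
      intro a ha
      simp only [Fin.sum_univ_three, Matrix.cons_val_zero, Matrix.cons_val_one,
        Matrix.cons_val] at ha
      have e1 := congrArg (fun x => inner ℝ x v) ha
      simp only [inner_add_left, real_inner_smul_left, hv1, hv2, inner_zero_left, mul_zero,
        zero_add] at e1
      have ha2 := (mul_eq_zero.1 e1).resolve_right h0
      rw [ha2, zero_smul, add_zero] at ha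
      have e2 := LinearIndependent.pair_iff.1 hlin2 _ _ ha
      intro i; fin_cases i
      · exact e2.1
      · exact e2.2
      · exact ha2
  have hd2 := (Matrix.det_gram_ne_zero_iff_linearIndependent (𝕜 := ℝ)).2 hlin2
  have hd3 := (Matrix.det_gram_ne_zero_iff_linearIndependent (𝕜 := ℝ)
    (v := ![iteratedDeriv 1 γ 0, iteratedDeriv 2 γ 0, iteratedDeriv 3 γ 0]))
  have hnn : 0 ≤ (Matrix.gram ℝ
      ![iteratedDeriv 1 γ 0, iteratedDeriv 2 γ 0, iteratedDeriv 3 γ 0]).det :=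
    (Matrix.posSemidef_gram ℝ _).det_nonneg
  rw [curveTorsion, div_eq_zero_iff, or_iff_left hd2, Real.sqrt_eq_zero hnn]
  exact not_iff_not.1 (hd3.trans hlin3)

end Surface

/-! ### The curve of cuspidal edge points of the Gauss map -/

section Cuspidal

variable {F : Type*} [NormedAddCommGroup F] [InnerProductSpace ℝ F]
  {r : E2 → F} {u : E2} {v : F}

theorem smoothNear_inner_snd {A : E2 → F} {q : E2} (hA : SmoothNear A q) (v : F) :
    SmoothNear (fun P : E2 × F => inner ℝ (A P.1) P.2) (q, v) :=
  SmoothNear.inner (SmoothNear.comp (g := Prod.fst) hA (contDiff_fst.smoothNear _))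
    (contDiff_snd.smoothNear _)

theorem fderiv_inner_snd {A : E2 → F} {q : E2} (hA : SmoothNear A q) (v : F) (x : E2 × F) :
    fderiv ℝ (fun P : E2 × F => inner ℝ (A P.1) P.2) (q, v) x =
      inner ℝ (A q) x.2 + inner ℝ (fderiv ℝ A q x.1) v := by
  have h1 : HasFDerivAt (fun P : E2 × F => A P.1) _ (q, v) :=
    HasFDerivAt.comp (g := A) (f := Prod.fst) (q, v) hA.differentiableAt.hasFDerivAt hasFDerivAt_fst
  rw [(h1.inner ℝ hasFDerivAt_snd).fderiv]
  simp

theorem gaussKronecker_eq (r : E2 → F) (P : E2 × F) : gaussKronecker r P =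
    inner ℝ (secondDeriv r P.1 (stdVec 0) (stdVec 0)) P.2 *
      inner ℝ (secondDeriv r P.1 (stdVec 1) (stdVec 1)) P.2 -
    inner ℝ (secondDeriv r P.1 (stdVec 0) (stdVec 1)) P.2 *
      inner ℝ (secondDeriv r P.1 (stdVec 1) (stdVec 0)) P.2 := by
  simp [gaussKronecker, normalHessian, Matrix.det_fin_two]

theorem cuspidalEdgeEq_zero (r : E2 → F) (P : E2 × F) : cuspidalEdgeEq r P 0 =
    inner ℝ (secondDeriv r P.1 (stdVec 1) (stdVec 1)) P.2 *
      fderiv ℝ (gaussKronecker r) P (stdVec 0, 0) -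
    inner ℝ (secondDeriv r P.1 (stdVec 0) (stdVec 1)) P.2 *
      fderiv ℝ (gaussKronecker r) P (stdVec 1, 0) := by
  simp [cuspidalEdgeEq, normalHessian, Matrix.adjugate_fin_two, Matrix.mulVec, dotProduct]
  ring

theorem cuspidalEdgeEq_one (r : E2 → F) (P : E2 × F) : cuspidalEdgeEq r P 1 =
    inner ℝ (secondDeriv r P.1 (stdVec 0) (stdVec 0)) P.2 *
      fderiv ℝ (gaussKronecker r) P (stdVec 1, 0) -
    inner ℝ (secondDeriv r P.1 (stdVec 1) (stdVec 0)) P.2 *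
      fderiv ℝ (gaussKronecker r) P (stdVec 0, 0) := by
  simp [cuspidalEdgeEq, normalHessian, Matrix.adjugate_fin_two, Matrix.mulVec, dotProduct]
  ring

theorem SmoothNear.gaussKronecker {q : E2} (hr : SmoothNear r q) (v : F) :
    SmoothNear (gaussKronecker r) (q, v) := by
  have h := fun i j => smoothNear_inner_snd (hr.secondDeriv (stdVec i) (stdVec j)) v
  exact (((h 0 0).mul (h 1 1)).sub ((h 0 1).mul (h 1 0))).congr
    (Eventually.of_forall (gaussKronecker_eq r))

theorem SmoothNear.cuspidalEdgeEq {q : E2} (hr : SmoothNear r q) (v : F) :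
    SmoothNear (cuspidalEdgeEq r) (q, v) := by
  have h := fun i j => smoothNear_inner_snd (hr.secondDeriv (stdVec i) (stdVec j)) v
  have hK : ∀ i, SmoothNear (fun P => _root_.fderiv ℝ (_root_.gaussKronecker r) P (stdVec i, 0))
      (q, v) := fun i => (hr.gaussKronecker v).fderiv.clm_apply (contDiff_const.smoothNear _)
  have h0 := ((h 1 1).mul (hK 0)).sub ((h 0 1).mul (hK 1))
  have h1 := ((h 0 0).mul (hK 1)).sub ((h 1 0).mul (hK 0))
  filter_upwards [h0, h1] with P h0 h1
  refine contDiffAt_pi.2 fun i => ?_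
  fin_cases i
  · exact h0.congr_of_eventuallyEq (Eventually.of_forall (cuspidalEdgeEq_zero r))
  · exact h1.congr_of_eventuallyEq (Eventually.of_forall (cuspidalEdgeEq_one r))

theorem gaussKronecker_slice (hr : SmoothNear r 0) (v : F) : ∀ᶠ q in 𝓝 0,
    gaussKronecker r (q, v) = hessDet (fun q => inner ℝ (r q) v) q := by
  filter_upwards [hr.eventually] with q hq
  simp only [gaussKronecker_eq, hessDet, secondDeriv_inner hq]

/-- The derivative of a function of `(q, n)` in a direction `(w, 0)`, from its restriction to the
slice `n = v`. -/
theorem fderiv_slice {Z : Type*} [NormedAddCommGroup Z] [NormedSpace ℝ Z] {G : E2 × F → Z} {q : E2}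
    (hG : SmoothNear G (q, v)) (w : E2) :
    fderiv ℝ G (q, v) (w, 0) = fderiv ℝ (fun q => G (q, v)) q w := by
  have h1 : HasFDerivAt (fun q => G (q, v)) _ q :=
    hG.differentiableAt.hasFDerivAt.comp q (hasFDerivAt_prodMk_left q v)
  rw [h1.fderiv]; simp

theorem fderiv_gaussKronecker_slice (hr : SmoothNear r 0) (v : F) : ∀ᶠ q in 𝓝 0, ∀ w,
    fderiv ℝ (gaussKronecker r) (q, v) (w, 0) =
      fderiv ℝ (hessDet (fun q => inner ℝ (r q) v)) q w := by
  filter_upwards [hr.eventually, (gaussKronecker_slice hr v).eventually_nhds] with q hq h1 w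
  have h2 : (fun q => gaussKronecker r (q, v)) =ᶠ[𝓝 q] _ := h1
  rw [fderiv_slice (hq.gaussKronecker v), h2.fderiv_eq]

theorem fderiv_cuspidalEdgeEq_slice (hr : SmoothNear r 0) (v : F) (w : E2) :
    fderiv ℝ (cuspidalEdgeEq r) (0, v) (w, 0) 0 =
      fderiv ℝ (hessCusp (fun q => inner ℝ (r q) v)) 0 w := by
  have h1 : (fun q => cuspidalEdgeEq r (q, v) 0) =ᶠ[𝓝 0]
      hessCusp (fun q => inner ℝ (r q) v) := by
    filter_upwards [hr.eventually, fderiv_gaussKronecker_slice hr v] with q hq h1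
    simp only [cuspidalEdgeEq_zero, hessCusp, secondDeriv_inner hq, h1]
  have h2 := fderiv_linear_image (ContinuousLinearMap.proj (R := ℝ) (φ := fun _ : Fin 2 => ℝ) 0)
    (hr.cuspidalEdgeEq v) (w, 0)
  have h3 := fderiv_slice
    ((hr.cuspidalEdgeEq v).clm_comp (ContinuousLinearMap.proj (R := ℝ) (φ := fun _ : Fin 2 => ℝ) 0)) w
  rw [← h1.fderiv_eq]
  exact h2.symm.trans h3

/-- A linear equation that does not vanish on `X` cuts the dimension by one. -/
theorem finrank_inf_ker {V : Type*} [AddCommGroup V] [Module ℝ V] [FiniteDimensional ℝ V]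
    {X : Submodule ℝ V} {ℓ : V →ₗ[ℝ] ℝ} {x : V} (hx : x ∈ X) (hℓ : ℓ x ≠ 0) :
    Module.finrank ℝ (X ⊓ LinearMap.ker ℓ : Submodule ℝ V) + 1 = Module.finrank ℝ X := by
  have h1 := LinearMap.finrank_range_add_finrank_ker (ℓ.domRestrict X)
  have h2 : LinearMap.range (ℓ.domRestrict X) = ⊤ := by
    refine LinearMap.range_eq_top.2 (LinearMap.surjective ?_)
    intro h
    exact hℓ (congrArg (fun T : X →ₗ[ℝ] ℝ => T ⟨x, hx⟩) h)
  have h3 : (X ⊓ LinearMap.ker ℓ : Submodule ℝ V) =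
      (LinearMap.ker (ℓ.domRestrict X)).map X.subtype := by
    rw [← Submodule.map_comap_subtype]; rfl
  rw [h3, Submodule.finrank_map_subtype_eq]
  rw [h2, finrank_top, Module.finrank_self] at h1
  omega

theorem fderiv_unitNormalEq (hr : SmoothNear r 0) (v : F) (x : E2 × F) :
    fderiv ℝ (unitNormalEq r) (0, v) x =
      (fun i => inner ℝ (fderiv ℝ r 0 (stdVec i)) x.2 + inner ℝ (secondDeriv r 0 x.1 (stdVec i)) v,
        2 * inner ℝ v x.2) := by
  have hA : ∀ i, SmoothNear (fun q => fderiv ℝ r q (stdVec i)) 0 := fun i =>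
    hr.fderiv.clm_apply (contDiff_const.smoothNear 0)
  have h1 : HasFDerivAt (fun (P : E2 × F) (i : Fin 2) => inner ℝ (fderiv ℝ r P.1 (stdVec i)) P.2)
      (ContinuousLinearMap.pi fun i =>
        fderiv ℝ (fun P : E2 × F => inner ℝ (fderiv ℝ r P.1 (stdVec i)) P.2) (0, v)) (0, v) :=
    hasFDerivAt_pi.2 fun i => (smoothNear_inner_snd (hA i) v).differentiableAt.hasFDerivAt
  have h2 : HasFDerivAt (fun P : E2 × F => ‖P.2‖ ^ 2 - 1) _ (0, v) :=
    (HasFDerivAt.norm_sq (f := Prod.snd) (x := ((0 : E2), v)) hasFDerivAt_snd).sub_const 1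
  have h3 : HasFDerivAt (unitNormalEq r) _ (0, v) := h1.prodMk h2
  rw [h3.fderiv]
  ext i
  · simp [fderiv_inner_snd (hA i), secondDeriv_eq_fderiv hr]
  · simp

end Cuspidal

section Transversal

variable {F : Type*} [NormedAddCommGroup F] [InnerProductSpace ℝ F] [FiniteDimensional ℝ F]
  {r : E2 → F} {u : E2} {v : F}

/-- The linearised equations of the unit normal bundle are independent. -/
theorem finrank_ker_fderiv_unitNormalEq (hr : SmoothNear r 0)
    (hinj : Function.Injective (fderiv ℝ r 0)) (hF : Module.finrank ℝ F = 4)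
    (hv : ‖v‖ = 1) (hvT : ∀ w, inner ℝ (fderiv ℝ r 0 w) v = 0) :
    Module.finrank ℝ (LinearMap.ker (fderiv ℝ (unitNormalEq r) (0, v)).toLinearMap) = 3 := by
  let Q : E2 →ₗ[ℝ] (Fin 2 → ℝ) := LinearMap.pi fun i =>
    (innerSL ℝ (fderiv ℝ r 0 (stdVec i))).toLinearMap ∘ₗ (fderiv ℝ r 0).toLinearMap
  have hQ : ∀ z i, Q z i = inner ℝ (fderiv ℝ r 0 (stdVec i)) (fderiv ℝ r 0 z) := fun z i => rfl
  have hQinj : Function.Injective Q := by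
    rw [injective_iff_map_eq_zero]
    intro z hz
    have h1 : inner ℝ (fderiv ℝ r 0 z) (fderiv ℝ r 0 z) = 0 := by
      conv_lhs => enter [2]; rw [E2.eq_of_coord (q := z), map_add, map_smul, map_smul]
      rw [inner_add_left, real_inner_smul_left, real_inner_smul_left, ← hQ, ← hQ, hz]
      simp
    exact (injective_iff_map_eq_zero _).1 hinj z (inner_self_eq_zero.1 h1)
  have hQsurj : Function.Surjective Q :=
    (LinearMap.injective_iff_surjective_of_finrank_eq_finrank (by simp)).1 hQinj
  have hsurj : LinearMap.range (fderiv ℝ (unitNormalEq r) (0, v)).toLinearMap = ⊤ := by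
    rw [LinearMap.range_eq_top]
    rintro ⟨y, s⟩
    obtain ⟨z, hz⟩ := hQsurj y
    refine ⟨(0, fderiv ℝ r 0 z + (s / 2) • v), ?_⟩
    refine (fderiv_unitNormalEq hr v _).trans ?_
    have hvv : inner ℝ v v = (1 : ℝ) := by rw [real_inner_self_eq_norm_sq, hv]; norm_num
    ext i
    · simp only [inner_add_right, real_inner_smul_right, hvT, ← hQ, hz]
      simp [secondDeriv]
    · have hvz : inner ℝ v (fderiv ℝ r 0 z) = 0 := by rw [real_inner_comm]; exact hvT z
      simp only [inner_add_right, real_inner_smul_right, hvv, hvz]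
      ring
  have h1 := LinearMap.finrank_range_add_finrank_ker
    (fderiv ℝ (unitNormalEq r) (0, v)).toLinearMap
  rw [hsurj, finrank_top, Module.finrank_prod, Module.finrank_prod, hF] at h1
  simp at h1
  omega

theorem inner_regularII {n : F} (hn : ∀ w, inner ℝ (fderiv ℝ r 0 w) n = 0) (u w : E2) :
    inner ℝ (regularII r 0 u w) n = inner ℝ (secondDeriv r 0 u w) n := by
  have hn' : n ∈ (tangentPlane r 0)ᗮ := by
    rw [Submodule.mem_orthogonal]
    rintro _ ⟨w, rfl⟩
    exact hn w
  rw [regularII, Submodule.inner_starProjection_left_eq_right,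
    Submodule.starProjection_eq_self_iff.2 hn']

theorem inner_fderiv_regularII (z u w : E2) :
    inner ℝ (fderiv ℝ r 0 z) (regularII r 0 u w) = 0 :=
  (Submodule.mem_orthogonal _ _).1 (Submodule.starProjection_apply_mem _ _) _ ⟨z, rfl⟩

/-- Moving the normal vector in the direction `II(u, u)` is transversal to the parabolic set. -/
theorem fderiv_gaussKronecker_normal (hr : SmoothNear r 0)
    (hk : ∀ w, inner ℝ (secondDeriv r 0 u w) v = 0) :
    u 0 ^ 2 * fderiv ℝ (gaussKronecker r) (0, v) (0, regularII r 0 u u) =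
      inner ℝ (secondDeriv r 0 (stdVec 1) (stdVec 1)) v * ‖regularII r 0 u u‖ ^ 2 := by
  set ν := regularII r 0 u u with hν
  have hs := secondDeriv_symm hr (stdVec 1) (stdVec 0)
  have hd := fun i j => fderiv_inner_snd (hr.secondDeriv (stdVec i) (stdVec j)) v (0, ν)
  have hD := fun i j =>
    (smoothNear_inner_snd (hr.secondDeriv (stdVec i) (stdVec j)) v).differentiableAt.hasFDerivAt
  have hK := ((hD 0 0).mul (hD 1 1)).sub ((hD 0 1).mul (hD 1 0))
  have hK' := hK.congr_of_eventuallyEq (Eventually.of_forall (gaussKronecker_eq r))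
  have e0 := hk (stdVec 0)
  have e1 := hk (stdVec 1)
  rw [secondDeriv_left, inner_add_left, real_inner_smul_left, real_inner_smul_left] at e0 e1
  have hνν : ‖ν‖ ^ 2 = u 0 * (u 0 * inner ℝ (secondDeriv r 0 (stdVec 0) (stdVec 0)) ν) +
      2 * (u 0 * (u 1 * inner ℝ (secondDeriv r 0 (stdVec 0) (stdVec 1)) ν)) +
      u 1 * (u 1 * inner ℝ (secondDeriv r 0 (stdVec 1) (stdVec 1)) ν) := by
    rw [← real_inner_self_eq_norm_sq]
    conv_lhs => rw [hν, inner_regularII (inner_fderiv_regularII · u u)]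
    rw [← hν, secondDeriv_right, secondDeriv_left _ _ u (stdVec 0),
      secondDeriv_left _ _ u (stdVec 1), hs]
    simp only [inner_add_left, real_inner_smul_left]
    ring
  rw [hK'.fderiv, hνν]
  simp only [sub_apply, add_apply, smul_apply, hd, smul_eq_mul, map_zero, inner_zero_left, add_zero,
    hs]
  rw [hs] at e0
  set m00 := inner ℝ (secondDeriv r 0 (stdVec 0) (stdVec 0)) ν
  set m01 := inner ℝ (secondDeriv r 0 (stdVec 0) (stdVec 1)) ν
  set m11 := inner ℝ (secondDeriv r 0 (stdVec 1) (stdVec 1)) ν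
  linear_combination (u 0 * m11) * e0 - (u 1 * m11 + 2 * u 0 * m01) * e1

/-- The curve of cuspidal edge points passes through `(0, v)` exactly if the cubic form vanishes
on the kernel direction `u`, and `u` is transversal to it exactly if moreover the defining
function `hessCusp` of this curve has nonzero derivative along `u`. -/
theorem transversalToCuspidalEdge_iff (hr : SmoothNear r 0)
    (hinj : Function.Injective (fderiv ℝ r 0)) (hF : Module.finrank ℝ F = 4)
    (hv : ‖v‖ = 1) (hvT : ∀ w, inner ℝ (fderiv ℝ r 0 w) v = 0) (hu : u ≠ 0)
    (hk : ∀ w, inner ℝ (secondDeriv r 0 u w) v = 0)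
    (hyy : inner ℝ (secondDeriv r 0 (stdVec 1) (stdVec 1)) v ≠ 0)
    (hII : regularII r 0 u u ≠ 0) :
    TransversalToCuspidalEdge r (0, v) u ↔ thirdDeriv (fun q => inner ℝ (r q) v) 0 u u u = 0 ∧
      fderiv ℝ (hessCusp (fun q => inner ℝ (r q) v)) 0 u ≠ 0 := by
  have hs := secondDeriv_symm hr (stdVec 1) (stdVec 0)
  have e0 := hk (stdVec 0)
  have e1 := hk (stdVec 1)
  rw [secondDeriv_left, inner_add_left, real_inner_smul_left, real_inner_smul_left] at e0 e1
  rw [hs] at e0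
  have hu0 : u 0 ≠ 0 := by
    intro h
    rw [h, zero_mul, zero_add] at e1
    apply hu
    rw [E2.eq_of_coord (q := u), h, (mul_eq_zero.1 e1).resolve_right hyy]; simp
  have h0 : fderiv ℝ (fun q => inner ℝ (r q) v) 0 = 0 := by
    ext w; rw [fderiv_inner_const hr, hvT]; rfl
  have hK0 : ∀ w, fderiv ℝ (gaussKronecker r) (0, v) (w, 0) =
      fderiv ℝ (hessDet (fun q => inner ℝ (r q) v)) 0 w :=
    (fderiv_gaussKronecker_slice hr v).self_of_nhds
  have hT3 : fderiv ℝ (gaussKronecker r) (0, v) (u, 0) = 0 ↔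
      thirdDeriv (fun q => inner ℝ (r q) v) 0 u u u = 0 := by
    rw [hK0]
    exact fderiv_hessDet_eq_zero_iff (hr.inner_const v) h0 (by rwa [secondDeriv_inner hr])
      (fun w => by rw [secondDeriv_inner hr, hk])
  rw [← hT3, ← fderiv_cuspidalEdgeEq_slice hr v u]
  set K := gaussKronecker r with hK
  set E := cuspidalEdgeEq r with hE
  have hKs : SmoothNear K (0, v) := hr.gaussKronecker v
  have hEs : SmoothNear E (0, v) := hr.cuspidalEdgeEq v
  have hEi : ∀ (i : Fin 2) x, fderiv ℝ (fun P => E P i) (0, v) x = fderiv ℝ E (0, v) x i :=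
    fun i x => fderiv_linear_image (ContinuousLinearMap.proj (R := ℝ) (φ := fun _ : Fin 2 => ℝ) i)
      hEs x
  have hKv : K (0, v) = 0 := by
    have : u 0 * K (0, v) = 0 := by
      rw [hK, gaussKronecker_eq]
      simp only [hs]
      linear_combination inner ℝ (secondDeriv r 0 (stdVec 1) (stdVec 1)) v * e0 -
        inner ℝ (secondDeriv r 0 (stdVec 0) (stdVec 1)) v * e1
    exact (mul_eq_zero.1 this).resolve_left hu0
  have hdK : fderiv ℝ K (0, v) (u, 0) = u 0 * fderiv ℝ K (0, v) (stdVec 0, 0) +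
      u 1 * fderiv ℝ K (0, v) (stdVec 1, 0) := by
    have : (u, (0 : F)) = u 0 • (stdVec 0, (0 : F)) + u 1 • (stdVec 1, (0 : F)) := by
      ext1
      · simpa using E2.eq_of_coord (q := u)
      · simp
    rw [this, map_add, map_smul, map_smul]; rfl
  -- the product of the Hessian matrix with its adjugate is `K`, so on the tangent space of the
  -- parabolic set the second component of the differential of `E` is determined by the first
  have hdE : fderiv ℝ K (0, v) (u, 0) = 0 → ∀ x, fderiv ℝ K (0, v) x = 0 →
      fderiv ℝ E (0, v) x 0 = 0 → fderiv ℝ E (0, v) x = 0 := by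
    intro hcub x hx hx0
    rw [hdK] at hcub
    have hE0 : E (0, v) 0 = 0 := by
      have : u 0 * E (0, v) 0 = 0 := by
        rw [hE, cuspidalEdgeEq_zero, ← hK]
        linear_combination inner ℝ (secondDeriv r 0 (stdVec 1) (stdVec 1)) v * hcub -
          fderiv ℝ K (0, v) (stdVec 1, 0) * e1
      exact (mul_eq_zero.1 this).resolve_left hu0
    have hE1 : E (0, v) 1 = 0 := by
      have : u 0 * E (0, v) 1 = 0 := by
        rw [hE, cuspidalEdgeEq_one, ← hK]
        simp only [hs]
        linear_combination fderiv ℝ K (0, v) (stdVec 1, 0) * e0 -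
          inner ℝ (secondDeriv r 0 (stdVec 0) (stdVec 1)) v * hcub
      exact (mul_eq_zero.1 this).resolve_left hu0
    have hfun : (fun P : E2 × F => inner ℝ (secondDeriv r P.1 (stdVec 1) (stdVec 0)) P.2 * E P 0 +
        inner ℝ (secondDeriv r P.1 (stdVec 1) (stdVec 1)) P.2 * E P 1) =
        fun P => K P * fderiv ℝ K P (stdVec 1, 0) := by
      funext P
      rw [hE, cuspidalEdgeEq_zero, cuspidalEdgeEq_one, ← hK]
      conv_rhs => rw [hK, gaussKronecker_eq, ← hK]
      ring
    have hM := fun j => (smoothNear_inner_snd (hr.secondDeriv (stdVec 1) (stdVec j))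
      v).differentiableAt.hasFDerivAt
    have hEd := fun i : Fin 2 => (hEs.clm_comp
      (ContinuousLinearMap.proj (R := ℝ) (φ := fun _ : Fin 2 => ℝ) i)).differentiableAt.hasFDerivAt
    have hl := ((hM 0).fun_mul (hEd 0)).fun_add ((hM 1).fun_mul (hEd 1))
    have hr' := hKs.differentiableAt.hasFDerivAt.fun_mul
      (hKs.fderiv.clm_apply (contDiff_const (c := ((stdVec 1, (0 : F)) : E2 × F)) |>.smoothNear
        (0, v))).differentiableAt.hasFDerivAt
    have hx1 := congrArg (fun T : E2 × F →L[ℝ] ℝ => T x)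
      (hl.unique (hr'.congr_of_eventuallyEq (Eventually.of_forall (congrFun hfun))))
    simp only [ContinuousLinearMap.proj_apply, hE0, hE1, hKv, add_apply, smul_apply, smul_eq_mul,
      hEi, hx, hx0, zero_mul, mul_zero, zero_add, add_zero] at hx1
    funext i; fin_cases i
    · exact hx0
    · exact (mul_eq_zero.1 hx1).resolve_left hyy
  have huN : fderiv ℝ (unitNormalEq r) (0, v) (u, 0) = 0 := by
    rw [fderiv_unitNormalEq hr]
    ext i
    · simp [hk]
    · simp
  have huker : u ∈ gaussKernel r (0, v) := hk
  constructor
  · rintro ⟨⟨-, -, hP⟩, -, hnt⟩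
    have hcub := hP u huker
    refine ⟨hcub, fun hE0 => hnt ⟨⟨huN, hcub⟩, ?_⟩⟩
    exact hdE hcub _ hcub hE0
  · rintro ⟨hcub, hEu⟩
    have hker : gaussKernel r (0, v) = {x | ∃ a : ℝ, x = a • u} := by
      ext w
      constructor
      · intro hw
        refine ⟨w 0 / u 0, ?_⟩
        have e2 := hw (stdVec 1)
        rw [secondDeriv_left, inner_add_left, real_inner_smul_left, real_inner_smul_left] at e2
        have e3 : (u 0 * w 1 - u 1 * w 0) *
            inner ℝ (secondDeriv r 0 (stdVec 1) (stdVec 1)) v = 0 := by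
          linear_combination u 0 * e2 - w 0 * e1
        have e4 := (mul_eq_zero.1 e3).resolve_right hyy
        ext i; fin_cases i
        · simp; field_simp
        · simp; field_simp; linarith
      · rintro ⟨a, rfl⟩ w'
        have : secondDeriv r 0 (a • u) w' = a • secondDeriv r 0 u w' := by simp [secondDeriv]
        change inner ℝ (secondDeriv r 0 (a • u) w') v = 0
        rw [this, real_inner_smul_left, hk, mul_zero]
    refine ⟨⟨⟨hvT, hv⟩, ⟨u, hu, hker⟩, ?_⟩, ?_, ?_⟩
    · rw [hker]
      rintro _ ⟨a, rfl⟩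
      have : (a • u, (0 : F)) = a • (u, (0 : F)) := by simp
      rw [this, map_smul, hcub, smul_zero]
    · set X := LinearMap.ker (fderiv ℝ (unitNormalEq r) (0, v)).toLinearMap with hX
      let ℓ : E2 × F →ₗ[ℝ] ℝ := LinearMap.proj 0 ∘ₗ (fderiv ℝ E (0, v)).toLinearMap
      have hℓ : ∀ x, ℓ x = fderiv ℝ E (0, v) x 0 := fun x => rfl
      have hT : cuspidalEdgeTangent r (0, v) =
          X ⊓ LinearMap.ker (fderiv ℝ K (0, v)).toLinearMap ⊓ LinearMap.ker ℓ := by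
        refine le_antisymm ?_ ?_
        · rintro x ⟨hx, hx'⟩
          refine ⟨hx, ?_⟩
          have : fderiv ℝ E (0, v) x = 0 := hx'
          exact LinearMap.mem_ker.2 ((hℓ x).trans (by rw [this]; rfl))
        · rintro x ⟨hx, hx'⟩
          exact ⟨hx, hdE hcub x hx.2 hx'⟩
      have hN : ((0, regularII r 0 u u) : E2 × F) ∈ X := by
        refine LinearMap.mem_ker.2 ((fderiv_unitNormalEq hr v _).trans ?_)
        ext i
        · simp [inner_fderiv_regularII, secondDeriv]
        · simp only [real_inner_comm _ v, inner_regularII hvT, hk]; simp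
      have hKN : (fderiv ℝ K (0, v)).toLinearMap (0, regularII r 0 u u) ≠ 0 := by
        intro h
        have h' : fderiv ℝ K (0, v) (0, regularII r 0 u u) = 0 := h
        have := fderiv_gaussKronecker_normal hr hk
        rw [← hK, h', mul_zero] at this
        have h2 : ‖regularII r 0 u u‖ ^ 2 ≠ 0 := by simpa using hII
        exact mul_ne_zero hyy h2 this.symm
      have f1 := finrank_ker_fderiv_unitNormalEq hr hinj hF hv hvT
      have f2 := finrank_inf_ker hN hKN
      have f3 := finrank_inf_ker (X := X ⊓ LinearMap.ker (fderiv ℝ K (0, v)).toLinearMap)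
        (ℓ := ℓ) (x := (u, 0)) ⟨huN, hcub⟩ hEu
      rw [hT]
      rw [← hX] at f1
      omega
    · rintro ⟨-, h⟩
      have h' : fderiv ℝ E (0, v) (u, 0) = 0 := h
      exact hEu (by rw [h']; rfl)

end Transversal

/-! ### The parabolic curve -/

section Parabolic

variable {F : Type*} [NormedAddCommGroup F] [InnerProductSpace ℝ F]

/-- The component of `x` orthogonal to the plane spanned by `a` and `b`, by Cramer's rule (for
linearly independent `a` and `b`). -/
def normalPart (a b x : F) : F :=
  x - ((inner ℝ b b * inner ℝ x a - inner ℝ a b * inner ℝ x b) *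
      (inner ℝ a a * inner ℝ b b - inner ℝ a b * inner ℝ a b)⁻¹) • a -
    ((inner ℝ a a * inner ℝ x b - inner ℝ a b * inner ℝ x a) *
      (inner ℝ a a * inner ℝ b b - inner ℝ a b * inner ℝ a b)⁻¹) • b

variable [FiniteDimensional ℝ F] {r : E2 → F} {v : F}

theorem regularII_eq_normalPart {q : E2}
    (hq : inner ℝ (fderiv ℝ r q (stdVec 0)) (fderiv ℝ r q (stdVec 0)) *
        inner ℝ (fderiv ℝ r q (stdVec 1)) (fderiv ℝ r q (stdVec 1)) -
      inner ℝ (fderiv ℝ r q (stdVec 0)) (fderiv ℝ r q (stdVec 1)) *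
        inner ℝ (fderiv ℝ r q (stdVec 0)) (fderiv ℝ r q (stdVec 1)) ≠ 0) (u w : E2) :
    regularII r q u w = normalPart (fderiv ℝ r q (stdVec 0)) (fderiv ℝ r q (stdVec 1))
      (secondDeriv r q u w) := by
  set a := fderiv ℝ r q (stdVec 0) with ha
  set b := fderiv ℝ r q (stdVec 1) with hb
  set x := secondDeriv r q u w with hx
  set Δ := inner ℝ a a * inner ℝ b b - inner ℝ a b * inner ℝ a b with hΔ
  have hmem : ∀ s t : ℝ, s • a + t • b ∈ tangentPlane r q := fun s t =>
    ⟨s • stdVec 0 + t • stdVec 1, by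
      change fderiv ℝ r q _ = _
      rw [map_add, map_smul, map_smul]⟩
  have hinner : ∀ y : F, inner ℝ a y = 0 → inner ℝ b y = 0 → y ∈ (tangentPlane r q)ᗮ := by
    intro y h1 h2
    rw [Submodule.mem_orthogonal]
    rintro _ ⟨z, rfl⟩
    change inner ℝ (fderiv ℝ r q z) y = 0
    rw [E2.eq_of_coord (q := z), map_add, map_smul, map_smul, inner_add_left,
      real_inner_smul_left, real_inner_smul_left, ← ha, ← hb, h1, h2]
    ring
  have hn : normalPart a b x ∈ (tangentPlane r q)ᗮ := by
    apply hinner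
    · simp only [normalPart, inner_sub_right, real_inner_smul_right, ← hΔ]
      rw [real_inner_comm a x]
      field_simp
      rw [hΔ]; ring
    · simp only [normalPart, inner_sub_right, real_inner_smul_right, ← hΔ]
      rw [real_inner_comm b x, real_inner_comm a b]
      field_simp
      rw [hΔ]; ring
  have ht : x - normalPart a b x ∈ tangentPlane r q := by
    have := hmem ((inner ℝ b b * inner ℝ x a - inner ℝ a b * inner ℝ x b) * Δ⁻¹)
      ((inner ℝ a a * inner ℝ x b - inner ℝ a b * inner ℝ x a) * Δ⁻¹)
    convert this using 1
    simp only [normalPart]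
    abel
  have h1 : (tangentPlane r q)ᗮ.starProjection (x - normalPart a b x) = 0 :=
    Submodule.starProjection_orthogonal_apply_eq_zero ht
  rw [map_sub, Submodule.starProjection_eq_self_iff.2 hn, sub_eq_zero] at h1
  exact h1

theorem SmoothNear.inv {X : Type*} [NormedAddCommGroup X] [NormedSpace ℝ X] {k : X → ℝ} {a : X}
    (h : SmoothNear k a) (h0 : k a ≠ 0) : SmoothNear (fun x => (k x)⁻¹) a := by
  filter_upwards [h, h.continuousAt.eventually_ne h0] with x hx hx' using hx.inv hx'

theorem SmoothNear.smul {X Y : Type*} [NormedAddCommGroup X] [NormedSpace ℝ X]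
    [NormedAddCommGroup Y] [NormedSpace ℝ Y] {k : X → ℝ} {g : X → Y} {a : X}
    (h : SmoothNear k a) (h' : SmoothNear g a) : SmoothNear (fun x => k x • g x) a := by
  filter_upwards [h, h'] with x hx hx' using hx.smul hx'

/-- The second fundamental form is a combination of the second and first derivatives with smooth
coefficients. -/
theorem exists_regularII_eq (hr : SmoothNear r 0) (hinj : Function.Injective (fderiv ℝ r 0))
    (u w : E2) : ∃ α β : E2 → ℝ, SmoothNear α 0 ∧ SmoothNear β 0 ∧
      ∀ᶠ q in 𝓝 0, regularII r q u w = secondDeriv r q u w - α q • fderiv ℝ r q (stdVec 0) -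
        β q • fderiv ℝ r q (stdVec 1) := by
  have hA : ∀ i, SmoothNear (fun q => fderiv ℝ r q (stdVec i)) 0 := fun i =>
    hr.fderiv.clm_apply (contDiff_const.smoothNear 0)
  have hx := hr.secondDeriv u w
  have hG := fun i j => (hA i).inner (hA j)
  have hΔ := ((hG 0 0).mul (hG 1 1)).sub ((hG 0 1).mul (hG 0 1))
  have hΔ0 : inner ℝ (fderiv ℝ r 0 (stdVec 0)) (fderiv ℝ r 0 (stdVec 0)) *
        inner ℝ (fderiv ℝ r 0 (stdVec 1)) (fderiv ℝ r 0 (stdVec 1)) -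
      inner ℝ (fderiv ℝ r 0 (stdVec 0)) (fderiv ℝ r 0 (stdVec 1)) *
        inner ℝ (fderiv ℝ r 0 (stdVec 0)) (fderiv ℝ r 0 (stdVec 1)) ≠ 0 := by
    have hl : LinearIndependent ℝ ![fderiv ℝ r 0 (stdVec 0), fderiv ℝ r 0 (stdVec 1)] := by
      rw [LinearIndependent.pair_iff]
      intro s t hst
      rw [← map_smul, ← map_smul, ← map_add, ← E2.mk_eq] at hst
      have := (injective_iff_map_eq_zero _).1 hinj _ hst
      exact ⟨by simpa using congrArg (fun q : E2 => q 0) this,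
        by simpa using congrArg (fun q : E2 => q 1) this⟩
    have := (Matrix.det_gram_ne_zero_iff_linearIndependent (𝕜 := ℝ)).2 hl
    rw [Matrix.det_fin_two] at this
    simpa [Matrix.gram_apply, real_inner_comm] using this
  refine ⟨_, _, (((hG 1 1).mul (hx.inner (hA 0))).sub ((hG 0 1).mul (hx.inner (hA 1)))).mul
    (hΔ.inv hΔ0), (((hG 0 0).mul (hx.inner (hA 1))).sub ((hG 0 1).mul (hx.inner (hA 0)))).mul
    (hΔ.inv hΔ0), ?_⟩
  filter_upwards [hΔ.continuousAt.eventually_ne hΔ0] with q hq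
  exact regularII_eq_normalPart hq u w

theorem SmoothNear.regularII (hr : SmoothNear r 0) (hinj : Function.Injective (_root_.fderiv ℝ r 0))
    (u w : E2) : SmoothNear (fun q => regularII r q u w) 0 := by
  obtain ⟨α, β, hα, hβ, he⟩ := exists_regularII_eq hr hinj u w
  have hA : ∀ i, SmoothNear (fun q => _root_.fderiv ℝ r q (stdVec i)) 0 := fun i =>
    hr.fderiv.clm_apply (contDiff_const.smoothNear 0)
  exact (((hr.secondDeriv u w).sub (hα.smul (hA 0))).sub (hβ.smul (hA 1))).congr he

/-- Where `II(∂x, ∂x) = 0`, only the derivative of this vector contributes to the differential of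
the resultant. -/
theorem fderiv_resultant (hr : SmoothNear r 0) (hinj : Function.Injective (fderiv ℝ r 0))
    (hA : regularII r 0 (stdVec 0) (stdVec 0) = 0) (w : E2) :
    fderiv ℝ (resultant r) 0 w =
      areaProduct (fderiv ℝ (fun q => regularII r q (stdVec 0) (stdVec 0)) 0 w)
        (regularII r 0 (stdVec 0) (stdVec 1)) (regularII r 0 (stdVec 0) (stdVec 1))
        (regularII r 0 (stdVec 1) (stdVec 1)) := by
  have sA := (hr.regularII hinj (stdVec 0) (stdVec 0)).differentiableAt.hasFDerivAt
  have sB := (hr.regularII hinj (stdVec 0) (stdVec 1)).differentiableAt.hasFDerivAt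
  have sC := (hr.regularII hinj (stdVec 1) (stdVec 1)).differentiableAt.hasFDerivAt
  have p1 := ((sA.inner ℝ sB).fun_mul (sB.inner ℝ sC)).fun_sub
    ((sA.inner ℝ sC).fun_mul (sB.inner ℝ sB))
  have p2 := ((sA.inner ℝ sA).fun_mul (sC.inner ℝ sC)).fun_sub
    ((sA.inner ℝ sC).fun_mul (sC.inner ℝ sA))
  have p3 := ((p1.const_mul 4).fun_sub p2).const_mul (1 / 4 : ℝ)
  have p4 : HasFDerivAt (resultant r) _ 0 := p3
  rw [p4.fderiv]
  simp [hA, areaProduct]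
  ring

/-- Expanding `II(∂y, ∂y)` in the orthogonal basis `II(∂x, ∂y)`, `v` of the normal plane leaves only
the `v` component of the derivative of `II(∂x, ∂x)`, which is the cubic form of the height
function. -/
theorem exists_fderiv_resultant (hr : SmoothNear r 0) (hinj : Function.Injective (fderiv ℝ r 0))
    (hF : Module.finrank ℝ F = 4) (hv : v ≠ 0) (hvT : ∀ w, inner ℝ (fderiv ℝ r 0 w) v = 0)
    (hk : ∀ w, inner ℝ (secondDeriv r 0 (stdVec 0) w) v = 0)
    (hyy : inner ℝ (secondDeriv r 0 (stdVec 1) (stdVec 1)) v ≠ 0)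
    (hA : regularII r 0 (stdVec 0) (stdVec 0) = 0)
    (hB : regularII r 0 (stdVec 0) (stdVec 1) ≠ 0) :
    ∃ κ : ℝ, κ ≠ 0 ∧ fderiv ℝ (resultant r) 0 (stdVec 0) =
      κ * thirdDeriv (fun q => inner ℝ (r q) v) 0 (stdVec 0) (stdVec 0) (stdVec 0) := by
  set T := tangentPlane r 0 with hT
  set B := regularII r 0 (stdVec 0) (stdVec 1) with hBdef
  set C := regularII r 0 (stdVec 1) (stdVec 1) with hCdef
  have hBv : inner ℝ B v = 0 := by rw [hBdef, inner_regularII hvT, hk]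
  have hCv : inner ℝ C v ≠ 0 := by rwa [hCdef, inner_regularII hvT]
  have hvv : inner ℝ v v ≠ (0 : ℝ) := fun h => hv (inner_self_eq_zero.1 h)
  have hBB : inner ℝ B B ≠ (0 : ℝ) := fun h => hB (inner_self_eq_zero.1 h)
  -- the normal plane is spanned by the orthogonal vectors `B` and `v`
  have hC : ∃ β μ : ℝ, β • B + μ • v = C := by
    have hl : LinearIndependent ℝ ![B, v] := by
      rw [LinearIndependent.pair_iff]
      intro s t hst
      have e1 := congrArg (fun x => inner ℝ x v) hst
      have e2 := congrArg (fun x => inner ℝ B x) hst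
      simp only [inner_add_left, real_inner_smul_left, hBv, inner_zero_left, mul_zero,
        zero_add] at e1
      simp only [inner_add_right, real_inner_smul_right, hBv, inner_zero_right, mul_zero,
        add_zero] at e2
      exact ⟨(mul_eq_zero.1 e2).resolve_right hBB, (mul_eq_zero.1 e1).resolve_right hvv⟩
    have hle : Submodule.span ℝ (Set.range ![B, v]) ≤ Tᗮ := by
      rw [Submodule.span_le]
      rintro _ ⟨i, rfl⟩
      fin_cases i
      · exact Submodule.starProjection_apply_mem _ _
      · change v ∈ Tᗮ
        rw [Submodule.mem_orthogonal]
        rintro _ ⟨w, rfl⟩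
        exact hvT w
    have h1 := finrank_span_eq_card hl
    have h2 := T.finrank_add_finrank_orthogonal
    have h3 : Module.finrank ℝ T = 2 := by
      have := LinearMap.finrank_range_of_inj (f := (fderiv ℝ r 0).toLinearMap) hinj
      rw [hT, tangentPlane, this]; simp
    have h4 := Submodule.eq_of_le_of_finrank_eq hle (by
      rw [h1, Fintype.card_fin]; omega)
    have h5 : C ∈ Tᗮ := Submodule.starProjection_apply_mem _ _
    rw [← h4] at h5
    have h6 : ∃ μ β : ℝ, μ • v + β • B = C := by simpa [Submodule.mem_span_pair] using h5
    obtain ⟨μ, β, h⟩ := h6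
    exact ⟨β, μ, by rw [add_comm]; exact h⟩
  obtain ⟨β, μ, hC⟩ := hC
  have hμ : inner ℝ C v = μ * inner ℝ v v := by
    rw [← hC, inner_add_left, real_inner_smul_left, real_inner_smul_left, hBv]; ring
  have hμ0 : μ ≠ 0 := by rintro rfl; apply hCv; rw [hμ, zero_mul]
  refine ⟨-(μ * inner ℝ B B), neg_ne_zero.2 (mul_ne_zero hμ0 hBB), ?_⟩
  have hdA : inner ℝ (fderiv ℝ (fun q => regularII r q (stdVec 0) (stdVec 0)) 0 (stdVec 0)) v =
      thirdDeriv (fun q => inner ℝ (r q) v) 0 (stdVec 0) (stdVec 0) (stdVec 0) := by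
    obtain ⟨a, b, ha, hb, he⟩ := exists_regularII_eq hr hinj (stdVec 0) (stdVec 0)
    rw [← fderiv_inner_const (hr.regularII hinj _ _)]
    have hh := hr.inner_const v
    have hh' : ∀ i, SmoothNear (fun q => fderiv ℝ (fun q => inner ℝ (r q) v) q (stdVec i)) 0 :=
      fun i => hh.fderiv.clm_apply (contDiff_const.smoothNear 0)
    have he' : (fun q => inner ℝ (regularII r q (stdVec 0) (stdVec 0)) v) =ᶠ[𝓝 0] fun q =>
        secondDeriv (fun q => inner ℝ (r q) v) q (stdVec 0) (stdVec 0) -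
          a q * fderiv ℝ (fun q => inner ℝ (r q) v) q (stdVec 0) -
          b q * fderiv ℝ (fun q => inner ℝ (r q) v) q (stdVec 1) := by
      filter_upwards [he, hr.eventually] with q h1 h2
      rw [h1, secondDeriv_inner h2, fderiv_inner_const h2, fderiv_inner_const h2]
      simp only [inner_sub_left, real_inner_smul_left]
    have hd := ((hh.secondDeriv (stdVec 0) (stdVec 0)).differentiableAt.hasFDerivAt.fun_sub
      (ha.differentiableAt.hasFDerivAt.fun_mul (hh' 0).differentiableAt.hasFDerivAt)).fun_sub
      (hb.differentiableAt.hasFDerivAt.fun_mul (hh' 1).differentiableAt.hasFDerivAt)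
    rw [he'.fderiv_eq, hd.fderiv, thirdDeriv_eq_fderiv hh]
    simp only [sub_apply, add_apply, smul_apply, ← secondDeriv_eq_fderiv hh, secondDeriv_inner hr,
      fderiv_inner_const hr, hk, hvT]
    simp
  rw [fderiv_resultant hr hinj hA, ← hdA, ← hBdef, ← hCdef, areaProduct]
  set D := fderiv ℝ (fun q => regularII r q (stdVec 0) (stdVec 0)) 0 (stdVec 0)
  rw [← hC]
  simp only [inner_add_right, real_inner_smul_right, hBv]
  ring

end Parabolic

/-! ### The two-jet of the normal form -/

theorem deriv_of_isBigO_pow_three {φ : ℝ → ℝ} (hφ : SmoothNear φ 0) {a b : ℝ}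
    (hO : (fun t => φ t - (a * t + b * t ^ 2)) =O[𝓝 0] fun t => t ^ 3) :
    deriv φ 0 = a ∧ deriv (deriv φ) 0 = 2 * b := by
  obtain ⟨g, hg, hge⟩ := hφ.exists_contDiff
  obtain ⟨w₁, hw₁, e₁, d₁⟩ := exists_mul_of_smooth hg
  obtain ⟨w₂, hw₂, e₂, d₂⟩ := exists_mul_of_smooth hw₁
  obtain ⟨w₃, hw₃, e₃, -⟩ := exists_mul_of_smooth hw₂
  have h1 : (fun t : ℝ => ∑ i : Fin 3, ![g 0, w₁ 0 - a, w₂ 0 - b] i * t ^ (i : ℕ)) =O[𝓝 0]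
      fun t => t ^ 3 := by
    have h2 : (fun t : ℝ => t ^ 3 * w₃ t) =O[𝓝 0] fun t => t ^ 3 := by
      simpa using (Asymptotics.isBigO_refl (fun t : ℝ => t ^ 3) (𝓝 0)).mul
        ((hw₃.continuous.tendsto 0).isBigO_one ℝ)
    refine (hO.sub h2).congr' ?_ (EventuallyEq.refl _ _)
    filter_upwards [hge] with t ht
    rw [← ht, e₁, e₂, e₃]
    simp [Fin.sum_univ_three]
    ring
  have h2 := eq_zero_of_sum_isBigO 3 _ (h1.mono nhdsWithin_le_nhds)
  have h3 : w₁ 0 - a = 0 := h2 1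
  have h4 : w₂ 0 - b = 0 := h2 2
  have h5 := d₁ 0
  have h6 := d₁ 1
  have h7 := d₂ 0
  simp only [zero_add, iteratedDeriv_one, iteratedDeriv_zero, Nat.cast_zero, one_mul] at h5 h7
  rw [iteratedDeriv_succ, iteratedDeriv_one, iteratedDeriv_one, h7] at h6
  rw [hge.symm.deriv_eq, hge.symm.deriv.deriv_eq, h5, h6]
  constructor
  · linarith
  · push_cast; linarith

/-- The derivatives of orders one and two of a smooth germ are those of a quadratic polynomial that it
agrees with to second order; the proof restricts the germ to lines. -/
theorem two_jet_of_isBigO {g : E2 → ℝ} (hg : SmoothNear g 0) {α β A B C : ℝ}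
    (hO : (fun q : E2 => g q - (α * q 0 + β * q 1 +
      (A * q 0 ^ 2 + B * (q 0 * q 1) + C * q 1 ^ 2))) =O[𝓝 0] fun q => ‖q‖ ^ 3) :
    (∀ w, fderiv ℝ g 0 w = α * w 0 + β * w 1) ∧ ∀ u w, secondDeriv g 0 u w =
      2 * A * (u 0 * w 0) + B * (u 0 * w 1 + u 1 * w 0) + 2 * C * (u 1 * w 1) := by
  have hline : ∀ w : E2, fderiv ℝ g 0 w = α * w 0 + β * w 1 ∧ secondDeriv g 0 w w =
      2 * (A * w 0 ^ 2 + B * (w 0 * w 1) + C * w 1 ^ 2) := by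
    intro w
    have hc : ContDiff ℝ ∞ (fun t : ℝ => t • w) := contDiff_id.smul contDiff_const
    have hcd : ∀ t, HasDerivAt (fun t : ℝ => t • w) w t := fun t => by
      simpa using (hasDerivAt_id t).smul_const w
    have hcd' : deriv (fun t : ℝ => t • w) = fun _ => w := funext fun t => (hcd t).deriv
    have hc0 : (0 : ℝ) • w = 0 := zero_smul _ _
    have hg' : SmoothNear g ((0 : ℝ) • w) := by rwa [hc0]
    have hs : SmoothNear (fun t : ℝ => g (t • w)) 0 :=
      SmoothNear.comp (g := fun t : ℝ => t • w) hg' (hc.smoothNear 0)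
    have ht : Tendsto (fun t : ℝ => t • w) (𝓝 0) (𝓝 0) := hc.continuous.tendsto' 0 0 hc0
    have h1 : (fun t : ℝ => g (t • w) - ((α * w 0 + β * w 1) * t +
        (A * w 0 ^ 2 + B * (w 0 * w 1) + C * w 1 ^ 2) * t ^ 2)) =O[𝓝 0] fun t => t ^ 3 := by
      refine ((hO.comp_tendsto ht).congr_left fun t => ?_).trans ?_
      · simp only [Function.comp_apply, PiLp.smul_apply, smul_eq_mul]
        ring
      · refine Asymptotics.IsBigO.of_bound (‖w‖ ^ 3) (Eventually.of_forall fun t => ?_)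
        simp [norm_smul, mul_pow, mul_comm]
    obtain ⟨h2, h3⟩ := deriv_of_isBigO_pow_three hs h1
    rw [deriv_comp_curve (c := fun t : ℝ => t • w) hg' (hc.smoothNear 0), hcd', hc0] at h2
    rw [deriv_deriv_comp_curve (c := fun t : ℝ => t • w) hg' (hc.smoothNear 0), hcd', hc0] at h3
    simp only [deriv_const', map_zero, add_zero] at h3
    exact ⟨h2, h3⟩
  refine ⟨fun w => (hline w).1, fun u w => ?_⟩
  have hs := secondDeriv_symm hg (stdVec 1) (stdVec 0)
  have e0 := (hline (stdVec 0)).2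
  have e1 := (hline (stdVec 1)).2
  have e2 := (hline (stdVec 0 + stdVec 1)).2
  rw [secondDeriv_left, secondDeriv_right _ _ (stdVec 0), secondDeriv_right _ _ (stdVec 1), hs]
  rw [secondDeriv_left, secondDeriv_right _ _ (stdVec 0), secondDeriv_right _ _ (stdVec 1), hs] at e2
  simp [stdVec] at e0 e1 e2 ⊢
  linear_combination u 0 * w 0 * e0 + u 1 * w 1 * e1 +
    (u 0 * w 1 + u 1 * w 0) * (1 / 2) * (e2 - e0 - e1)

/-- The quadratic part of the normal form. -/
def quadraticJet (b₂₀ b₁₁ b₀₂ c₂₀ : ℝ) (q : E2) : E4 :=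
  !₂[q 0, q 0 * q 1, b₂₀ * q 0 ^ 2 + b₁₁ * (q 0 * q 1) + b₀₂ * q 1 ^ 2, c₂₀ * q 0 ^ 2]

/-- The germ `f` agrees with the quadratic part of the normal form to second order. All the
geometric conditions depend on `f` through this two-jet and through the height functions. -/
structure HasTwoJet (f : E2 → E4) (b₂₀ b₁₁ b₀₂ c₂₀ : ℝ) : Prop where
  smooth : SmoothNear f 0
  isBigO : (fun q => f q - quadraticJet b₂₀ b₁₁ b₀₂ c₂₀ q) =O[𝓝 0] fun q => ‖q‖ ^ 3
  ne_zero : b₀₂ ≠ 0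

theorem isBigO_coord (i : Fin 2) : (fun q : E2 => q i) =O[𝓝 0] fun q => ‖q‖ :=
  Asymptotics.IsBigO.of_bound 1 (Eventually.of_forall fun q => by
    simpa using PiLp.norm_apply_le q i)

theorem isBigO_cubic (i j k : Fin 2) :
    (fun q : E2 => q i * q j * q k) =O[𝓝 0] fun q => ‖q‖ ^ 3 :=
  (((isBigO_coord i).mul (isBigO_coord j)).mul (isBigO_coord k)).congr_right fun q => by ring

theorem IsNormalFormI1.exists_hasTwoJet {f : E2 → E4} (hf : IsNormalFormI1 f) :
    ∃ b₂₀ b₁₁ b₀₂ c₂₀, HasTwoJet f b₂₀ b₁₁ b₀₂ c₂₀ := by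
  obtain ⟨hs, b, c, hb, -, hO⟩ := hf
  refine ⟨b 2 0, b 1 1, b 0 2, c 2 0, hs, ?_, hb⟩
  have h1 : (fun q : E2 => ‖q‖ ^ 4) =O[𝓝 0] fun q => ‖q‖ ^ 3 :=
    (isBigO_pow_of_le (by norm_num)).comp_tendsto (tendsto_norm_zero (E := E2))
  have hcub : ∀ a : ℕ → ℕ → ℝ, (fun q : E2 => a 3 0 * (q 0 * q 0 * q 0) + a 2 1 * (q 0 * q 0 * q 1)
      + a 1 2 * (q 0 * q 1 * q 1) + a 0 3 * (q 1 * q 1 * q 1)) =O[𝓝 0] fun q => ‖q‖ ^ 3 :=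
    fun a => ((((isBigO_cubic 0 0 0).const_mul_left _).add
      ((isBigO_cubic 0 0 1).const_mul_left _)).add ((isBigO_cubic 0 1 1).const_mul_left _)).add
      ((isBigO_cubic 1 1 1).const_mul_left _)
  have h2 : ∀ (e : E4) (k : E2 → ℝ), k =O[𝓝 0] (fun q => ‖q‖ ^ 3) →
      (fun q => k q • e) =O[𝓝 0] fun q => ‖q‖ ^ 3 := fun e k hk => by
    simpa using hk.smul (Asymptotics.isBigO_const_const e (one_ne_zero (α := ℝ)) (𝓝 0))
  refine ((hO.trans h1).add ((h2 (EuclideanSpace.single 2 1) _ (hcub b)).add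
    (h2 (EuclideanSpace.single 3 1) _ (hcub c)))).congr_left fun q => ?_
  ext i
  fin_cases i <;> simp [normalFormJet, quadraticJet] <;> ring

namespace HasTwoJet

variable {f : E2 → E4} {b₂₀ b₁₁ b₀₂ c₂₀ : ℝ} (J : HasTwoJet f b₂₀ b₁₁ b₀₂ c₂₀)
include J

theorem map_zero : f 0 = 0 := by
  have := (J.isBigO.congr_right fun q => by rw [sub_zero]).eq_zero_of_norm_pow
    (three_ne_zero)
  have h0 : quadraticJet b₂₀ b₁₁ b₀₂ c₂₀ 0 = 0 := by
    ext i; fin_cases i <;> simp [quadraticJet]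
  simpa [h0] using this

theorem isBigO_apply (i : Fin 4) :
    (fun q => f q i - quadraticJet b₂₀ b₁₁ b₀₂ c₂₀ q i) =O[𝓝 0] fun q => ‖q‖ ^ 3 :=
  Asymptotics.IsBigO.trans (Asymptotics.IsBigO.of_bound 1 (Eventually.of_forall fun q => by
    simpa using PiLp.norm_apply_le (f q - quadraticJet b₂₀ b₁₁ b₀₂ c₂₀ q) i)) J.isBigO

theorem jet_apply {i : Fin 4} {α β A B C : ℝ} (h : ∀ q : E2, quadraticJet b₂₀ b₁₁ b₀₂ c₂₀ q i =
      α * q 0 + β * q 1 + (A * q 0 ^ 2 + B * (q 0 * q 1) + C * q 1 ^ 2)) :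
    (∀ w, fderiv ℝ f 0 w i = α * w 0 + β * w 1) ∧ ∀ u w, secondDeriv f 0 u w i =
      2 * A * (u 0 * w 0) + B * (u 0 * w 1 + u 1 * w 0) + 2 * C * (u 1 * w 1) := by
  have h1 := two_jet_of_isBigO (J.smooth.clm_comp (EuclideanSpace.proj i : E4 →L[ℝ] ℝ))
    ((J.isBigO_apply i).congr_left fun q => by rw [h q]; rfl)
  refine ⟨fun w => ?_, fun u w => ?_⟩
  · rw [← h1.1 w, fderiv_linear_image _ J.smooth]; rfl
  · rw [← h1.2 u w, secondDeriv_linear_image _ J.smooth]; rfl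

theorem fderiv_eq (w : E2) : fderiv ℝ f 0 w = !₂[w 0, 0, 0, 0] := by
  have h0 := (J.jet_apply (i := 0) (α := 1) (β := 0) (A := 0) (B := 0) (C := 0)
    (by simp [quadraticJet])).1 w
  have h1 := (J.jet_apply (i := 1) (α := 0) (β := 0) (A := 0) (B := 1) (C := 0)
    (by simp [quadraticJet])).1 w
  have h2 := (J.jet_apply (i := 2) (α := 0) (β := 0) (A := b₂₀) (B := b₁₁) (C := b₀₂)
    (by simp [quadraticJet])).1 w
  have h3 := (J.jet_apply (i := 3) (α := 0) (β := 0) (A := c₂₀) (B := 0) (C := 0)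
    (by simp [quadraticJet])).1 w
  ext i; fin_cases i
  · simpa using h0
  · simpa using h1
  · simpa using h2
  · simpa using h3

theorem secondDeriv_eq (u w : E2) : secondDeriv f 0 u w = !₂[0, u 0 * w 1 + u 1 * w 0,
    2 * b₂₀ * (u 0 * w 0) + b₁₁ * (u 0 * w 1 + u 1 * w 0) + 2 * b₀₂ * (u 1 * w 1),
    2 * c₂₀ * (u 0 * w 0)] := by
  have h0 := (J.jet_apply (i := 0) (α := 1) (β := 0) (A := 0) (B := 0) (C := 0)
    (by simp [quadraticJet])).2 u w
  have h1 := (J.jet_apply (i := 1) (α := 0) (β := 0) (A := 0) (B := 1) (C := 0)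
    (by simp [quadraticJet])).2 u w
  have h2 := (J.jet_apply (i := 2) (α := 0) (β := 0) (A := b₂₀) (B := b₁₁) (C := b₀₂)
    (by simp [quadraticJet])).2 u w
  have h3 := (J.jet_apply (i := 3) (α := 0) (β := 0) (A := c₂₀) (B := 0) (C := 0)
    (by simp [quadraticJet])).2 u w
  ext i; fin_cases i
  · simpa using h0
  · simpa using h1
  · simpa using h2
  · simpa using h3

end HasTwoJet

/-! ### Geometry of the singular point -/

theorem inner_E4 (x y : E4) :
    inner ℝ x y = x 0 * y 0 + x 1 * y 1 + x 2 * y 2 + x 3 * y 3 := by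
  simp [PiLp.inner_apply, Fin.sum_univ_four, mul_comm]

namespace HasTwoJet

variable {f : E2 → E4} {b₂₀ b₁₁ b₀₂ c₂₀ : ℝ} (J : HasTwoJet f b₂₀ b₁₁ b₀₂ c₂₀) {v : E4}
include J

theorem mem_tangentLine {x : E4} : x ∈ tangentLine f ↔ x 1 = 0 ∧ x 2 = 0 ∧ x 3 = 0 := by
  constructor
  · rintro ⟨w, rfl⟩
    have := J.fderiv_eq w
    simp [this]
  · rintro ⟨h1, h2, h3⟩
    refine ⟨!₂[x 0, 0], ?_⟩
    have := J.fderiv_eq !₂[x 0, 0]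
    refine this.trans ?_
    ext i; fin_cases i
    · rfl
    · exact h1.symm
    · exact h2.symm
    · exact h3.symm

theorem secondFundamentalForm_eq (u w : E2) : secondFundamentalForm f u w = secondDeriv f 0 u w := by
  refine Submodule.starProjection_eq_self_iff.2 ((Submodule.mem_orthogonal _ _).2 fun x hx => ?_)
  obtain ⟨h1, h2, h3⟩ := J.mem_tangentLine.1 hx
  rw [inner_E4, h1, h2, h3, J.secondDeriv_eq]
  simp

theorem mem_planeE {x : E4} : x ∈ planeE f ↔ x 0 = 0 ∧ x 3 = 0 := by
  have hmem : ∀ s : ℝ, (!₂[0, 2 * s, 2 * b₂₀ + 2 * b₁₁ * s + 2 * b₀₂ * s ^ 2, 2 * c₂₀] : E4) ∈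
      curvatureParabola f := by
    intro s
    refine ⟨!₂[1, s], ?_, ?_⟩
    · rw [J.fderiv_eq]
      simp [EuclideanSpace.norm_eq, Fin.sum_univ_four]
    · rw [J.secondFundamentalForm_eq, J.secondDeriv_eq]
      ext i; fin_cases i <;> simp <;> ring
  have hsub : ∀ s t : ℝ, (!₂[0, 2 * s, 2 * b₂₀ + 2 * b₁₁ * s + 2 * b₀₂ * s ^ 2, 2 * c₂₀] : E4) -
      !₂[0, 2 * t, 2 * b₂₀ + 2 * b₁₁ * t + 2 * b₀₂ * t ^ 2, 2 * c₂₀] ∈ planeE f := fun s t => by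
    rw [planeE, direction_affineSpan]
    exact vsub_mem_vectorSpan ℝ (hmem s) (hmem t)
  constructor
  · let Z : Submodule ℝ E4 := LinearMap.ker (EuclideanSpace.proj 0 : E4 →L[ℝ] ℝ).toLinearMap ⊓
      LinearMap.ker (EuclideanSpace.proj 3 : E4 →L[ℝ] ℝ).toLinearMap
    have hZ : ∀ y : E4, y ∈ Z ↔ y 0 = 0 ∧ y 3 = 0 := fun y => Iff.rfl
    intro hx
    rw [← hZ]
    rw [planeE, direction_affineSpan, vectorSpan_def] at hx
    refine Submodule.span_le.2 ?_ hx
    rintro _ ⟨_, ⟨p, hp, rfl⟩, _, ⟨q, hq, rfl⟩, rfl⟩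
    refine (hZ _).2 ?_
    rw [J.fderiv_eq] at hp hq
    have hsq : ∀ p : E2, ‖(!₂[p 0, 0, 0, 0] : E4)‖ = 1 → p 0 * p 0 = 1 := fun p hp => by
      simp only [EuclideanSpace.norm_eq, Fin.sum_univ_four, Real.sqrt_eq_one] at hp
      simpa [sq] using hp
    simp only [J.secondFundamentalForm_eq, J.secondDeriv_eq, vsub_eq_sub, PiLp.sub_apply]
    simp [hsq p hp, hsq q hq]
  · rintro ⟨h0, h3⟩
    -- the chords of the parabola at the parameters `1, -1` and `1, 0, -1` span the plane
    have h := (planeE f).add_mem ((planeE f).smul_mem (x 1 / 4) (hsub 1 (-1)))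
      ((planeE f).smul_mem ((x 2 - b₁₁ * x 1) / (4 * b₀₂))
        ((planeE f).add_mem (hsub 1 0) (hsub (-1) 0)))
    have hb := J.ne_zero
    convert h using 1
    ext i; fin_cases i
    · simp [h0]
    · simp; ring
    · simp; field_simp; ring
    · simp [h3]

theorem isAsymptoticFor_iff {u : E2} {ν : E4} : IsAsymptoticFor f u ν ↔
    u ≠ 0 ∧ ν ≠ 0 ∧ (ν 0 = 0 ∧ ν 3 = 0) ∧ ∀ w, inner ℝ (secondDeriv f 0 u w) ν = 0 := by
  simp only [IsAsymptoticFor, J.mem_planeE, J.secondFundamentalForm_eq]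

/-- The equations of a pair of an asymptotic direction and a binormal. -/
theorem IsAsymptoticFor.eqs {u : E2} {ν : E4} (h : IsAsymptoticFor f u ν) :
    ν 1 * u 1 + ν 2 * (2 * b₂₀ * u 0 + b₁₁ * u 1) = 0 ∧
      ν 1 * u 0 + ν 2 * (b₁₁ * u 0 + 2 * b₀₂ * u 1) = 0 := by
  obtain ⟨-, -, ⟨h0, h3⟩, hk⟩ := J.isAsymptoticFor_iff.1 h
  have e0 := hk (stdVec 0)
  have e1 := hk (stdVec 1)
  rw [inner_E4, h0, h3, J.secondDeriv_eq] at e0 e1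
  simp [stdVec] at e0 e1
  exact ⟨by linarith, by linarith⟩

theorem isAsymptoticFor_of_eqs {u : E2} {ν : E4} (hu : u ≠ 0) (hν : ν ≠ 0) (h0 : ν 0 = 0)
    (h3 : ν 3 = 0) (e0 : ν 1 * u 1 + ν 2 * (2 * b₂₀ * u 0 + b₁₁ * u 1) = 0)
    (e1 : ν 1 * u 0 + ν 2 * (b₁₁ * u 0 + 2 * b₀₂ * u 1) = 0) : IsAsymptoticFor f u ν := by
  refine J.isAsymptoticFor_iff.2 ⟨hu, hν, ⟨h0, h3⟩, fun w => ?_⟩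
  rw [inner_E4, h0, h3, J.secondDeriv_eq]
  simp
  linear_combination w 0 * e0 + w 1 * e1

/-- If `b₂₀ = 0`, then the only asymptotic direction is that of the first coordinate axis. -/
theorem IsAsymptoticFor.eq_zero_of_eq_zero (hb : b₂₀ = 0) {u : E2} {ν : E4}
    (h : IsAsymptoticFor f u ν) : u 1 = 0 := by
  obtain ⟨e0, e1⟩ := IsAsymptoticFor.eqs J h
  obtain ⟨-, hν, ⟨h0, h3⟩, -⟩ := J.isAsymptoticFor_iff.1 h
  by_contra hu1
  rw [hb] at e0
  have e2 : ν 1 + ν 2 * b₁₁ = 0 := by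
    have : u 1 * (ν 1 + ν 2 * b₁₁) = 0 := by linear_combination e0
    exact (mul_eq_zero.1 this).resolve_left hu1
  have e3 : ν 2 = 0 := by
    have : (2 * b₀₂ * u 1) * ν 2 = 0 := by linear_combination e1 - u 0 * e2
    exact (mul_eq_zero.1 this).resolve_left (mul_ne_zero (mul_ne_zero two_ne_zero J.ne_zero) hu1)
  rw [e3, zero_mul, add_zero] at e2
  apply hν
  ext i; fin_cases i
  · exact h0
  · exact e2
  · exact e3
  · exact h3

/-- If `b₂₀ ≠ 0`, then the asymptotic directions are not those of the coordinate axes. -/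
theorem IsAsymptoticFor.ne_zero_of_ne_zero (hb : b₂₀ ≠ 0) {u : E2} {ν : E4}
    (h : IsAsymptoticFor f u ν) : u 0 ≠ 0 ∧ u 1 ≠ 0 := by
  obtain ⟨e0, e1⟩ := IsAsymptoticFor.eqs J h
  obtain ⟨hu, hν, ⟨h0, h3⟩, -⟩ := J.isAsymptoticFor_iff.1 h
  have hν2 : ν 2 ≠ 0 := by
    intro h2
    rw [h2, zero_mul, add_zero] at e0 e1
    apply hν
    have hν1 : ν 1 = 0 := by
      by_contra hν1
      apply hu
      rw [E2.eq_of_coord (q := u), (mul_eq_zero.1 e0).resolve_left hν1,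
        (mul_eq_zero.1 e1).resolve_left hν1]; simp
    ext i; fin_cases i
    · exact h0
    · exact hν1
    · exact h2
    · exact h3
  have key0 : u 1 = 0 → u 0 = 0 := fun h => by
    rw [h] at e0
    have : (2 * b₂₀ * ν 2) * u 0 = 0 := by linear_combination e0
    exact (mul_eq_zero.1 this).resolve_left (mul_ne_zero (mul_ne_zero two_ne_zero hb) hν2)
  have key1 : u 0 = 0 → u 1 = 0 := fun h => by
    rw [h] at e1
    have : (2 * b₀₂ * ν 2) * u 1 = 0 := by linear_combination e1
    exact (mul_eq_zero.1 this).resolve_left (mul_ne_zero (mul_ne_zero two_ne_zero J.ne_zero) hν2)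
  have hnot : ¬(u 0 = 0 ∧ u 1 = 0) := fun h => hu (by
    rw [E2.eq_of_coord (q := u), h.1, h.2]; simp)
  exact ⟨fun h => hnot ⟨h, key1 h⟩, fun h => hnot ⟨key0 h, h⟩⟩

theorem ne_zero_of_isHyperbolicPoint (h : IsHyperbolicPoint f) : b₂₀ ≠ 0 := by
  intro hb
  have hsub : asymptoticDirections f ⊆ {Submodule.span ℝ {stdVec 0}} := by
    rintro L ⟨u, ν, hu, rfl⟩
    have h1 := IsAsymptoticFor.eq_zero_of_eq_zero J hb hu
    have h2 : u = u 0 • stdVec 0 := by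
      conv_lhs => rw [E2.eq_of_coord (q := u), h1, zero_smul, add_zero]
    have h3 : u 0 ≠ 0 := fun h => hu.1 (by rw [h2, h, zero_smul])
    rw [Set.mem_singleton_iff, h2]
    exact Submodule.span_singleton_smul_eq (IsUnit.mk0 _ h3) _
  have h1 := Set.encard_le_encard hsub
  rw [Set.encard_singleton, h] at h1
  exact absurd h1 (by norm_num)

theorem eq_zero_of_isParabolicPoint (h : IsParabolicPoint f) : b₂₀ = 0 := by
  by_contra hb
  obtain ⟨L, hL⟩ := Set.encard_eq_one.1 h
  obtain ⟨u, ν, hu, hLu⟩ : L ∈ asymptoticDirections f := by rw [hL]; rfl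
  obtain ⟨hu0, hu1⟩ := IsAsymptoticFor.ne_zero_of_ne_zero J hb hu
  obtain ⟨e0, e1⟩ := IsAsymptoticFor.eqs J hu
  obtain ⟨-, hν, ⟨h0, h3⟩, -⟩ := J.isAsymptoticFor_iff.1 hu
  -- the reflected direction is asymptotic too, with the conjugate binormal
  have hu' : IsAsymptoticFor f !₂[u 0, -u 1] !₂[0, -ν 1 - 2 * b₁₁ * ν 2, ν 2, 0] := by
    refine J.isAsymptoticFor_of_eqs (fun h => hu0 ?_) (fun h => hν ?_) rfl rfl ?_ ?_
    · simpa using congrArg (fun q : E2 => q 0) h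
    · have h2 : ν 2 = 0 := by simpa using congrArg (fun q : E4 => q 2) h
      have h1 : -ν 1 - 2 * b₁₁ * ν 2 = 0 := by simpa using congrArg (fun q : E4 => q 1) h
      ext i; fin_cases i
      · exact h0
      · simp; rw [h2] at h1; linarith
      · exact h2
      · exact h3
    · simp; linear_combination e0
    · simp; linear_combination -e1
  have hmem : Submodule.span ℝ {(!₂[u 0, -u 1] : E2)} ∈ asymptoticDirections f := ⟨_, _, hu', rfl⟩
  rw [hL, Set.mem_singleton_iff, hLu] at hmem
  have := Submodule.mem_span_singleton_self (R := ℝ) (!₂[u 0, -u 1] : E2)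
  rw [hmem, Submodule.mem_span_singleton] at this
  obtain ⟨a, ha⟩ := this
  have a0 : a * u 0 = u 0 := by simpa using congrArg (fun q : E2 => q 0) ha
  have a1 : a * u 1 = -u 1 := by simpa using congrArg (fun q : E2 => q 1) ha
  have ha1 : a = 1 := by
    have : (a - 1) * u 0 = 0 := by linear_combination a0
    linarith [(mul_eq_zero.1 this).resolve_right hu0]
  rw [ha1] at a1
  exact hu1 (by linarith)

/-- The limit of the secants along the second coordinate axis, on which `f` is `(0, 0, b₀₂ y², 0)` up
to terms of order three. -/
theorem single_mem_tangentConeM : EuclideanSpace.single 2 b₀₂ ∈ tangentConeM f := by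
  have hq : Tendsto (fun n : ℕ => (!₂[0, 1 / ((n : ℝ) + 1)] : E2)) atTop (𝓝 0) := by
    have h1 : Continuous (fun t : ℝ => (!₂[0, t] : E2)) :=
      (contDiff_mk contDiff_const contDiff_id).continuous
    refine (h1.tendsto' 0 0 ?_).comp tendsto_one_div_add_atTop_nhds_zero_nat
    ext i; fin_cases i <;> simp
  refine ⟨fun n => ((n : ℝ) + 1) ^ 2, fun n => !₂[0, 1 / ((n : ℝ) + 1)], hq, ?_⟩
  have h1 := (J.isBigO.comp_tendsto hq)
  have h2 : (fun n : ℕ => ((n : ℝ) + 1) ^ 2 • (f !₂[0, 1 / ((n : ℝ) + 1)] -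
      quadraticJet b₂₀ b₁₁ b₀₂ c₂₀ !₂[0, 1 / ((n : ℝ) + 1)])) =O[atTop]
        fun n : ℕ => 1 / ((n : ℝ) + 1) := by
    refine ((Asymptotics.isBigO_refl (fun n : ℕ => ((n : ℝ) + 1) ^ 2) atTop).smul h1).congr_right
      fun n => ?_
    have hn : (0 : ℝ) < (n : ℝ) + 1 := by positivity
    simp only [Function.comp_apply, EuclideanSpace.norm_eq, Fin.sum_univ_two, Matrix.cons_val_zero,
      Matrix.cons_val_one, norm_zero, smul_eq_mul]
    rw [zero_pow two_ne_zero, zero_add, Real.sqrt_sq (norm_nonneg _), Real.norm_of_nonneg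
      (by positivity)]
    field_simp
  have h3 := h2.trans_tendsto tendsto_one_div_add_atTop_nhds_zero_nat
  have h4 := h3.add_const (EuclideanSpace.single 2 b₀₂ : E4)
  rw [zero_add] at h4
  refine h4.congr fun n => ?_
  have hn : ((n : ℝ) + 1) ≠ 0 := by positivity
  rw [J.map_zero, sub_zero, smul_sub]
  have : ((n : ℝ) + 1) ^ 2 • quadraticJet b₂₀ b₁₁ b₀₂ c₂₀ !₂[0, 1 / ((n : ℝ) + 1)] =
      EuclideanSpace.single 2 b₀₂ := by
    ext i; fin_cases i <;> simp [quadraticJet]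
    field_simp
  rw [this, sub_add_cancel]

theorem tangentLine_le_hyperplane (h0 : v 0 = 0) : tangentLine f ≤ hyperplane v := by
  intro x hx
  obtain ⟨h1, h2, h3⟩ := J.mem_tangentLine.1 hx
  rw [hyperplane, Submodule.mem_orthogonal_singleton_iff_inner_right, inner_E4, h1, h2, h3, h0]
  ring

end HasTwoJet

theorem sup_hyperplane_eq_top {X : Submodule ℝ E4} {v x : E4} (hx : x ∈ X)
    (hv : inner ℝ v x ≠ 0) : X ⊔ hyperplane v = ⊤ := by
  rw [eq_top_iff]
  intro y _
  have h1 : y - (inner ℝ v y / inner ℝ v x) • x ∈ hyperplane v := by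
    rw [hyperplane, Submodule.mem_orthogonal_singleton_iff_inner_right, inner_sub_right,
      real_inner_smul_right, div_mul_cancel₀ _ hv, sub_self]
  have h2 := Submodule.add_mem_sup (X.smul_mem (inner ℝ v y / inner ℝ v x) hx) h1
  simpa using h2

section

/-! ### The associated regular surface -/

theorem inner_height (f : E2 → E4) (v : E4) : height f v = fun q => inner ℝ (f q) v := rfl

theorem E5.inner_eq (x y : E5) : inner ℝ x y = inner ℝ x.fst y.fst + x.snd * y.snd := by
  rw [WithLp.prod_inner_apply]
  simp [mul_comm]

theorem inclusion45_apply (x : E4) : inclusion45 x = WithLp.toLp 2 (x, (0 : ℝ)) := rfl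

variable {f : E2 → E4} {ψ : E2 → ℝ}

theorem smoothNear_liftN (hf : SmoothNear f 0) (hψ : SmoothNear ψ 0) :
    SmoothNear (liftN f ψ) 0 :=
  (hf.prodMk hψ).clm_comp (WithLp.prodContinuousLinearEquiv 2 ℝ E4 ℝ).symm.toContinuousLinearMap

theorem fderiv_liftN (hf : SmoothNear f 0) (hψ : SmoothNear ψ 0) (w : E2) :
    fderiv ℝ (liftN f ψ) 0 w = WithLp.toLp 2 (fderiv ℝ f 0 w, fderiv ℝ ψ 0 w) := by
  have h1 := fderiv_linear_image
    (WithLp.prodContinuousLinearEquiv 2 ℝ E4 ℝ).symm.toContinuousLinearMap (hf.prodMk hψ) w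
  refine h1.trans ?_
  rw [(hf.differentiableAt.hasFDerivAt.prodMk hψ.differentiableAt.hasFDerivAt).fderiv]
  rfl

theorem fderiv_liftN_mem (w : E2) : fderiv ℝ (liftN f ψ) 0 w ∈ assocSpace f ψ :=
  Submodule.mem_sup_left ⟨w, rfl⟩

theorem inclusion45_mem {n : E4} (hn : n ∈ planeE f) : inclusion45 n ∈ assocSpace f ψ :=
  Submodule.mem_sup_right ⟨n, hn, rfl⟩

theorem smoothNear_assocSurface (hf : SmoothNear f 0) (hψ : SmoothNear ψ 0) :
    SmoothNear (assocSurface f ψ) 0 :=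
  (smoothNear_liftN hf hψ).clm_comp (assocSpace f ψ).orthogonalProjectionOnto

theorem coe_fderiv_assocSurface (hf : SmoothNear f 0) (hψ : SmoothNear ψ 0) (w : E2) :
    (fderiv ℝ (assocSurface f ψ) 0 w : E5) = fderiv ℝ (liftN f ψ) 0 w := by
  have h1 := fderiv_linear_image (assocSpace f ψ).orthogonalProjectionOnto
    (smoothNear_liftN hf hψ) w
  have h2 : fderiv ℝ (assocSurface f ψ) 0 w = _ := h1
  rw [h2]
  exact congrArg Subtype.val ((assocSpace f ψ).orthogonalProjectionOnto_mem_subspace_eq_self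
    ⟨_, fderiv_liftN_mem w⟩)

theorem injective_fderiv_assocSurface (hf : SmoothNear f 0) (hL : IsLift f ψ) :
    Function.Injective (fderiv ℝ (assocSurface f ψ) 0) := fun a b hab => hL.2 (by
  rw [← coe_fderiv_assocSurface hf hL.1, ← coe_fderiv_assocSurface hf hL.1, hab])

theorem coe_assocDirection {n : E4} (hn : n ∈ planeE f) :
    (assocDirection f ψ n : E5) = inclusion45 n :=
  congrArg Subtype.val ((assocSpace f ψ).orthogonalProjectionOnto_mem_subspace_eq_self
    ⟨_, inclusion45_mem hn⟩)

theorem norm_assocDirection {n : E4} (hn : n ∈ planeE f) : ‖assocDirection f ψ n‖ = ‖n‖ := by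
  have h1 : ‖assocDirection f ψ n‖ = ‖inclusion45 n‖ := by
    rw [← coe_assocDirection hn (ψ := ψ)]; rfl
  rw [h1, inclusion45_apply, WithLp.prod_norm_eq_of_L2]
  simp

/-- The height functions of the singular surface in the directions of the plane `E_p` are height
functions of the associated regular surface. -/
theorem inner_assocSurface {n : E4} (hn : n ∈ planeE f) :
    (fun q => inner ℝ (assocSurface f ψ q) (assocDirection f ψ n)) = height f n := by
  funext q
  have h1 : inner ℝ (assocSurface f ψ q) (assocDirection f ψ n) =
      inner ℝ (liftN f ψ q) (inclusion45 n) := by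
    rw [Submodule.coe_inner, coe_assocDirection hn]
    have := (assocSpace f ψ).inner_starProjection_left_eq_right (liftN f ψ q) (inclusion45 n)
    rw [Submodule.starProjection_eq_self_iff.2 (inclusion45_mem hn)] at this
    exact this
  rw [h1, E5.inner_eq, inclusion45_apply]
  simp [liftN, height]

namespace HasTwoJet

variable {b₂₀ b₁₁ b₀₂ c₂₀ : ℝ} (J : HasTwoJet f b₂₀ b₁₁ b₀₂ c₂₀)
include J

theorem finrank_planeE : Module.finrank ℝ (planeE f) = 2 := by
  let e : (Fin 2 → ℝ) →ₗ[ℝ] E4 :=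
    { toFun := fun y => !₂[0, y 0, y 1, 0]
      map_add' := fun y z => by ext i; fin_cases i <;> simp
      map_smul' := fun a y => by ext i; fin_cases i <;> simp }
  have he : ∀ y, e y = !₂[0, y 0, y 1, 0] := fun y => rfl
  have hinj : Function.Injective e := by
    intro y z hyz
    rw [he, he] at hyz
    have h1 : y 0 = z 0 := congrArg (fun q : E4 => q 1) hyz
    have h2 : y 1 = z 1 := congrArg (fun q : E4 => q 2) hyz
    funext i; fin_cases i
    · exact h1
    · exact h2
  have hrange : planeE f = LinearMap.range e := by
    ext x
    rw [J.mem_planeE]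
    constructor
    · rintro ⟨h0, h3⟩
      refine ⟨![x 1, x 2], ?_⟩
      rw [he]
      ext i; fin_cases i
      · exact h0.symm
      · rfl
      · rfl
      · exact h3.symm
    · rintro ⟨y, rfl⟩
      exact ⟨rfl, rfl⟩
  rw [hrange, LinearMap.finrank_range_of_inj hinj]
  simp

theorem finrank_assocSpace (hL : IsLift f ψ) : Module.finrank ℝ (assocSpace f ψ) = 4 := by
  have h1 : Module.finrank ℝ (LinearMap.range (fderiv ℝ (liftN f ψ) 0).toLinearMap) = 2 := by
    have := LinearMap.finrank_range_of_inj (f := (fderiv ℝ (liftN f ψ) 0).toLinearMap) hL.2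
    rw [this]; simp
  have h2 : Module.finrank ℝ ((planeE f).map inclusion45) = 2 := by
    have hinj : Function.Injective inclusion45 := fun x y hxy =>
      congrArg (fun z : E5 => z.fst) hxy
    rw [(Submodule.equivMapOfInjective _ hinj _).finrank_eq.symm, J.finrank_planeE]
  have h3 : LinearMap.range (fderiv ℝ (liftN f ψ) 0).toLinearMap ⊓
      (planeE f).map inclusion45 = ⊥ := by
    rw [eq_bot_iff]
    rintro _ ⟨⟨w, rfl⟩, n, hn, he⟩
    have he' : inclusion45 n = fderiv ℝ (liftN f ψ) 0 w := he
    rw [fderiv_liftN J.smooth hL.1, inclusion45_apply] at he'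
    have e1 : n = fderiv ℝ f 0 w := congrArg (fun z : E5 => z.fst) he'
    have e2 : n = 0 := by
      obtain ⟨h0, h3⟩ := J.mem_planeE.1 hn
      rw [J.fderiv_eq] at e1
      have := congrArg (fun q : E4 => q 0) e1
      rw [e1]
      have hw : w 0 = 0 := by simpa [h0] using this.symm
      rw [hw]; ext i; fin_cases i <;> rfl
    rw [Submodule.mem_bot, ← he, e2, LinearMap.map_zero]
  have h4 := Submodule.finrank_sup_add_finrank_inf_eq
    (LinearMap.range (fderiv ℝ (liftN f ψ) 0).toLinearMap) ((planeE f).map inclusion45)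
  rw [h3, finrank_bot, h1, h2] at h4
  exact h4

end HasTwoJet

/-- The properties of the associated surface `r` that matter: it is an immersed surface in a
four-space whose normal plane at the origin is a copy `dir` of the plane `E_p`, and its height
functions in the directions of this plane are those of `f`. -/
structure IsAssociated {F : Type*} [NormedAddCommGroup F] [InnerProductSpace ℝ F]
    (f : E2 → E4) (r : E2 → F) (dir : E4 → F) : Prop where
  smooth : SmoothNear r 0
  injective : Function.Injective (fderiv ℝ r 0)
  finrank : Module.finrank ℝ F = 4
  norm_dir : ∀ n ∈ planeE f, ‖dir n‖ = ‖n‖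
  inner_dir : ∀ n ∈ planeE f, (fun q => inner ℝ (r q) (dir n)) = height f n
  exists_add : ∀ y : F, ∃ z, ∃ n ∈ planeE f, fderiv ℝ r 0 z + dir n = y

theorem HasTwoJet.isAssociated {b₂₀ b₁₁ b₀₂ c₂₀ : ℝ} (J : HasTwoJet f b₂₀ b₁₁ b₀₂ c₂₀)
    (hL : IsLift f ψ) : IsAssociated f (assocSurface f ψ) (assocDirection f ψ) where
  smooth := smoothNear_assocSurface J.smooth hL.1
  injective := injective_fderiv_assocSurface J.smooth hL
  finrank := J.finrank_assocSpace hL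
  norm_dir := fun _ hn => norm_assocDirection hn
  inner_dir := fun _ hn => inner_assocSurface hn
  exists_add := by
    rintro ⟨y, hy⟩
    obtain ⟨_, ⟨z, rfl⟩, _, ⟨n, hn, rfl⟩, rfl⟩ := Submodule.mem_sup.1 hy
    refine ⟨z, n, hn, Subtype.ext ?_⟩
    refine (congrArg₂ (· + ·) (coe_fderiv_assocSurface J.smooth hL.1 z)
      (coe_assocDirection hn) : _)

namespace IsAssociated

variable {F : Type*} [NormedAddCommGroup F] [InnerProductSpace ℝ F]
  {r : E2 → F} {dir : E4 → F} {b₂₀ b₁₁ b₀₂ c₂₀ : ℝ} (A : IsAssociated f r dir)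
  (J : HasTwoJet f b₂₀ b₁₁ b₀₂ c₂₀) {n : E4} (hn : n ∈ planeE f)
include A J

section
include hn

theorem inner_fderiv (w : E2) : inner ℝ (fderiv ℝ r 0 w) (dir n) = 0 := by
  rw [← fderiv_inner_const A.smooth, A.inner_dir n hn, inner_height,
    fderiv_inner_const J.smooth, inner_E4, J.fderiv_eq, (J.mem_planeE.1 hn).1]
  simp

theorem inner_secondDeriv (u w : E2) :
    inner ℝ (secondDeriv r 0 u w) (dir n) = inner ℝ (secondDeriv f 0 u w) n := by
  rw [← secondDeriv_inner A.smooth, A.inner_dir n hn, inner_height, secondDeriv_inner J.smooth]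

theorem regularII_ne_zero [FiniteDimensional ℝ F] {u w : E2} (h : inner ℝ (secondDeriv f 0 u w) n ≠ 0) :
    regularII r 0 u w ≠ 0 := by
  intro h0
  apply h
  rw [← A.inner_secondDeriv J hn, ← inner_regularII (A.inner_fderiv J hn), h0, inner_zero_left]

end

theorem regularII_eq_zero [FiniteDimensional ℝ F] {u w : E2}
    (h : ∀ n ∈ planeE f, inner ℝ (secondDeriv f 0 u w) n = 0) :
    regularII r 0 u w = 0 := by
  obtain ⟨z, n, hn, he⟩ := A.exists_add (regularII r 0 u w)
  refine (inner_self_eq_zero (𝕜 := ℝ)).1 ?_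
  have h1 : inner ℝ (fderiv ℝ r 0 z + dir n) (regularII r 0 u w) =
      inner ℝ (regularII r 0 u w) (regularII r 0 u w) := by rw [he]
  rw [← h1, inner_add_left, inner_fderiv_regularII, real_inner_comm,
    inner_regularII (A.inner_fderiv J hn), A.inner_secondDeriv J hn, h n hn, add_zero]

end IsAssociated

end

/-! ### Height functions and the model surface -/

/-- The singularity types are modelled by the submersions: the sign `c` in `ModelledBy` and the
sign `s` of `Z` realise the two independent signs of `±x ^ k ± y ^ 2`. -/
theorem hasTypeA_iff_exists_modelledBy {h : E2 → ℝ} (h0 : h 0 = 0) {k : ℕ} (hk : 1 ≤ k) :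
    HasTypeA (k - 1) h ↔ ∃ s : ℝ, (s = 1 ∨ s = -1) ∧ ModelledBy h k s := by
  have hk' : k - 1 + 1 = k := by omega
  have hsgn : ((-1 : ℝ) ^ (k + 1) = 1 ∨ (-1 : ℝ) ^ (k + 1) = -1) := neg_one_pow_eq_or ℝ _
  generalize hσ : (-1 : ℝ) ^ (k + 1) = σ at hsgn
  have hσ2 : σ * σ = 1 := by rcases hsgn with rfl | rfl <;> norm_num
  have hmul : ∀ {a b : ℝ}, (a = 1 ∨ a = -1) → (b = 1 ∨ b = -1) → (a * b = 1 ∨ a * b = -1) := by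
    rintro a b (rfl | rfl) (rfl | rfl) <;> norm_num
  constructor
  · rintro ⟨ε, δ, hε, hδ, φ, hφ, he⟩
    have hε2 : ε * ε = 1 := by rcases hε with rfl | rfl <;> norm_num
    refine ⟨ε * σ * δ, hmul (hmul hε hsgn) hδ, ε * σ, hmul hε hsgn, φ, hφ, ?_⟩
    filter_upwards [he] with q hq
    have hm : modelSubmersion k (ε * σ * δ) (modelI1 q) =
        ε * σ * δ * q 1 ^ 2 + (-1) ^ (k + 1) * q 0 ^ k := rfl
    rw [hq, h0, hk', hm, hσ]
    linear_combination σ * q 0 ^ k * hε2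
  · rintro ⟨s, hs, c, hc, φ, hφ, he⟩
    have hc2 : c * c = 1 := by rcases hc with rfl | rfl <;> norm_num
    refine ⟨c * σ, c * s, hmul hc hsgn, hmul hc hs, φ, hφ, ?_⟩
    filter_upwards [he] with q hq
    have hm : modelSubmersion k s (modelI1 q) = s * q 1 ^ 2 + (-1) ^ (k + 1) * q 0 ^ k := rfl
    rw [hm, hσ] at hq
    rw [h0, hk']
    linear_combination c * hq - h (φ q) * hc2

/-- The six models occur for `f = (x, xy, s y² + (-1) ^ (k + 1) x ^ k, y³)`. -/
theorem exists_modelledBy {k : ℕ} (hk : k ∈ ({2, 3, 4} : Set ℕ)) {s : ℝ} (hs : s = 1 ∨ s = -1) :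
    ∃ (f : E2 → E4) (v : E4), IsNormalFormI1 f ∧
      ‖v‖ = 1 ∧ v 0 = 0 ∧ v 3 = 0 ∧ v 2 ≠ 0 ∧ ModelledBy (height f v) k s := by
  have hs0 : s ≠ 0 := by rcases hs with rfl | rfl <;> norm_num
  refine ⟨fun q => !₂[q 0, q 0 * q 1, s * q 1 ^ 2 + (-1) ^ (k + 1) * q 0 ^ k, q 1 ^ 3],
    EuclideanSpace.single 2 1, ⟨?_, ?_⟩, by simp, by simp, by simp, by simp, 1, Or.inl rfl, id,
    ⟨contDiff_id.smoothNear 0, rfl, by rw [fderiv_id]; exact Function.bijective_id⟩,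
    Eventually.of_forall fun q => ?_⟩
  · refine ContDiff.smoothNear (contDiff_euclidean.2 fun i => ?_) 0
    have h0 := contDiff_coord 0
    have h1 := contDiff_coord 1
    fin_cases i
    · exact h0
    · exact h0.mul h1
    · exact (contDiff_const.mul (h1.pow 2)).add (contDiff_const.mul (h0.pow k))
    · exact h1.pow 3
  · have h4 : (fun q : E2 => (EuclideanSpace.single 2 (-(q 0 ^ 4)) : E4)) =O[𝓝 0]
        fun q => ‖q‖ ^ 4 := by
      refine Asymptotics.IsBigO.of_bound 1 (Eventually.of_forall fun q => ?_)
      rw [PiLp.norm_single, norm_neg, norm_pow, norm_pow, norm_norm, one_mul]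
      exact pow_le_pow_left₀ (norm_nonneg _) (PiLp.norm_apply_le q 0) 4
    rcases hk with rfl | rfl | rfl
    · refine ⟨fun i j => if (i, j) = (0, 2) then s else if (i, j) = (2, 0) then -1 else 0,
        fun i j => if (i, j) = (0, 3) then 1 else 0, by simpa using hs0, by simp, ?_⟩
      refine (Asymptotics.isBigO_zero _ _).congr_left fun q => ?_
      ext i; fin_cases i <;> simp [normalFormJet]
      ring
    · refine ⟨fun i j => if (i, j) = (0, 2) then s else if (i, j) = (3, 0) then 1 else 0,
        fun i j => if (i, j) = (0, 3) then 1 else 0, by simpa using hs0, by simp, ?_⟩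
      refine (Asymptotics.isBigO_zero _ _).congr_left fun q => ?_
      ext i; fin_cases i <;> simp [normalFormJet]
      ring
    · refine ⟨fun i j => if (i, j) = (0, 2) then s else 0,
        fun i j => if (i, j) = (0, 3) then 1 else 0, by simpa using hs0, by simp, ?_⟩
      refine h4.congr_left fun q => ?_
      ext i; fin_cases i <;> simp [normalFormJet]
      ring
  · have hm : modelSubmersion k s (modelI1 q) = s * q 1 ^ 2 + (-1) ^ (k + 1) * q 0 ^ k := rfl
    refine Eq.trans ?_ hm.symm
    simp [inner_height, inner_E4]

/-! ### Singularities of the height function -/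

variable {f : E2 → E4} {b₂₀ b₁₁ b₀₂ c₂₀ : ℝ} {v : E4}

namespace HasTwoJet

variable (J : HasTwoJet f b₂₀ b₁₁ b₀₂ c₂₀) (h0 : v 0 = 0) (h3 : v 3 = 0) (h2 : v 2 ≠ 0)
include J

theorem smoothNear_height (v : E4) : SmoothNear (height f v) 0 := J.smooth.inner_const v

theorem secondDeriv_height (v : E4) (u w : E2) :
    secondDeriv (height f v) 0 u w = inner ℝ (secondDeriv f 0 u w) v := by
  rw [inner_height, secondDeriv_inner J.smooth]

include h0

theorem fderiv_height : fderiv ℝ (height f v) 0 = 0 := by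
  ext w
  rw [inner_height, fderiv_inner_const J.smooth, J.fderiv_eq, inner_E4, h0]
  simp

include h3 h2

theorem secondDeriv_height_ne_zero :
    secondDeriv (height f v) 0 (stdVec 1) (stdVec 1) ≠ 0 := by
  rw [J.secondDeriv_height, J.secondDeriv_eq, inner_E4, h0, h3]
  simpa [stdVec] using ⟨J.ne_zero, h2⟩

theorem isAsymptoticFor_height_iff {u : E2} : IsAsymptoticFor f u v ↔
    u ≠ 0 ∧ ∀ w, secondDeriv (height f v) 0 u w = 0 := by
  have hv : v ≠ 0 := fun hv => h2 (by rw [hv]; rfl)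
  simp only [J.isAsymptoticFor_iff, J.secondDeriv_height, ne_eq, hv, not_false_eq_true, h0, h3,
    true_and, and_self]

theorem isBinormal_iff : IsBinormal f v ↔ hessDet (height f v) 0 = 0 := by
  rw [hessDet_eq_zero_iff (J.smoothNear_height v) (J.secondDeriv_height_ne_zero h0 h3 h2)]
  exact exists_congr fun u => J.isAsymptoticFor_height_iff h0 h3 h2

theorem hasTypeA_one_height_iff : HasTypeA 1 (height f v) ↔ ¬ IsBinormal f v := by
  rw [J.isBinormal_iff h0 h3 h2, hasTypeA_one_iff (J.smoothNear_height v) (J.fderiv_height h0)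
    (J.secondDeriv_height_ne_zero h0 h3 h2)]

theorem isBinormal_of_hasTypeA {k : ℕ} (hk : 2 ≤ k) (hA : HasTypeA k (height f v)) :
    IsBinormal f v :=
  (J.isBinormal_iff h0 h3 h2).2 (hA.hessDet_eq_zero (J.smoothNear_height v) (J.fderiv_height h0)
    (J.secondDeriv_height_ne_zero h0 h3 h2) hk)

/-- A condition on height functions that, for each asymptotic direction, is equivalent to having
type `A_k` with `k ≥ 2`, may be tested on all the asymptotic directions of `v`. -/
theorem hasTypeA_iff_of_forall {k : ℕ} (hk : 2 ≤ k) {P : E2 → Prop}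
    (hP : ∀ u, IsAsymptoticFor f u v → (HasTypeA k (height f v) ↔ P u)) :
    HasTypeA k (height f v) ↔ IsBinormal f v ∧ ∀ u, IsAsymptoticFor f u v → P u := by
  constructor
  · exact fun hA => ⟨J.isBinormal_of_hasTypeA h0 h3 h2 hk hA, fun u hu => (hP u hu).1 hA⟩
  · rintro ⟨⟨u, hu⟩, h⟩
    exact (hP u hu).2 (h u hu)

theorem hasTypeA_two_height_iff {u : E2} (hu : IsAsymptoticFor f u v) :
    HasTypeA 2 (height f v) ↔ thirdDeriv (height f v) 0 u u u ≠ 0 := by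
  obtain ⟨hu0, hk⟩ := (J.isAsymptoticFor_height_iff h0 h3 h2).1 hu
  exact hasTypeA_two_iff (J.smoothNear_height v) (J.fderiv_height h0)
    (J.secondDeriv_height_ne_zero h0 h3 h2) hu0 hk

theorem hasTypeA_three_height_iff {u : E2} (hu : IsAsymptoticFor f u v) :
    HasTypeA 3 (height f v) ↔ thirdDeriv (height f v) 0 u u u = 0 ∧
      fderiv ℝ (hessCusp (height f v)) 0 u ≠ 0 := by
  obtain ⟨hu0, hk⟩ := (J.isAsymptoticFor_height_iff h0 h3 h2).1 hu
  exact hasTypeA_three_iff (J.smoothNear_height v) (J.fderiv_height h0)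
    (J.secondDeriv_height_ne_zero h0 h3 h2) hu0 hk

end HasTwoJet

namespace IsAssociated

variable {F : Type*} [NormedAddCommGroup F] [InnerProductSpace ℝ F] [FiniteDimensional ℝ F]
  {r : E2 → F} {dir : E4 → F} (A : IsAssociated f r dir)
  (J : HasTwoJet f b₂₀ b₁₁ b₀₂ c₂₀) {u : E2}
  (h0 : v 0 = 0) (h3 : v 3 = 0) (h2 : v 2 ≠ 0) (hu : IsAsymptoticFor f u v)
include A J

/-- The `xy` term of `f` shows in the normal curvature. -/
theorem regularII_ne_zero_of_ne_zero {u w : E2} (h : u 0 * w 1 + u 1 * w 0 ≠ 0) :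
    regularII r 0 u w ≠ 0 := by
  refine A.regularII_ne_zero J (n := EuclideanSpace.single 1 1)
    (J.mem_planeE.2 ⟨by simp, by simp⟩) ?_
  rw [J.secondDeriv_eq, inner_E4]
  simpa using h

include h0 h3 hu

theorem curveTorsion_eq_zero_iff_thirdDeriv (hb : b₂₀ ≠ 0) {c : ℝ → E2}
    (hc : IsNormalSection r u c) :
    curveTorsion (fun t => r (c t)) = 0 ↔ thirdDeriv (height f v) 0 u u u = 0 := by
  have hv : v ∈ planeE f := J.mem_planeE.2 ⟨h0, h3⟩
  obtain ⟨hu0, hu1⟩ := HasTwoJet.IsAsymptoticFor.ne_zero_of_ne_zero J hb hu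
  obtain ⟨-, hv0, -, hk⟩ := J.isAsymptoticFor_iff.1 hu
  rw [← A.inner_dir v hv]
  refine curveTorsion_eq_zero_iff A.smooth A.injective A.finrank hc ?_ (A.inner_fderiv J hv)
    (fun w => (A.inner_secondDeriv J hv u w).trans (hk w)) (A.regularII_ne_zero_of_ne_zero J ?_)
  · rw [← norm_ne_zero_iff, A.norm_dir v hv]
    exact norm_ne_zero_iff.2 hv0
  · have := mul_ne_zero hu0 hu1
    intro h
    apply this
    linarith [mul_comm (u 0) (u 1)]

theorem hasNormalTorsion_zero_iff (hb : b₂₀ ≠ 0) :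
    HasNormalTorsion r u 0 ↔ thirdDeriv (height f v) 0 u u u = 0 := by
  constructor
  · rintro ⟨c, hc, ht⟩
    exact (A.curveTorsion_eq_zero_iff_thirdDeriv J h0 h3 hu hb hc).1 ht
  · intro h
    obtain ⟨c, hc⟩ := exists_isNormalSection A.smooth A.injective u
    exact ⟨c, hc, (A.curveTorsion_eq_zero_iff_thirdDeriv J h0 h3 hu hb hc).2 h⟩

theorem exists_hasNormalTorsion_ne_zero_iff (hb : b₂₀ ≠ 0) :
    (∃ τ, HasNormalTorsion r u τ ∧ τ ≠ 0) ↔ thirdDeriv (height f v) 0 u u u ≠ 0 := by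
  constructor
  · rintro ⟨τ, ⟨c, hc, rfl⟩, hτ⟩
    rwa [ne_eq, A.curveTorsion_eq_zero_iff_thirdDeriv J h0 h3 hu hb hc] at hτ
  · intro h
    obtain ⟨c, hc⟩ := exists_isNormalSection A.smooth A.injective u
    exact ⟨_, ⟨c, hc, rfl⟩,
      fun ht => h ((A.curveTorsion_eq_zero_iff_thirdDeriv J h0 h3 hu hb hc).1 ht)⟩

include h2

theorem transversalToCuspidalEdge_height_iff (hv1 : ‖v‖ = 1) (hb : b₂₀ ≠ 0) :
    TransversalToCuspidalEdge r (0, dir v) u ↔ thirdDeriv (height f v) 0 u u u = 0 ∧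
      fderiv ℝ (hessCusp (height f v)) 0 u ≠ 0 := by
  have hv : v ∈ planeE f := J.mem_planeE.2 ⟨h0, h3⟩
  obtain ⟨hu0, hu1⟩ := HasTwoJet.IsAsymptoticFor.ne_zero_of_ne_zero J hb hu
  obtain ⟨hu', -, -, hk⟩ := J.isAsymptoticFor_iff.1 hu
  have hyy := J.secondDeriv_height_ne_zero h0 h3 h2
  rw [J.secondDeriv_height] at hyy
  rw [← A.inner_dir v hv]
  refine transversalToCuspidalEdge_iff A.smooth A.injective A.finrank
    ((A.norm_dir v hv).trans hv1) (A.inner_fderiv J hv) hu'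
    (fun w => (A.inner_secondDeriv J hv u w).trans (hk w))
    ((A.inner_secondDeriv J hv _ _).trans_ne hyy) (A.regularII_ne_zero_of_ne_zero J ?_)
  have := mul_ne_zero hu0 hu1
  intro h
  apply this
  linarith [mul_comm (u 0) (u 1)]

/-- At a parabolic point, along the asymptotic direction, the derivative of the resultant is a
nonzero multiple of the third derivative of the height function. -/
theorem resultant_eq_zero_and_fderiv_eq_zero_iff (hb : b₂₀ = 0) :
    resultant r 0 = 0 ∧
      (fderiv ℝ (resultant r) 0 u = 0 ↔ thirdDeriv (height f v) 0 u u u = 0) := by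
  have hv : v ∈ planeE f := J.mem_planeE.2 ⟨h0, h3⟩
  obtain ⟨hu', hv0, -, hk⟩ := J.isAsymptoticFor_iff.1 hu
  have hu1 := HasTwoJet.IsAsymptoticFor.eq_zero_of_eq_zero J hb hu
  have hue : u = u 0 • stdVec 0 := by
    have := E2.eq_of_coord (q := u)
    rwa [hu1, zero_smul, add_zero] at this
  have hu0 : u 0 ≠ 0 := fun h => hu' (by rw [hue, h, zero_smul])
  have hyy := J.secondDeriv_height_ne_zero h0 h3 h2
  rw [J.secondDeriv_height] at hyy
  have hII : regularII r 0 (stdVec 0) (stdVec 0) = 0 := A.regularII_eq_zero J fun n hn => by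
    obtain ⟨n0, n3⟩ := J.mem_planeE.1 hn
    rw [J.secondDeriv_eq, inner_E4, n0, n3]
    simp [stdVec, hb]
  have hII' : regularII r 0 (stdVec 0) (stdVec 1) ≠ 0 :=
    A.regularII_ne_zero_of_ne_zero J (by simp [stdVec])
  have hke : ∀ w, inner ℝ (secondDeriv r 0 (stdVec 0) w) (dir v) = 0 := fun w => by
    rw [A.inner_secondDeriv J hv]
    have := hk w
    rw [hue] at this
    simpa [secondDeriv, real_inner_smul_left, hu0] using this
  obtain ⟨κ, hκ, he⟩ := exists_fderiv_resultant A.smooth A.injective A.finrank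
    (norm_ne_zero_iff.1 ((A.norm_dir v hv).trans_ne (norm_ne_zero_iff.2 hv0)))
    (A.inner_fderiv J hv) hke ((A.inner_secondDeriv J hv _ _).trans_ne hyy) hII hII'
  rw [A.inner_dir v hv] at he
  refine ⟨by simp [resultant, areaProduct, hII], ?_⟩
  rw [hue, map_smul, he]
  simp [thirdDeriv, hκ, hu0]

theorem transversalToParabolicCurve_iff (hb : b₂₀ = 0) :
    TransversalToParabolicCurve r u ↔ thirdDeriv (height f v) 0 u u u ≠ 0 := by
  obtain ⟨hR, h⟩ := A.resultant_eq_zero_and_fderiv_eq_zero_iff J h0 h3 h2 hu hb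
  have hmem : u ∈ parabolicTangent r ↔ fderiv ℝ (resultant r) 0 u = 0 := Iff.rfl
  rw [ne_eq, ← h, TransversalToParabolicCurve, hmem]
  refine ⟨fun h => h.2, fun h' => ⟨⟨hR, fun hz => h' ?_⟩, h'⟩⟩
  rw [hz]; rfl

theorem tangentToParabolicCurve_iff (hb : b₂₀ = 0) (hreg : ParabolicCurveRegular r) :
    TangentToParabolicCurve r u ↔ thirdDeriv (height f v) 0 u u u = 0 := by
  rw [← (A.resultant_eq_zero_and_fderiv_eq_zero_iff J h0 h3 h2 hu hb).2]
  exact and_iff_right hreg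

end IsAssociated

theorem mainTheorem3 :
    (∀ (f : E2 → E4) (v : E4), IsNormalFormI1 f →
      ‖v‖ = 1 → v 0 = 0 → v 3 = 0 → v 2 ≠ 0 →
      -- position of the hyperplane
      tangentLine f ≤ hyperplane v ∧
      Submodule.span ℝ (tangentConeM f) ⊔ hyperplane v = ⊤ ∧
      planeE f ⊔ hyperplane v = ⊤ ∧
      -- the height function is singular, with the possible types
      fderiv ℝ (height f v) 0 = 0 ∧
      (codimension (height f v) ≤ 3 →
        HasTypeA 1 (height f v) ∨ HasTypeA 2 (height f v) ∨ HasTypeA 3 (height f v)) ∧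
      -- the models
      (∀ k ∈ ({2, 3, 4} : Set ℕ),
        (HasTypeA (k - 1) (height f v) ↔
          ∃ s : ℝ, (s = 1 ∨ s = -1) ∧ ModelledBy (height f v) k s)) ∧
      -- Morse singularities
      (HasTypeA 1 (height f v) ↔ ¬ IsBinormal f v) ∧
      -- elliptic points
      (IsEllipticPoint f → HasTypeA 1 (height f v)) ∧
      ∀ ψ : E2 → ℝ, IsLift f ψ →
        -- hyperbolic points
        (IsHyperbolicPoint f →
          (HasTypeA 2 (height f v) ↔
            IsBinormal f v ∧ ∀ u : E2, IsAsymptoticFor f u v →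
              ∃ τ : ℝ, HasNormalTorsion (assocSurface f ψ) u τ ∧ τ ≠ 0) ∧
          (HasTypeA 3 (height f v) ↔
            IsBinormal f v ∧ ∀ u : E2, IsAsymptoticFor f u v →
              HasNormalTorsion (assocSurface f ψ) u 0 ∧
              TransversalToCuspidalEdge (assocSurface f ψ) (0, assocDirection f ψ v) u)) ∧
        -- parabolic points
        (IsParabolicPoint f →
          (HasTypeA 2 (height f v) ↔
            IsBinormal f v ∧ ∀ u : E2, IsAsymptoticFor f u v →
              TransversalToParabolicCurve (assocSurface f ψ) u) ∧
          (ParabolicCurveRegular (assocSurface f ψ) → codimension (height f v) ≤ 3 →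
            (HasTypeA 3 (height f v) ↔
              IsBinormal f v ∧ ∀ u : E2, IsAsymptoticFor f u v →
                TangentToParabolicCurve (assocSurface f ψ) u)))) ∧
    -- each of the models occurs
    (∀ k ∈ ({2, 3, 4} : Set ℕ), ∀ s : ℝ, s = 1 ∨ s = -1 →
      ∃ (f : E2 → E4) (v : E4), IsNormalFormI1 f ∧
        ‖v‖ = 1 ∧ v 0 = 0 ∧ v 3 = 0 ∧ v 2 ≠ 0 ∧ ModelledBy (height f v) k s) := by
  refine ⟨fun f v hf hv1 h0 h3 h2 => ?_, fun k hk s hs => exists_modelledBy hk hs⟩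
  obtain ⟨b₂₀, b₁₁, b₀₂, c₂₀, J⟩ := hf.exists_hasTwoJet
  have hsm := J.smoothNear_height v
  have hd := J.fderiv_height h0
  have hyy := J.secondDeriv_height_ne_zero h0 h3 h2
  refine ⟨J.tangentLine_le_hyperplane h0,
    sup_hyperplane_eq_top (Submodule.subset_span J.single_mem_tangentConeM) ?_,
    sup_hyperplane_eq_top (x := EuclideanSpace.single 2 1)
      (J.mem_planeE.2 ⟨by simp, by simp⟩) (by simpa [inner_E4] using h2), hd,
    hasTypeA_of_codimension_le hsm hd hyy, fun k hk => ?_,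
    J.hasTypeA_one_height_iff h0 h3 h2, fun hell => ?_, fun ψ hψ => ?_⟩
  · simpa [inner_E4] using ⟨h2, J.ne_zero⟩
  · refine hasTypeA_iff_exists_modelledBy ?_ (by rcases hk with rfl | rfl | rfl <;> norm_num)
    rw [inner_height]
    simp [J.map_zero]
  · refine (J.hasTypeA_one_height_iff h0 h3 h2).2 fun ⟨u, hu⟩ => ?_
    have hmem : Submodule.span ℝ {u} ∈ asymptoticDirections f := ⟨u, v, hu, rfl⟩
    rw [hell] at hmem
    exact hmem
  · have A := J.isAssociated hψ
    refine ⟨fun hhyp => ?_, fun hpar => ?_⟩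
    · have hb := J.ne_zero_of_isHyperbolicPoint hhyp
      refine ⟨J.hasTypeA_iff_of_forall h0 h3 h2 le_rfl fun u hu => ?_,
        J.hasTypeA_iff_of_forall h0 h3 h2 (by norm_num) fun u hu => ?_⟩
      · rw [J.hasTypeA_two_height_iff h0 h3 h2 hu,
          A.exists_hasNormalTorsion_ne_zero_iff J h0 h3 hu hb]
      · rw [J.hasTypeA_three_height_iff h0 h3 h2 hu,
          A.hasNormalTorsion_zero_iff J h0 h3 hu hb,
          A.transversalToCuspidalEdge_height_iff J h0 h3 h2 hu hv1 hb]
        tauto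
    · have hb := J.eq_zero_of_isParabolicPoint hpar
      refine ⟨J.hasTypeA_iff_of_forall h0 h3 h2 le_rfl fun u hu => ?_, fun hreg hcod =>
        J.hasTypeA_iff_of_forall h0 h3 h2 (by norm_num) fun u hu => ?_⟩
      · rw [J.hasTypeA_two_height_iff h0 h3 h2 hu,
          A.transversalToParabolicCurve_iff J h0 h3 h2 hu hb]
      · rw [A.tangentToParabolicCurve_iff J h0 h3 h2 hu hb hreg]
        refine ⟨fun hA => ((J.hasTypeA_three_height_iff h0 h3 h2 hu).1 hA).1, fun ht => ?_⟩
        -- `v` is binormal and the third derivative vanishes: types `A_1` and `A_2` are excluded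
        rcases hasTypeA_of_codimension_le hsm hd hyy hcod with h | h | h
        · exact absurd ⟨u, hu⟩ ((J.hasTypeA_one_height_iff h0 h3 h2).1 h)
        · exact absurd ht ((J.hasTypeA_two_height_iff h0 h3 h2 hu).1 h)
        · exact h

end
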